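/- \textbf{Conventions.} Let $\mathbf{LCS}$ be the symmetric monoidal category of complete Hausdorff locally convex spaces over $\mathbb C$ and continuous linear maps, with the completed projective tensor product $\widehat\otimes$, unit object $\mathbb C$ and braiding $x\otimes y\mapsto y\otimes x$. A $\widehat\otimes$-algebra is an (associative, unital) algebra in $\mathbf{LCS}$; left and right (unital) $\widehat\otimes$-modules over it are modules in $\mathbf{LCS}$; $A\text{-}\mathbf{mod}$ is the category of left $\widehat\otimes$-modules over $A$. A Hopf $\widehat\otimes$-algebra is a Hopf algebra in $\mathbf{LCS}$. For a right $A$-$\widehat\otimes$-module $X$ and a left $A$-$\widehat\otimes$-module $Y$, $X\widehat\otimes_A Y$ is the completion of the quotient of $X\widehat\otimes Y$ by the closed linear span of the elements $x\cdot a\otimes y-x\otimes a\cdot y$. A morphism in $A\text{-}\mathbf{mod}$ is an admissible epimorphism if it has a continuous linear right inverse; $P\in A\text{-}\mathbf{mod}$ is projective if every morphism $P\to Y$ lifts along every admissible epimorphism $X\to Y$ in $A\text{-}\mathbf{mod}$. A projective resolution of $X$ is a complex $0\leftarrow X\leftarrow P_0\leftarrow P_1\leftarrow\cdots$ in $A\text{-}\mathbf{mod}$,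 with all $P_n$ projective, that splits as a complex of topological vector spaces, i.e. has a contracting homotopy consisting of continuous linear maps. For such a resolution, $\operatorname{Ext}^n_A(X,Y)=H^n({}_A\mathbf h(P_\bullet,Y))$, where ${}_A\mathbf h(P_n,Y)$ is the vector space of morphisms $P_n\to Y$ in $A\text{-}\mathbf{mod}$, and $\operatorname{Tor}^A_n(Z,X)=H_n(Z\,\widehat\otimes_A P_\bullet)$ with the quotient topology (cycles modulo boundaries, possibly not Hausdorff). The enveloping algebra is $A^e=A\widehat\otimes A^{\mathrm{op}}$. An $A$-$\widehat\otimes$-bimodule is a left $A^e$-$\widehat\otimes$-module, with $(a\otimes b)\cdot m=a\cdot m\cdot b$, and is also a right $A^e$-$\widehat\otimes$-module with $m\cdot(a\otimes b)=b\cdot m\cdot a$. A projective bimodule resolution of $A$ is a projective resolution of $A$ in $A^e\text{-}\mathbf{mod}$. For a bimodule $M$, $\mathcal H^n(A,M)=\operatorname{Ext}^n_{A^e}(A,M)$ and $\mathcal H_n(A,M)=\operatorname{Tor}_n^{A^e}(M,A)$. \textbf{Theorem.} Let $H$ be a Hopf $\widehat\otimes$-algebra with comultiplication $\Delta$, counit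 $\varepsilon$, and antipode $S$, and suppose that $S$ is invertible in $\mathbf{LCS}$ (i.e. is a topological isomorphism). Consider $\mathbb C$ as a left $H$-$\widehat\otimes$-module via $\varepsilon$. Let $E=(1\otimes S)\Delta\colon H\to H^e$, an algebra homomorphism, and let $H^e_E$ denote $H^e$ with its usual left $H^e$-module structure and the right $H$-module structure $u\cdot h=u\,E(h)$. For an $H$-$\widehat\otimes$-bimodule $M$, let ${}_EM$ be the left $H$-$\widehat\otimes$-module with $h\cdot m=E(h)\cdot m$, and $M_E$ the right $H$-$\widehat\otimes$-module with $m\cdot h=m\cdot E(h)$. (1) There is an isomorphism $\varphi\colon H^e_E\,\widehat\otimes_H\,\mathbb C\to H$ of left $H^e$-$\widehat\otimes$-modules with $\varphi\bigl((a\otimes b)\otimes c\bigr)=c\,ab$ for all $a,b\in H$ and $c\in\mathbb C$, such that for every projective resolution $0\leftarrow\mathbb C\leftarrow P_\bullet$ of $\mathbb C$ in $H\text{-}\mathbf{mod}$ the complex $$0\leftarrow H\leftarrow H^e_E\,\widehat\otimes_H\,P_\bullet ,$$ whose augmentation is the map $H^e_E\widehat\otimes_H P_0\to H^e_E\widehat\otimes_H\mathbb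 C$ followed by $\varphi$, is a projective bimodule resolution of $H$. (2) For each $n\ge 0$ there are isomorphisms $$\mathcal H^n(H,M)\cong\operatorname{Ext}^n_H(\mathbb C,{}_EM)\qquad\text{and}\qquad \mathcal H_n(H,M)\cong\operatorname{Tor}_n^H(M_E,\mathbb C),$$ natural in the $H$-$\widehat\otimes$-bimodule $M$, where the first is an isomorphism of vector spaces and the second an isomorphism of topological vector spaces. Here the left-hand sides may be computed from any projective bimodule resolution of $H$, and the right-hand sides from any projective resolution of $\mathbb C$ in $H\text{-}\mathbf{mod}$. -/

import Mathlib

open CategoryTheory MonoidalCategory TensorProduct Topology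
open scoped MonObj ComonObj HopfObj MonoidalLeftAction

universe u

noncomputable section

section Bilinear

variable {X Y Z : Type*} [AddCommGroup X] [Module ℂ X] [TopologicalSpace X] [PolynormableSpace ℂ X]
  [AddCommGroup Y] [Module ℂ Y] [TopologicalSpace Y] [PolynormableSpace ℂ Y]
  [AddCommGroup Z] [Module ℂ Z] [TopologicalSpace Z]

theorem exists_seminorm_of_mem_nhds {U : Set X} (hU : U ∈ 𝓝 (0 : X)) :
    ∃ p : Seminorm ℂ X, Continuous p ∧ ∀ x, p x < 1 → x ∈ U := by
  have hw := PolynormableSpace.withSeminorms ℂ X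
  obtain ⟨s, r, hr, h⟩ := (hw.mem_nhds_iff 0 U).1 hU
  have hc : Continuous ⇑(s.sup (fun p : {p : Seminorm ℂ X // Continuous p} => p.1)) := by
    have := hw.topologicalAddGroup
    have := hw.continuousSMul
    refine Seminorm.continuous (𝕜 := ℂ) (r := 1) ?_
    exact (hw.mem_nhds_iff 0 _).2 ⟨s, 1, one_pos, subset_rfl⟩
  refine ⟨(Real.toNNReal r⁻¹) • s.sup (fun p => p.1), ?_, fun x hx => h ?_⟩
  · exact continuous_const.mul hc
  · rw [Seminorm.mem_ball_zero]
    have h1 : (Real.toNNReal r⁻¹ : ℝ) * s.sup (fun p : {p : Seminorm ℂ X // Continuous p} => p.1) x < 1 := hx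
    rw [Real.coe_toNNReal _ (inv_nonneg.2 hr.le)] at h1
    rwa [inv_mul_lt_iff₀ hr, mul_one] at h1

theorem bilin_bound (B : X →ₗ[ℂ] Y →ₗ[ℂ] Z) (hB : Continuous fun p : X × Y => B p.1 p.2)
    {q : Seminorm ℂ Z} (hq : Continuous q) :
    ∃ (p₁ : Seminorm ℂ X) (p₂ : Seminorm ℂ Y), Continuous p₁ ∧ Continuous p₂ ∧
      ∀ x y, q (B x y) ≤ p₁ x * p₂ y := by
  have h0 : {p : X × Y | q (B p.1 p.2) < 1} ∈ 𝓝 ((0, 0) : X × Y) := by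
    refine (isOpen_lt (hq.comp hB) continuous_const).mem_nhds ?_
    simp
  rw [nhds_prod_eq, Filter.mem_prod_iff] at h0
  obtain ⟨U, hU, V, hV, hUV⟩ := h0
  obtain ⟨p₁, hp₁, h₁⟩ := exists_seminorm_of_mem_nhds hU
  obtain ⟨p₂, hp₂, h₂⟩ := exists_seminorm_of_mem_nhds hV
  refine ⟨p₁, p₂, hp₁, hp₂, fun x y => ?_⟩
  have key : ∀ r : ℝ, 0 < r → q (B x y) ≤ (p₁ x + r) * (p₂ y + r) := by
    intro r hr
    have ha : 0 < p₁ x + r := add_pos_of_nonneg_of_pos (apply_nonneg _ _) hr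
    have hb : 0 < p₂ y + r := add_pos_of_nonneg_of_pos (apply_nonneg _ _) hr
    have hx : ((p₁ x + r : ℝ) : ℂ)⁻¹ • x ∈ U := by
      apply h₁
      rw [map_smul_eq_mul, norm_inv, Complex.norm_real, Real.norm_of_nonneg ha.le,
        inv_mul_lt_iff₀ ha]
      linarith
    have hy : ((p₂ y + r : ℝ) : ℂ)⁻¹ • y ∈ V := by
      apply h₂
      rw [map_smul_eq_mul, norm_inv, Complex.norm_real, Real.norm_of_nonneg hb.le,
        inv_mul_lt_iff₀ hb]
      linarith
    have := hUV (Set.mk_mem_prod hx hy)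
    simp only [Set.mem_ofPred_eq, map_smul, LinearMap.smul_apply, map_smul_eq_mul, norm_inv,
      Complex.norm_real, Real.norm_of_nonneg ha.le, Real.norm_of_nonneg hb.le] at this
    rw [inv_mul_lt_iff₀ hb, inv_mul_lt_iff₀ ha] at this
    linarith
  have hl : Filter.Tendsto (fun r : ℝ => (p₁ x + r) * (p₂ y + r)) (𝓝[>] 0)
      (𝓝 (p₁ x * p₂ y)) := by
    have : Continuous (fun r : ℝ => (p₁ x + r) * (p₂ y + r)) := by fun_prop
    exact tendsto_nhdsWithin_of_tendsto_nhds (by simpa using this.tendsto 0)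
  exact ge_of_tendsto hl (by filter_upwards [self_mem_nhdsWithin] with r hr using key r hr)

theorem bilin_continuous [PolynormableSpace ℂ Z] (B : X →ₗ[ℂ] Y →ₗ[ℂ] Z)
    (h : ∀ q : Seminorm ℂ Z, Continuous q → ∃ (p₁ : Seminorm ℂ X) (p₂ : Seminorm ℂ Y),
      Continuous p₁ ∧ Continuous p₂ ∧ ∀ x y, q (B x y) ≤ p₁ x * p₂ y) :
    Continuous fun p : X × Y => B p.1 p.2 := by
  have := (PolynormableSpace.withSeminorms ℂ X).topologicalAddGroup
  have := (PolynormableSpace.withSeminorms ℂ Y).topologicalAddGroup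
  rw [continuous_iff_continuousAt]
  rintro ⟨x₀, y₀⟩
  refine ((PolynormableSpace.withSeminorms ℂ Z).tendsto_nhds _ _).2 ?_
  rintro ⟨q, hq⟩ r hr
  obtain ⟨p₁, p₂, h₁, h₂, hb⟩ := h q hq
  have hc : Continuous fun p : X × Y => p₁ (p.1 - x₀) * p₂ (p.2 - y₀) + p₁ x₀ * p₂ (p.2 - y₀)
      + p₁ (p.1 - x₀) * p₂ y₀ := by fun_prop
  have ht := (hc.tendsto (x₀, y₀)).eventually_lt_const (u := r) (by simpa using hr)
  filter_upwards [ht] with p hp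
  refine lt_of_le_of_lt ?_ hp
  have e : B p.1 p.2 - B x₀ y₀ = B (p.1 - x₀) (p.2 - y₀) + B x₀ (p.2 - y₀) + B (p.1 - x₀) y₀ := by
    simp only [map_sub, LinearMap.sub_apply]; abel
  show q (B p.1 p.2 - B x₀ y₀) ≤ _
  rw [e]
  refine (map_add_le_add q _ _).trans (add_le_add ((map_add_le_add q _ _).trans
    (add_le_add (hb _ _) (hb _ _))) (hb _ _))

theorem linear_continuous {X Z : Type*} [AddCommGroup X] [Module ℂ X] [TopologicalSpace X]
    [IsTopologicalAddGroup X]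
    [AddCommGroup Z] [Module ℂ Z] [TopologicalSpace Z] [PolynormableSpace ℂ Z] (f : X →ₗ[ℂ] Z)
    (h : ∀ q : Seminorm ℂ Z, Continuous q → Continuous (q.comp f)) : Continuous f := by
  have := (PolynormableSpace.withSeminorms ℂ Z).topologicalAddGroup
  refine continuous_of_continuousAt_zero f.toAddMonoidHom ?_
  refine ((PolynormableSpace.withSeminorms ℂ Z).tendsto_nhds _ _).2 ?_
  rintro ⟨q, hq⟩ r hr
  have := ((h q hq).tendsto 0).eventually_lt_const (u := r) (by simpa using hr)
  filter_upwards [this] with x hx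
  simpa using hx

/-- Local convexity from enough continuous seminorms. -/
theorem polynormable_of_seminorms {X : Type*} [AddCommGroup X] [Module ℂ X] [TopologicalSpace X]
    [IsTopologicalAddGroup X]
    (h : ∀ U ∈ 𝓝 (0 : X), ∃ p : Seminorm ℂ X, Continuous p ∧ ∀ x, p x < 1 → x ∈ U) :
    PolynormableSpace ℂ X where
  withSeminorms' := by
    rw [SeminormFamily.withSeminorms_iff_nhds_eq_iInf]
    refine le_antisymm ?_ ?_
    · simp_rw [le_iInf_iff, ← Filter.tendsto_iff_comap]
      intro ⟨p, hp⟩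
      exact hp.tendsto' 0 0 (map_zero _)
    · intro U hU
      obtain ⟨p, hp, hpU⟩ := h U hU
      refine Filter.mem_iInf_of_mem ⟨p, hp⟩ ?_
      exact ⟨Set.Iio 1, Iio_mem_nhds one_pos, fun x hx => hpU x hx⟩

end Bilinear

/-- The algebraic tensor product, to carry the projective locally convex topology. -/
def ProjTensor (X Y : Type u) [AddCommGroup X] [Module ℂ X] [AddCommGroup Y] [Module ℂ Y] :
    Type u := X ⊗[ℂ] Y

namespace ProjTensor

section Alg

variable (X Y : Type u) [AddCommGroup X] [Module ℂ X] [AddCommGroup Y] [Module ℂ Y]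

instance : AddCommGroup (ProjTensor X Y) := inferInstanceAs (AddCommGroup (X ⊗[ℂ] Y))
instance : Module ℂ (ProjTensor X Y) := inferInstanceAs (Module ℂ (X ⊗[ℂ] Y))

/-- The canonical bilinear map. -/
def mk : X →ₗ[ℂ] Y →ₗ[ℂ] ProjTensor X Y := TensorProduct.mk ℂ X Y

variable {X Y}

@[elab_as_elim]
theorem induction {P : ProjTensor X Y → Prop} (w : ProjTensor X Y) (h0 : P 0)
    (h1 : ∀ x y, P (mk X Y x y)) (h2 : ∀ v w, P v → P w → P (v + w)) : P w :=
  TensorProduct.induction_on w h0 h1 h2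

/-- The linear map on the algebraic tensor product given by a bilinear map. -/
def lift {Z : Type*} [AddCommGroup Z] [Module ℂ Z] (B : X →ₗ[ℂ] Y →ₗ[ℂ] Z) :
    ProjTensor X Y →ₗ[ℂ] Z := TensorProduct.lift B

theorem lift_mk {Z : Type*} [AddCommGroup Z] [Module ℂ Z] (B : X →ₗ[ℂ] Y →ₗ[ℂ] Z) (x : X) (y : Y) :
    lift B (mk X Y x y) = B x y := TensorProduct.lift.tmul _ _

/-- The projective tensor product `p₁ ⊗ p₂` of two seminorms: the largest seminorm `r` with
`r (x ⊗ y) ≤ p₁ x * p₂ y`. -/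
def seminorm (p₁ : Seminorm ℂ X) (p₂ : Seminorm ℂ Y) : Seminorm ℂ (ProjTensor X Y) :=
  sSup {r | ∀ x y, r (mk X Y x y) ≤ p₁ x * p₂ y}

theorem bddAbove (p₁ : Seminorm ℂ X) (p₂ : Seminorm ℂ Y) :
    BddAbove {r : Seminorm ℂ (ProjTensor X Y) | ∀ x y, r (mk X Y x y) ≤ p₁ x * p₂ y} := by
  rw [Seminorm.bddAbove_iff]
  have : ∀ w : ProjTensor X Y, ∃ C : ℝ, ∀ r : Seminorm ℂ (ProjTensor X Y),
      (∀ x y, r (mk X Y x y) ≤ p₁ x * p₂ y) → r w ≤ C := by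
    intro w
    induction w using induction with
    | h0 => exact ⟨0, fun r _ => by simp⟩
    | h1 x y => exact ⟨_, fun r hr => hr x y⟩
    | h2 v w hv hw =>
      obtain ⟨C, hC⟩ := hv
      obtain ⟨D, hD⟩ := hw
      exact ⟨C + D, fun r hr => (map_add_le_add r _ _).trans (add_le_add (hC r hr) (hD r hr))⟩
  choose C hC using this
  refine ⟨C, ?_⟩
  rintro _ ⟨r, hr, rfl⟩ w
  exact hC w r hr

theorem le_seminorm {p₁ : Seminorm ℂ X} {p₂ : Seminorm ℂ Y} {r : Seminorm ℂ (ProjTensor X Y)}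
    (hr : ∀ x y, r (mk X Y x y) ≤ p₁ x * p₂ y) : r ≤ seminorm p₁ p₂ :=
  le_csSup (bddAbove p₁ p₂) hr

theorem seminorm_mk_le (p₁ : Seminorm ℂ X) (p₂ : Seminorm ℂ Y) (x : X) (y : Y) :
    seminorm p₁ p₂ (mk X Y x y) ≤ p₁ x * p₂ y := by
  rw [seminorm, Seminorm.sSup_apply (bddAbove p₁ p₂)]
  have : Nonempty {r : Seminorm ℂ (ProjTensor X Y) | ∀ x y, r (mk X Y x y) ≤ p₁ x * p₂ y} :=
    ⟨⟨0, fun x y => mul_nonneg (apply_nonneg _ _) (apply_nonneg _ _)⟩⟩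
  exact ciSup_le fun r => r.2 x y

theorem le_mul_seminorm {p₁ : Seminorm ℂ X} {p₂ : Seminorm ℂ Y} {r : Seminorm ℂ (ProjTensor X Y)}
    {C : ℝ} (hC : 0 ≤ C) (hr : ∀ x y, r (mk X Y x y) ≤ C * (p₁ x * p₂ y)) (w : ProjTensor X Y) :
    r w ≤ C * seminorm p₁ p₂ w := by
  rcases hC.eq_or_lt with rfl | hC
  · rw [zero_mul]
    induction w using induction with
    | h0 => simp
    | h1 x y => simpa using hr x y
    | h2 v w hv hw => exact (map_add_le_add r _ _).trans (by linarith)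
  · have h : (Real.toNNReal C⁻¹) • r ≤ seminorm p₁ p₂ := by
      refine le_seminorm fun x y => ?_
      show (Real.toNNReal C⁻¹ : ℝ) * r _ ≤ _
      rw [Real.coe_toNNReal _ (inv_nonneg.2 hC.le), inv_mul_le_iff₀ hC]
      exact hr x y
    have h' : (Real.toNNReal C⁻¹ : ℝ) * r w ≤ seminorm p₁ p₂ w := h w
    rwa [Real.coe_toNNReal _ (inv_nonneg.2 hC.le), inv_mul_le_iff₀ hC] at h'

end Alg

section Top

variable (X Y : Type u) [AddCommGroup X] [Module ℂ X] [TopologicalSpace X]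
  [AddCommGroup Y] [Module ℂ Y] [TopologicalSpace Y]

/-- The family of the seminorms `p₁ ⊗ p₂`, for continuous seminorms `p₁` and `p₂`. -/
def family : SeminormFamily ℂ (ProjTensor X Y)
    ({p : Seminorm ℂ X // Continuous p} × {p : Seminorm ℂ Y // Continuous p}) :=
  fun p => seminorm p.1.1 p.2.1

/-- The projective topology: it is generated by the seminorms `p₁ ⊗ p₂`. -/
instance : TopologicalSpace (ProjTensor X Y) := (family X Y).moduleFilterBasis.topology

theorem withSeminorms : WithSeminorms (family X Y) := ⟨rfl⟩

instance : PolynormableSpace ℂ (ProjTensor X Y) := (withSeminorms X Y).toPolynormableSpace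
instance : IsTopologicalAddGroup (ProjTensor X Y) := (withSeminorms X Y).topologicalAddGroup
instance : ContinuousSMul ℂ (ProjTensor X Y) := (withSeminorms X Y).continuousSMul
instance : UniformSpace (ProjTensor X Y) := IsTopologicalAddGroup.rightUniformSpace _
instance : IsUniformAddGroup (ProjTensor X Y) := isUniformAddGroup_of_addCommGroup

variable {X Y}

theorem continuous_seminorm {p₁ : Seminorm ℂ X} {p₂ : Seminorm ℂ Y} (h₁ : Continuous p₁)
    (h₂ : Continuous p₂) : Continuous (seminorm p₁ p₂) :=
  (withSeminorms X Y).continuous_seminorm (⟨p₁, h₁⟩, ⟨p₂, h₂⟩)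

/-- The topology is the intended one: a seminorm is continuous as soon as it is dominated on
elementary tensors by a product of continuous seminorms. -/
theorem continuous_of_le {r : Seminorm ℂ (ProjTensor X Y)} {p₁ : Seminorm ℂ X} {p₂ : Seminorm ℂ Y}
    (h₁ : Continuous p₁) (h₂ : Continuous p₂) (hr : ∀ x y, r (mk X Y x y) ≤ p₁ x * p₂ y) :
    Continuous r :=
  Seminorm.continuous_of_le (continuous_seminorm h₁ h₂) (le_seminorm hr)

variable [PolynormableSpace ℂ X] [PolynormableSpace ℂ Y]

theorem continuous_mk : Continuous fun p : X × Y => mk X Y p.1 p.2 := by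
  refine bilin_continuous (mk X Y) fun q hq => ?_
  have hw := withSeminorms X Y
  obtain ⟨s, C, -, h⟩ := Seminorm.bound_of_continuous hw q hq
  classical
  have : ∀ s : Finset _, ∃ (p₁ : Seminorm ℂ X) (p₂ : Seminorm ℂ Y), Continuous p₁ ∧ Continuous p₂ ∧
      ∀ x y, s.sup (family X Y) (mk X Y x y) ≤ p₁ x * p₂ y := by
    intro s
    induction s using Finset.induction_on with
    | empty => exact ⟨0, 0, continuous_const, continuous_const, fun x y => by simp⟩
    | insert i s hi ih =>
      obtain ⟨p₁, p₂, h₁, h₂, ih⟩ := ih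
      refine ⟨p₁ + i.1.1, p₂ + i.2.1, h₁.add i.1.2, h₂.add i.2.2, fun x y => ?_⟩
      have e := seminorm_mk_le i.1.1 i.2.1 x y
      rw [Finset.sup_insert]
      have := ih x y
      have a := apply_nonneg p₁ x
      have b := apply_nonneg p₂ y
      have c := apply_nonneg i.1.1 x
      have d := apply_nonneg i.2.1 y
      show max (seminorm i.1.1 i.2.1 (mk X Y x y)) _ ≤ (p₁ x + i.1.1 x) * (p₂ y + i.2.1 y)
      refine max_le ?_ ?_ <;> nlinarith [mul_nonneg a b, mul_nonneg a d, mul_nonneg c b, mul_nonneg c d]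
  obtain ⟨p₁, p₂, h₁, h₂, hs⟩ := this s
  refine ⟨C • p₁, p₂, continuous_const.mul h₁, h₂, fun x y => (h _).trans ?_⟩
  show (C : ℝ) * _ ≤ ((C : ℝ) * p₁ x) * p₂ y
  rw [mul_assoc]
  exact mul_le_mul_of_nonneg_left (hs x y) C.2

theorem continuous_lift {Z : Type*} [AddCommGroup Z] [Module ℂ Z] [TopologicalSpace Z]
    [PolynormableSpace ℂ Z] (B : X →ₗ[ℂ] Y →ₗ[ℂ] Z) (hB : Continuous fun p : X × Y => B p.1 p.2) :
    Continuous (lift B) := by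
  refine linear_continuous _ fun q hq => ?_
  obtain ⟨p₁, p₂, h₁, h₂, h⟩ := bilin_bound B hB hq
  refine continuous_of_le h₁ h₂ fun x y => ?_
  rw [Seminorm.comp_apply, lift_mk]
  exact h x y

end Top

end ProjTensor

section completion

open UniformSpace

section Completion

variable {E : Type u} [AddCommGroup E] [Module ℂ E] [UniformSpace E] [IsUniformAddGroup E]
  [PolynormableSpace ℂ E]

instance (priority := low) : UniformContinuousConstSMul ℂ E :=
  have := (PolynormableSpace.withSeminorms ℂ E).continuousSMul
  uniformContinuousConstSMul_of_continuousConstSMul ℂ E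

/-- The extension of a continuous seminorm to the completion. -/
def completionSeminorm (p : Seminorm ℂ E) (hp : Continuous p) : Seminorm ℂ (Completion E) :=
  have hu : UniformContinuous p := Seminorm.uniformContinuous_of_continuousAt_zero hp.continuousAt
  have hc : Continuous (Completion.extension p) := Completion.continuous_extension
  Seminorm.of (Completion.extension p)
    (fun v w => by
      refine Completion.induction_on₂ v w (isClosed_le (by fun_prop) (by fun_prop)) fun a b => ?_
      rw [← Completion.coe_add, Completion.extension_coe hu, Completion.extension_coe hu,
        Completion.extension_coe hu]
      exact map_add_le_add p a b)
    (fun c v => by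
      refine Completion.induction_on v (isClosed_eq (hc.comp (continuous_const_smul c))
        (by fun_prop)) fun a => ?_
      rw [← Completion.coe_smul, Completion.extension_coe hu, Completion.extension_coe hu,
        map_smul_eq_mul])

theorem completionSeminorm_coe (p : Seminorm ℂ E) (hp : Continuous p) (x : E) :
    completionSeminorm p hp (x : Completion E) = p x :=
  Completion.extension_coe (Seminorm.uniformContinuous_of_continuousAt_zero hp.continuousAt) x

theorem continuous_completionSeminorm (p : Seminorm ℂ E) (hp : Continuous p) :
    Continuous (completionSeminorm p hp) :=
  (Completion.continuous_extension : Continuous (Completion.extension p))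

instance : PolynormableSpace ℂ (Completion E) := by
  refine polynormable_of_seminorms fun U hU => ?_
  obtain ⟨V, hV, hVc, hVU⟩ := exists_mem_nhds_isClosed_subset hU
  have hV' : ((↑) : E → Completion E) ⁻¹' V ∈ 𝓝 (0 : E) :=
    (Completion.continuous_coe E).continuousAt.preimage_mem_nhds (by rwa [Completion.coe_zero])
  obtain ⟨p, hp, h⟩ := exists_seminorm_of_mem_nhds hV'
  refine ⟨completionSeminorm p hp, continuous_completionSeminorm p hp, fun x hx => hVU ?_⟩
  have ho : IsOpen {y : Completion E | completionSeminorm p hp y < 1} :=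
    isOpen_lt (continuous_completionSeminorm p hp) continuous_const
  have hd := (Completion.denseRange_coe (α := E)).open_subset_closure_inter ho hx
  refine hVc.closure_subset_iff.2 ?_ hd
  rintro _ ⟨hy, a, rfl⟩
  exact h a (by simpa [completionSeminorm_coe] using hy)

/-- The canonical map to the completion. -/
def toCompletion (E : Type u) [AddCommGroup E] [Module ℂ E] [UniformSpace E] [IsUniformAddGroup E]
    [PolynormableSpace ℂ E] : E →L[ℂ] Completion E where
  toFun := (↑)
  map_add' := Completion.coe_add
  map_smul' := Completion.coe_smul
  cont := Completion.continuous_coe E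

variable {Z : Type*} [AddCommGroup Z] [Module ℂ Z] [UniformSpace Z] [IsUniformAddGroup Z]
  [PolynormableSpace ℂ Z] [CompleteSpace Z] [T0Space Z]

theorem completion_lin_ext {f g : Completion E →L[ℂ] Z}
    (h : ∀ x : E, f (toCompletion E x) = g (toCompletion E x)) : f = g := by
  ext w
  exact Completion.induction_on w (isClosed_eq f.continuous g.continuous) h

/-- The extension of a continuous linear map to the completion. -/
def completionLift (f : E →L[ℂ] Z) : Completion E →L[ℂ] Z where
  toFun := Completion.extension f
  map_add' v w := by
    have hu := f.uniformContinuous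
    refine Completion.induction_on₂ v w (isClosed_eq (by fun_prop) (by fun_prop)) fun a b => ?_
    rw [← Completion.coe_add, Completion.extension_coe hu, Completion.extension_coe hu,
      Completion.extension_coe hu, map_add]
  map_smul' c v := by
    have hu := f.uniformContinuous
    have := (PolynormableSpace.withSeminorms ℂ Z).continuousSMul
    refine Completion.induction_on v (isClosed_eq
      (Completion.continuous_extension.comp (continuous_const_smul c))
      (Completion.continuous_extension.const_smul c)) fun a => ?_
    rw [← Completion.coe_smul, Completion.extension_coe hu, Completion.extension_coe hu,
      map_smul, RingHom.id_apply]
  cont := Completion.continuous_extension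

theorem completionLift_coe (f : E →L[ℂ] Z) (x : E) :
    completionLift f (toCompletion E x) = f x :=
  Completion.extension_coe f.uniformContinuous x

variable {Y : Type*} [AddCommGroup Y] [Module ℂ Y] [TopologicalSpace Y] [PolynormableSpace ℂ Y]

/-- The extension of a continuous bilinear map to the completion of the second factor. -/
def completionLift₂ (B : Y →ₗ[ℂ] E →ₗ[ℂ] Z) (hB : Continuous fun p : Y × E => B p.1 p.2) :
    Y →ₗ[ℂ] Completion E →ₗ[ℂ] Z where
  toFun y := (completionLift ⟨B y, hB.comp (Continuous.prodMk_right y)⟩).toLinearMap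
  map_add' y y' := by
    have := (PolynormableSpace.withSeminorms ℂ Z).continuousSMul
    rw [← ContinuousLinearMap.toLinearMap_add]
    congr 1
    refine completion_lin_ext fun x => ?_
    rw [completionLift_coe, add_apply, completionLift_coe, completionLift_coe]
    exact congrArg (· x) (map_add B y y')
  map_smul' c y := by
    have := (PolynormableSpace.withSeminorms ℂ Z).continuousSMul
    rw [RingHom.id_apply, ← ContinuousLinearMap.toLinearMap_smul]
    congr 1
    refine completion_lin_ext fun x => ?_
    rw [completionLift_coe, smul_apply, completionLift_coe]
    exact congrArg (· x) (map_smul B c y)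

theorem completionLift₂_coe (B : Y →ₗ[ℂ] E →ₗ[ℂ] Z) (hB : Continuous fun p : Y × E => B p.1 p.2)
    (y : Y) (x : E) : completionLift₂ B hB y (toCompletion E x) = B y x :=
  completionLift_coe _ _

theorem continuous_completionLift₂ (B : Y →ₗ[ℂ] E →ₗ[ℂ] Z)
    (hB : Continuous fun p : Y × E => B p.1 p.2) :
    Continuous fun p : Y × Completion E => completionLift₂ B hB p.1 p.2 := by
  refine bilin_continuous _ fun q hq => ?_
  obtain ⟨p₁, p₂, h₁, h₂, h⟩ := bilin_bound B hB hq
  refine ⟨p₁, completionSeminorm p₂ h₂, h₁, continuous_completionSeminorm p₂ h₂, fun y w => ?_⟩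
  have hc : Continuous (completionLift₂ B hB y) := (completionLift _).continuous
  refine Completion.induction_on w (isClosed_le (hq.comp hc)
    (continuous_const.mul (continuous_completionSeminorm p₂ h₂))) fun x => ?_
  rw [completionSeminorm_coe]
  exact (congrArg q (completionLift₂_coe B hB y x)).trans_le (h y x)

/-- A trilinear jointly continuous map gives a jointly continuous bilinear map on the
projective tensor product of the last two arguments. -/
theorem continuous_lift_trilinear {X₁ X₂ : Type u} {Y Z : Type*} [AddCommGroup X₁] [Module ℂ X₁] [TopologicalSpace X₁] [PolynormableSpace ℂ X₁]
    [AddCommGroup X₂] [Module ℂ X₂] [TopologicalSpace X₂] [PolynormableSpace ℂ X₂]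
    [AddCommGroup Y] [Module ℂ Y] [TopologicalSpace Y] [PolynormableSpace ℂ Y]
    [AddCommGroup Z] [Module ℂ Z] [TopologicalSpace Z] [PolynormableSpace ℂ Z]
    (B : Y →ₗ[ℂ] ProjTensor X₁ X₂ →ₗ[ℂ] Z)
    (h : ∀ q : Seminorm ℂ Z, Continuous q → ∃ (p₀ : Seminorm ℂ Y) (p₁ : Seminorm ℂ X₁)
      (p₂ : Seminorm ℂ X₂), Continuous p₀ ∧ Continuous p₁ ∧ Continuous p₂ ∧
        ∀ y x₁ x₂, q (B y (ProjTensor.mk X₁ X₂ x₁ x₂)) ≤ p₀ y * (p₁ x₁ * p₂ x₂)) :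
    Continuous fun p : Y × ProjTensor X₁ X₂ => B p.1 p.2 := by
  refine bilin_continuous B fun q hq => ?_
  obtain ⟨p₀, p₁, p₂, h₀, h₁, h₂, hb⟩ := h q hq
  refine ⟨p₀, ProjTensor.seminorm p₁ p₂, h₀, ProjTensor.continuous_seminorm h₁ h₂, fun y w => ?_⟩
  exact ProjTensor.le_mul_seminorm (r := q.comp (B y)) (apply_nonneg _ _) (hb y) w

end Completion

section Quotient

variable {E : Type u} [AddCommGroup E] [Module ℂ E] [TopologicalSpace E] [PolynormableSpace ℂ E]

/-- A quotient of a locally convex space is locally convex. -/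
theorem polynormable_quotient [IsTopologicalAddGroup E] (N : Submodule ℂ E) : PolynormableSpace ℂ (E ⧸ N) := by
  have := (PolynormableSpace.withSeminorms ℂ E).continuousSMul
  refine polynormable_of_seminorms fun U hU => ?_
  have hU' : N.mkQ ⁻¹' U ∈ 𝓝 (0 : E) :=
    N.mkQL.continuous.continuousAt.preimage_mem_nhds (by simpa using hU)
  obtain ⟨p, hp, h⟩ := exists_seminorm_of_mem_nhds hU'
  have hz (z : E ⧸ N) : ∃ x, N.mkQ x = z := N.mkQ_surjective z
  have hbd (z : E ⧸ N) : BddBelow (Set.range fun x : {x // N.mkQ x = z} => p x) :=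
    ⟨0, by rintro _ ⟨x, rfl⟩; exact apply_nonneg _ _⟩
  have hne (z : E ⧸ N) : Nonempty {x // N.mkQ x = z} := let ⟨x, hx⟩ := hz z; ⟨⟨x, hx⟩⟩
  let r : Seminorm ℂ (E ⧸ N) := Seminorm.ofSMulLE (fun z => ⨅ x : {x // N.mkQ x = z}, p x)
    (by
      refine le_antisymm ((ciInf_le (hbd 0) ⟨0, map_zero _⟩).trans (by simp)) ?_
      exact le_ciInf fun x => apply_nonneg _ _)
    (fun z w => by
      refine le_ciInf_add_ciInf fun x y => ?_
      exact (ciInf_le (hbd _) ⟨x.1 + y.1, by rw [map_add, x.2, y.2]⟩).trans (map_add_le_add p _ _))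
    (fun c z => by
      rw [Real.mul_iInf_of_nonneg (norm_nonneg c)]
      refine le_ciInf fun x => ?_
      exact (ciInf_le (hbd _) ⟨c • x.1, by rw [map_smul, x.2]⟩).trans (map_smul_eq_mul p _ _).le)
  have hr (x : E) : r (N.mkQ x) ≤ p x := ciInf_le (hbd _) (⟨x, rfl⟩ : {y // N.mkQ y = N.mkQ x})
  refine ⟨r, ?_, fun z hzr => ?_⟩
  · refine N.isOpenQuotientMap_mkQ.isQuotientMap.continuous_iff.2 ?_
    exact Seminorm.continuous_of_le (p := r.comp N.mkQ) hp hr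
  · obtain ⟨⟨x, hx⟩, hlt⟩ := exists_lt_of_ciInf_lt hzr
    rw [← hx]
    exact h x hlt

end Quotient

end completion

/-- A complete Hausdorff locally convex space over `ℂ`; local convexity is the condition that the
topology is generated by the continuous seminorms. -/
structure LCS : Type (u + 1) where
  carrier : Type u
  [addCommGroup : AddCommGroup carrier]
  [module : Module ℂ carrier]
  [uniformSpace : UniformSpace carrier]
  [isUniformAddGroup : IsUniformAddGroup carrier]
  [locallyConvex : PolynormableSpace ℂ carrier]
  [completeSpace : CompleteSpace carrier]
  [t2Space : T2Space carrier]

namespace LCS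

instance : CoeSort LCS.{u} (Type u) := ⟨LCS.carrier⟩

attribute [instance] addCommGroup module uniformSpace isUniformAddGroup locallyConvex
  completeSpace t2Space

instance (X : LCS.{u}) : ContinuousSMul ℂ X :=
  (PolynormableSpace.withSeminorms ℂ X).continuousSMul

instance (X : LCS.{u}) : IsTopologicalAddGroup X := IsUniformAddGroup.to_topologicalAddGroup

/-- Morphisms are the continuous linear maps. -/
@[ext]
structure Hom (X Y : LCS.{u}) where
  hom : X →L[ℂ] Y

instance : Category LCS.{u} where
  Hom := Hom
  id X := ⟨ContinuousLinearMap.id ℂ X⟩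
  comp f g := ⟨g.hom.comp f.hom⟩

/-- The morphism given by a continuous linear map. -/
def ofHom {X Y : LCS.{u}} (f : X →L[ℂ] Y) : X ⟶ Y := ⟨f⟩

@[simp] theorem ofHom_hom {X Y : LCS.{u}} (f : X →L[ℂ] Y) : (ofHom f).hom = f := rfl
@[simp] theorem id_apply (X : LCS.{u}) (x : X) : (𝟙 X : X ⟶ X).hom x = x := rfl
@[simp] theorem comp_apply {X Y Z : LCS.{u}} (f : X ⟶ Y) (g : Y ⟶ Z) (x : X) :
    (f ≫ g).hom x = g.hom (f.hom x) := rfl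

theorem hom_ext {X Y : LCS.{u}} {f g : X ⟶ Y} (h : ∀ x, f.hom x = g.hom x) : f = g :=
  Hom.ext (ContinuousLinearMap.ext h)

/-- The completed projective tensor product. -/
def tens (X Y : LCS.{u}) : LCS.{u} where
  carrier := UniformSpace.Completion (ProjTensor X Y)

section tens

variable {X Y Z W V : LCS.{u}}

/-- The canonical bilinear map `X × Y → X ⊗̂ Y`. -/
def tmulₗ (X Y : LCS.{u}) : X →ₗ[ℂ] Y →ₗ[ℂ] tens X Y :=
  (ProjTensor.mk X Y).compr₂ (toCompletion (ProjTensor X Y)).toLinearMap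

/-- The elementary tensor `x ⊗ y` in `X ⊗̂ Y`. -/
def tmul (x : X) (y : Y) : tens X Y := tmulₗ X Y x y

theorem continuous_tmul : Continuous fun p : X × Y => tmulₗ X Y p.1 p.2 :=
  (toCompletion (ProjTensor X Y)).continuous.comp ProjTensor.continuous_mk

theorem tmul_add (x : X) (y y' : Y) : tmul x (y + y') = tmul x y + tmul x y' :=
  map_add (tmulₗ X Y x) y y'
theorem add_tmul (x x' : X) (y : Y) : tmul (x + x') y = tmul x y + tmul x' y :=
  LinearMap.map_add₂ (tmulₗ X Y) x x' y
theorem tmul_smul (c : ℂ) (x : X) (y : Y) : tmul x (c • y) = c • tmul x y :=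
  map_smul (tmulₗ X Y x) c y
theorem smul_tmul (c : ℂ) (x : X) (y : Y) : tmul (c • x) y = c • tmul x y :=
  LinearMap.map_smul₂ (tmulₗ X Y) c x y

/-- `y ↦ x ⊗ y`. -/
def tmulL (Y : LCS.{u}) (x : X) : Y →L[ℂ] tens X Y where
  toLinearMap := tmulₗ X Y x
  cont := by
    have h := (continuous_tmul (X := X) (Y := Y)).comp (Continuous.prodMk_right x)
    exact h

/-- `x ↦ x ⊗ y`. -/
def tmulR (X : LCS.{u}) (y : Y) : X →L[ℂ] tens X Y where
  toLinearMap := (tmulₗ X Y).flip y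
  cont := by
    have h := (continuous_tmul (X := X) (Y := Y)).comp (Continuous.prodMk_left y)
    exact h

theorem tens_ext {E : Type*} [AddCommGroup E] [Module ℂ E] [TopologicalSpace E] [T2Space E]
    {f g : tens X Y →L[ℂ] E} (h : ∀ x y, f (tmul x y) = g (tmul x y)) (w : tens X Y) :
    f w = g w := by
  refine UniformSpace.Completion.induction_on w (isClosed_eq f.continuous g.continuous) fun a => ?_
  induction a using ProjTensor.induction with
  | h0 => exact (map_zero f).trans (map_zero g).symm
  | h1 x y => exact h x y
  | h2 v w hv hw =>
    rw [UniformSpace.Completion.coe_add]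
    exact (map_add f _ _).trans ((congrArg₂ (· + ·) hv hw).trans (map_add g _ _).symm)

theorem ext₂ {f g : tens X Y ⟶ Z} (h : ∀ x y, f.hom (tmul x y) = g.hom (tmul x y)) : f = g :=
  hom_ext (tens_ext h)

theorem ext₃ {f g : tens (tens X Y) Z ⟶ W}
    (h : ∀ x y z, f.hom (tmul (tmul x y) z) = g.hom (tmul (tmul x y) z)) : f = g :=
  ext₂ fun w z => tens_ext (f := f.hom.comp (tmulR _ z)) (g := g.hom.comp (tmulR _ z))
    (fun x y => h x y z) w

theorem ext₃' {f g : tens X (tens Y Z) ⟶ W}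
    (h : ∀ x y z, f.hom (tmul x (tmul y z)) = g.hom (tmul x (tmul y z))) : f = g :=
  ext₂ fun x w => tens_ext (f := f.hom.comp (tmulL _ x)) (g := g.hom.comp (tmulL _ x))
    (fun y z => h x y z) w

theorem ext₄ {f g : tens (tens (tens X Y) Z) W ⟶ V}
    (h : ∀ x y z w, f.hom (tmul (tmul (tmul x y) z) w) = g.hom (tmul (tmul (tmul x y) z) w)) :
    f = g :=
  ext₃ fun v z w => tens_ext
    (f := (f.hom.comp (tmulR _ w)).comp (tmulR _ z))
    (g := (g.hom.comp (tmulR _ w)).comp (tmulR _ z)) (fun x y => h x y z w) v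

/-- The universal property of `X ⊗̂ Y`. -/
def lift (B : X →ₗ[ℂ] Y →ₗ[ℂ] Z) (hB : Continuous fun p : X × Y => B p.1 p.2) : tens X Y ⟶ Z :=
  ofHom (completionLift ⟨ProjTensor.lift B, ProjTensor.continuous_lift B hB⟩)

@[simp] theorem lift_tmul (B : X →ₗ[ℂ] Y →ₗ[ℂ] Z) (hB : Continuous fun p : X × Y => B p.1 p.2)
    (x : X) (y : Y) : (lift B hB).hom (tmul x y) = B x y :=
  (completionLift_coe _ _).trans (ProjTensor.lift_mk _ _ _)

theorem continuous_flip {B : X →ₗ[ℂ] Y →ₗ[ℂ] Z} (hB : Continuous fun p : X × Y => B p.1 p.2) :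
    Continuous fun p : Y × X => B.flip p.1 p.2 := hB.comp continuous_swap

/-- The morphism on `Y ⊗̂ X` given by a bilinear map on `X × Y`. -/
def liftFlip (B : X →ₗ[ℂ] Y →ₗ[ℂ] Z) (hB : Continuous fun p : X × Y => B p.1 p.2) :
    tens Y X ⟶ Z := lift B.flip (continuous_flip hB)

theorem liftFlip_tmul (B : X →ₗ[ℂ] Y →ₗ[ℂ] Z) (hB : Continuous fun p : X × Y => B p.1 p.2)
    (x : X) (y : Y) : (liftFlip B hB).hom (tmul y x) = B x y := lift_tmul _ _ _ _

/-- Trilinear jointly continuous maps, by a bound on each continuous seminorm. -/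
def Tri (T : W →ₗ[ℂ] X →ₗ[ℂ] Y →ₗ[ℂ] Z) : Prop :=
  ∀ q : Seminorm ℂ Z, Continuous q → ∃ (p₀ : Seminorm ℂ W) (p₁ : Seminorm ℂ X)
      (p₂ : Seminorm ℂ Y), Continuous p₀ ∧ Continuous p₁ ∧ Continuous p₂ ∧
        ∀ w x y, q (T w x y) ≤ p₀ w * (p₁ x * p₂ y)

/-- A trilinear map as a bilinear map on the algebraic tensor product. -/
def triAlg (T : W →ₗ[ℂ] X →ₗ[ℂ] Y →ₗ[ℂ] Z) : W →ₗ[ℂ] ProjTensor X Y →ₗ[ℂ] Z where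
  toFun w := ProjTensor.lift (T w)
  map_add' w w' := by
    ext v
    induction v using ProjTensor.induction with
    | h0 => simp
    | h1 x y => simp [ProjTensor.lift_mk]
    | h2 v v' h h' => rw [map_add, h, h', map_add]
  map_smul' c w := by
    ext v
    induction v using ProjTensor.induction with
    | h0 => simp
    | h1 x y => simp [ProjTensor.lift_mk]
    | h2 v v' h h' => rw [map_add, h, h', map_add]

theorem continuous_triAlg {T : W →ₗ[ℂ] X →ₗ[ℂ] Y →ₗ[ℂ] Z} (hT : Tri T) :
    Continuous fun p : W × ProjTensor X Y => triAlg T p.1 p.2 := by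
  refine continuous_lift_trilinear _ fun q hq => ?_
  obtain ⟨p₀, p₁, p₂, h₀, h₁, h₂, h⟩ := hT q hq
  refine ⟨p₀, p₁, p₂, h₀, h₁, h₂, fun w x y => ?_⟩
  exact (congrArg q (ProjTensor.lift_mk (T w) x y)).trans_le (h w x y)

/-- The bilinear map `W × (X ⊗̂ Y) → Z` given by a trilinear map. -/
def triBilin (T : W →ₗ[ℂ] X →ₗ[ℂ] Y →ₗ[ℂ] Z) (hT : Tri T) : W →ₗ[ℂ] tens X Y →ₗ[ℂ] Z :=
  completionLift₂ (triAlg T) (continuous_triAlg hT)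

theorem triBilin_tmul (T : W →ₗ[ℂ] X →ₗ[ℂ] Y →ₗ[ℂ] Z) (hT : Tri T) (w : W) (x : X) (y : Y) :
    triBilin T hT w (tmul x y) = T w x y :=
  (completionLift₂_coe _ _ _ _).trans (ProjTensor.lift_mk _ _ _)

theorem continuous_triBilin (T : W →ₗ[ℂ] X →ₗ[ℂ] Y →ₗ[ℂ] Z) (hT : Tri T) :
    Continuous fun p : W × tens X Y => triBilin T hT p.1 p.2 :=
  continuous_completionLift₂ _ _

/-- `(x, y, z) ↦ (x ⊗ y) ⊗ z`. -/
def tri₁ (X Y Z : LCS.{u}) : X →ₗ[ℂ] Y →ₗ[ℂ] Z →ₗ[ℂ] tens (tens X Y) Z where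
  toFun x := (tmulₗ (tens X Y) Z).comp (tmulₗ X Y x)
  map_add' x x' := by
    ext y z
    exact (congrArg (tmul · z) (add_tmul x x' y)).trans (add_tmul _ _ _)
  map_smul' c x := by
    ext y z
    exact (congrArg (tmul · z) (smul_tmul c x y)).trans (smul_tmul _ _ _)

theorem tri₁_tri (X Y Z : LCS.{u}) : Tri (tri₁ X Y Z) := by
  intro q hq
  obtain ⟨p, p₃, h, h₃, hb⟩ := bilin_bound (tmulₗ (tens X Y) Z) continuous_tmul hq
  obtain ⟨p₁, p₂, h₁, h₂, hb'⟩ := bilin_bound (tmulₗ X Y) continuous_tmul h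
  refine ⟨p₁, p₂, p₃, h₁, h₂, h₃, fun x y z => ?_⟩
  rw [← mul_assoc]
  exact (hb _ z).trans (mul_le_mul_of_nonneg_right (hb' x y) (apply_nonneg _ _))

/-- `(z, x, y) ↦ x ⊗ (y ⊗ z)`. -/
def tri₂ (X Y Z : LCS.{u}) : Z →ₗ[ℂ] X →ₗ[ℂ] Y →ₗ[ℂ] tens X (tens Y Z) where
  toFun z := (tmulₗ X (tens Y Z)).compl₂ ((tmulₗ Y Z).flip z)
  map_add' z z' := by
    ext x y
    exact (congrArg (tmul x) (tmul_add y z z')).trans (tmul_add _ _ _)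
  map_smul' c z := by
    ext x y
    exact (congrArg (tmul x) (tmul_smul c y z)).trans (tmul_smul _ _ _)

theorem tri₂_tri (X Y Z : LCS.{u}) : Tri (tri₂ X Y Z) := by
  intro q hq
  obtain ⟨p₁, p, h₁, h, hb⟩ := bilin_bound (tmulₗ X (tens Y Z)) continuous_tmul hq
  obtain ⟨p₂, p₃, h₂, h₃, hb'⟩ := bilin_bound (tmulₗ Y Z) continuous_tmul h
  refine ⟨p₃, p₁, p₂, h₃, h₁, h₂, fun z x y => ?_⟩
  refine ((hb x _).trans (mul_le_mul_of_nonneg_left (hb' y z) (apply_nonneg _ _))).trans_eq ?_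
  ring

/-- The associativity map `(x ⊗ y) ⊗ z ↦ x ⊗ (y ⊗ z)`. -/
def assocHom (X Y Z : LCS.{u}) : tens (tens X Y) Z ⟶ tens X (tens Y Z) :=
  liftFlip (triBilin (tri₂ X Y Z) (tri₂_tri X Y Z))
    (continuous_triBilin (tri₂ X Y Z) (tri₂_tri X Y Z))

/-- The associativity map `x ⊗ (y ⊗ z) ↦ (x ⊗ y) ⊗ z`. -/
def assocInv (X Y Z : LCS.{u}) : tens X (tens Y Z) ⟶ tens (tens X Y) Z :=
  lift (triBilin (tri₁ X Y Z) (tri₁_tri X Y Z))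
    (continuous_triBilin (tri₁ X Y Z) (tri₁_tri X Y Z))

@[simp] theorem assocHom_tmul (x : X) (y : Y) (z : Z) :
    (assocHom X Y Z).hom (tmul (tmul x y) z) = tmul x (tmul y z) :=
  (liftFlip_tmul _ _ _ _).trans (triBilin_tmul (tri₂ X Y Z) (tri₂_tri X Y Z) z x y)

@[simp] theorem assocInv_tmul (x : X) (y : Y) (z : Z) :
    (assocInv X Y Z).hom (tmul x (tmul y z)) = tmul (tmul x y) z :=
  (lift_tmul _ _ _ _).trans (triBilin_tmul (tri₁ X Y Z) (tri₁_tri X Y Z) x y z)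

/-- The associativity isomorphism. -/
def assoc (X Y Z : LCS.{u}) : tens (tens X Y) Z ≅ tens X (tens Y Z) where
  hom := assocHom X Y Z
  inv := assocInv X Y Z
  hom_inv_id := ext₃ fun x y z => by
    rw [comp_apply, assocHom_tmul, assocInv_tmul, id_apply]
  inv_hom_id := ext₃' fun x y z => by
    rw [comp_apply, assocInv_tmul, assocHom_tmul, id_apply]

/-- The tensor product of two morphisms. -/
def map (f : X ⟶ Z) (g : Y ⟶ W) : tens X Y ⟶ tens Z W :=
  lift ((tmulₗ Z W).compl₁₂ f.hom.toLinearMap g.hom.toLinearMap)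
    (continuous_tmul.comp (f.hom.continuous.prodMap g.hom.continuous))

@[simp] theorem map_tmul (f : X ⟶ Z) (g : Y ⟶ W) (x : X) (y : Y) :
    (map f g).hom (tmul x y) = tmul (f.hom x) (g.hom y) := lift_tmul _ _ _ _

/-- The braiding `x ⊗ y ↦ y ⊗ x`. -/
def swap (X Y : LCS.{u}) : tens X Y ⟶ tens Y X :=
  lift (tmulₗ Y X).flip (continuous_tmul.comp continuous_swap)

@[simp] theorem swap_tmul (x : X) (y : Y) : (swap X Y).hom (tmul x y) = tmul y x :=
  lift_tmul _ _ _ _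

/-- The unit object `ℂ`. -/
def unit : LCS.{u} where
  carrier := ULift.{u} ℂ

/-- A scalar as an element of the unit object. -/
def unit.up (c : ℂ) : (unit : LCS.{u}) := (ULift.up c : ULift.{u} ℂ)

/-- An element of the unit object as a scalar. -/
def unit.down : (unit : LCS.{u}) →L[ℂ] ℂ :=
  ⟨(ULift.moduleEquiv (R := ℂ) (M := ℂ)).toLinearMap, continuous_uliftDown⟩

@[simp] theorem unit.down_up (c : ℂ) : unit.down (unit.up c) = c := rfl
@[simp] theorem unit.up_down (c : (unit : LCS.{u})) : unit.up (unit.down c) = c := rfl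

theorem unit.smul_one (c : (unit : LCS.{u})) : unit.down c • unit.up 1 = c := by
  have h : unit.up (unit.down c * 1) = c := by rw [mul_one, unit.up_down]
  exact h

/-- `c ⊗ x ↦ c x`. -/
def lUnitHom (X : LCS.{u}) : tens unit X ⟶ X :=
  lift ((LinearMap.lsmul ℂ X).comp unit.down.toLinearMap)
    ((unit.down.continuous.comp continuous_fst).smul continuous_snd)

@[simp] theorem lUnitHom_tmul (c : (unit : LCS.{u})) (x : X) :
    (lUnitHom X).hom (tmul c x) = unit.down c • x := lift_tmul _ _ _ _

/-- `x ⊗ c ↦ c x`. -/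
def rUnitHom (X : LCS.{u}) : tens X unit ⟶ X :=
  lift ((LinearMap.lsmul ℂ X).comp unit.down.toLinearMap).flip
    ((unit.down.continuous.comp continuous_snd).smul continuous_fst)

@[simp] theorem rUnitHom_tmul (c : (unit : LCS.{u})) (x : X) :
    (rUnitHom X).hom (tmul x c) = unit.down c • x := lift_tmul _ _ _ _

/-- The isomorphism `ℂ ⊗̂ X ≅ X`. -/
def lUnit (X : LCS.{u}) : tens unit X ≅ X where
  hom := lUnitHom X
  inv := ofHom (tmulL X (unit.up 1))
  hom_inv_id := ext₂ fun c x => by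
    rw [comp_apply, lUnitHom_tmul, id_apply]
    refine (tmul_smul (unit.down c) (unit.up 1) x).trans ((smul_tmul _ _ _).symm.trans ?_)
    rw [unit.smul_one]
  inv_hom_id := hom_ext fun x => by
    rw [comp_apply, id_apply]
    exact (lUnitHom_tmul _ x).trans (one_smul ℂ x)

/-- The isomorphism `X ⊗̂ ℂ ≅ X`. -/
def rUnit (X : LCS.{u}) : tens X unit ≅ X where
  hom := rUnitHom X
  inv := ofHom (tmulR X (unit.up 1))
  hom_inv_id := ext₂ fun x c => by
    rw [comp_apply, rUnitHom_tmul, id_apply]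
    refine (smul_tmul (unit.down c) x (unit.up 1)).trans ((tmul_smul _ _ _).symm.trans ?_)
    rw [unit.smul_one]
  inv_hom_id := hom_ext fun x => by
    rw [comp_apply, id_apply]
    exact (rUnitHom_tmul _ x).trans (one_smul ℂ x)

end tens

instance : MonoidalCategoryStruct LCS.{u} where
  tensorObj := tens
  whiskerLeft X _ _ f := map (𝟙 X) f
  whiskerRight f Y := map f (𝟙 Y)
  tensorHom f g := map f g
  tensorUnit := unit
  associator := assoc
  leftUnitor := lUnit
  rightUnitor := rUnit

theorem map_id (X Y : LCS.{u}) : map (𝟙 X) (𝟙 Y) = 𝟙 (tens X Y) := ext₂ fun x y => by simp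

theorem map_comp {X₁ Y₁ Z₁ X₂ Y₂ Z₂ : LCS.{u}} (f₁ : X₁ ⟶ Y₁) (f₂ : X₂ ⟶ Y₂) (g₁ : Y₁ ⟶ Z₁)
    (g₂ : Y₂ ⟶ Z₂) : map f₁ f₂ ≫ map g₁ g₂ = map (f₁ ≫ g₁) (f₂ ≫ g₂) := ext₂ fun x y => by simp

theorem assocHom_naturality {X₁ X₂ X₃ Y₁ Y₂ Y₃ : LCS.{u}} (f₁ : X₁ ⟶ Y₁) (f₂ : X₂ ⟶ Y₂)
    (f₃ : X₃ ⟶ Y₃) : map (map f₁ f₂) f₃ ≫ assocHom Y₁ Y₂ Y₃ =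
      assocHom X₁ X₂ X₃ ≫ map f₁ (map f₂ f₃) := ext₃ fun x y z => by simp

theorem lUnitHom_naturality {X Y : LCS.{u}} (f : X ⟶ Y) :
    map (𝟙 unit) f ≫ lUnitHom Y = lUnitHom X ≫ f := ext₂ fun x y => by simp

theorem rUnitHom_naturality {X Y : LCS.{u}} (f : X ⟶ Y) :
    map f (𝟙 unit) ≫ rUnitHom Y = rUnitHom X ≫ f := ext₂ fun x y => by simp

theorem assocHom_pentagon (W X Y Z : LCS.{u}) :
    map (assocHom W X Y) (𝟙 Z) ≫ assocHom W (tens X Y) Z ≫ map (𝟙 W) (assocHom X Y Z) =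
      assocHom (tens W X) Y Z ≫ assocHom W X (tens Y Z) := ext₄ fun w x y z => by simp

theorem assocHom_triangle (X Y : LCS.{u}) :
    assocHom X unit Y ≫ map (𝟙 X) (lUnitHom Y) = map (rUnitHom X) (𝟙 Y) :=
  ext₃ fun x c y => by simp [tmul_smul, smul_tmul]

instance : MonoidalCategory LCS.{u} := MonoidalCategory.ofTensorHom
  (id_tensorHom_id := map_id)
  (id_tensorHom := fun _ _ _ _ => rfl)
  (tensorHom_id := fun _ _ => rfl)
  (tensorHom_comp_tensorHom := map_comp)
  (associator_naturality := assocHom_naturality)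
  (leftUnitor_naturality := lUnitHom_naturality)
  (rightUnitor_naturality := rUnitHom_naturality)
  (pentagon := assocHom_pentagon)
  (triangle := assocHom_triangle)

theorem swap_swap (X Y : LCS.{u}) : swap X Y ≫ swap Y X = 𝟙 (tens X Y) :=
  ext₂ fun x y => by simp

/-- The braiding isomorphism. -/
def braid (X Y : LCS.{u}) : tens X Y ≅ tens Y X where
  hom := swap X Y
  inv := swap Y X
  hom_inv_id := swap_swap X Y
  inv_hom_id := swap_swap Y X

theorem swap_naturality {X Y Z W : LCS.{u}} (f : X ⟶ Z) (g : Y ⟶ W) :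
    map f g ≫ swap Z W = swap X Y ≫ map g f := ext₂ fun x y => by simp

theorem swap_hexagon (X Y Z : LCS.{u}) :
    assocHom X Y Z ≫ swap X (tens Y Z) ≫ assocHom Y Z X =
      map (swap X Y) (𝟙 Z) ≫ assocHom Y X Z ≫ map (𝟙 Y) (swap X Z) := ext₃ fun x y z => by simp

theorem swap_hexagon' (X Y Z : LCS.{u}) :
    assocInv X Y Z ≫ swap (tens X Y) Z ≫ assocInv Z X Y =
      map (𝟙 X) (swap Y Z) ≫ assocInv X Z Y ≫ map (swap X Z) (𝟙 Y) := ext₃' fun x y z => by simp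

instance : SymmetricCategory LCS.{u} where
  braiding := braid
  braiding_naturality_right X _ _ f := swap_naturality (𝟙 X) f
  braiding_naturality_left f Z := swap_naturality f (𝟙 Z)
  hexagon_forward := swap_hexagon
  hexagon_reverse := swap_hexagon'
  symmetry := swap_swap

end LCS

namespace LCS

section elements

variable {X Y Z W : LCS.{u}}

/-- The elementary tensor `x ⊗ y`, as an element of the tensor product in the monoidal category
of complete locally convex spaces. -/
def el (x : X) (y : Y) : (X ⊗ Y : LCS.{u}) := tmul x y

/-- The scalar `c` as an element of the unit object. -/
def scal (c : ℂ) : (𝟙_ LCS.{u}) := unit.up c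

/-- The scalar given by an element of the unit object. -/
def val : (𝟙_ LCS.{u}) →L[ℂ] ℂ := unit.down

@[simp] theorem val_scal (c : ℂ) : val (scal.{u} c) = c := rfl
theorem val_smul (c : (𝟙_ LCS.{u})) : val c • scal 1 = c := unit.smul_one c

theorem el_add (x : X) (y y' : Y) : el x (y + y') = el x y + el x y' := tmul_add x y y'
theorem add_el (x x' : X) (y : Y) : el (x + x') y = el x y + el x' y := add_tmul x x' y
theorem el_smul (c : ℂ) (x : X) (y : Y) : el x (c • y) = c • el x y := tmul_smul c x y
theorem smul_el (c : ℂ) (x : X) (y : Y) : el (c • x) y = c • el x y := smul_tmul c x y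

theorem el_ext {f g : X ⊗ Y ⟶ Z} (h : ∀ x y, f.hom (el x y) = g.hom (el x y)) : f = g := ext₂ h
theorem el_ext₃ {f g : (X ⊗ Y) ⊗ Z ⟶ W}
    (h : ∀ x y z, f.hom (el (el x y) z) = g.hom (el (el x y) z)) : f = g := ext₃ h
theorem el_ext₃' {f g : X ⊗ (Y ⊗ Z) ⟶ W}
    (h : ∀ x y z, f.hom (el x (el y z)) = g.hom (el x (el y z))) : f = g := ext₃' h

@[simp] theorem whiskerLeft_el (f : Y ⟶ Z) (x : X) (y : Y) :
    (X ◁ f).hom (el x y) = el x (f.hom y) := map_tmul (𝟙 X) f x y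
@[simp] theorem whiskerRight_el (f : X ⟶ Z) (x : X) (y : Y) :
    (f ▷ Y).hom (el x y) = el (f.hom x) y := map_tmul f (𝟙 Y) x y
@[simp] theorem tensorHom_el (f : X ⟶ Z) (g : Y ⟶ W) (x : X) (y : Y) :
    (f ⊗ₘ g).hom (el x y) = el (f.hom x) (g.hom y) := map_tmul f g x y
@[simp] theorem associator_hom_el (x : X) (y : Y) (z : Z) :
    (α_ X Y Z).hom.hom (el (el x y) z) = el x (el y z) := assocHom_tmul x y z
@[simp] theorem associator_inv_el (x : X) (y : Y) (z : Z) :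
    (α_ X Y Z).inv.hom (el x (el y z)) = el (el x y) z := assocInv_tmul x y z
@[simp] theorem braiding_hom_el (x : X) (y : Y) :
    (β_ X Y).hom.hom (el x y) = el y x := swap_tmul x y
@[simp] theorem leftUnitor_hom_el (c : (𝟙_ LCS.{u})) (x : X) :
    (λ_ X).hom.hom (el c x) = val c • x := lUnitHom_tmul c x
@[simp] theorem rightUnitor_hom_el (c : (𝟙_ LCS.{u})) (x : X) :
    (ρ_ X).hom.hom (el x c) = val c • x := rUnitHom_tmul c x
@[simp] theorem leftUnitor_inv_apply (x : X) : (λ_ X).inv.hom x = el (scal 1) x := rfl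
@[simp] theorem tensorμ_el (x : X) (y : Y) (z : Z) (w : W) :
    (tensorμ X Y Z W).hom (el (el x y) (el z w)) = el (el x z) (el y w) := by
  simp [tensorμ]

end elements

section algebra

variable (A : LCS.{u}) [MonObj A]

/-- The product of two elements of a `⊗̂`-algebra. -/
def mulElt (a b : A) : A := μ[A].hom (el a b)

/-- The unit element. -/
def oneElt : A := η[A].hom (scal 1)

theorem one_mulElt (a : A) : mulElt A (oneElt A) a = a := by
  have h := congrArg (fun f => Hom.hom f (el (scal 1) a)) (MonObj.one_mul A)
  simp only [comp_apply, whiskerRight_el, leftUnitor_hom_el, val_scal, one_smul] at h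
  exact h

theorem mulElt_one (a : A) : mulElt A a (oneElt A) = a := by
  have h := congrArg (fun f => Hom.hom f (el a (scal 1))) (MonObj.mul_one A)
  simp only [comp_apply, whiskerLeft_el, rightUnitor_hom_el, val_scal, one_smul] at h
  exact h

theorem mulElt_assoc (a b c : A) :
    mulElt A (mulElt A a b) c = mulElt A a (mulElt A b c) := by
  have h := congrArg (fun f => Hom.hom f (el (el a b) c)) (MonObj.mul_assoc A)
  simp only [comp_apply, whiskerLeft_el, whiskerRight_el, associator_hom_el] at h
  exact h

theorem one_hom_apply (c : (𝟙_ LCS.{u})) : (η[A]).hom c = val c • oneElt A := by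
  conv_lhs => rw [← val_smul c]
  exact map_smul _ _ _

theorem opp_mul_assoc : ((β_ A A).hom ≫ μ[A]) ▷ A ≫ (β_ A A).hom ≫ μ[A] =
    (α_ A A A).hom ≫ A ◁ ((β_ A A).hom ≫ μ[A]) ≫ (β_ A A).hom ≫ μ[A] :=
  el_ext₃ fun a b c => by
    simp only [comp_apply, whiskerLeft_el, whiskerRight_el, associator_hom_el, braiding_hom_el]
    exact (mulElt_assoc A c b a).symm

/-- The underlying space of the opposite algebra. -/
def Opp (A : LCS.{u}) : LCS.{u} := A

/-- The opposite algebra: the multiplication is composed with the braiding. -/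
instance : MonObj (Opp A) where
  one := η[A]
  mul := (β_ A A).hom ≫ μ[A]
  one_mul := by
    change η[A] ▷ A ≫ (β_ A A).hom ≫ μ[A] = (λ_ A).hom
    simp
  mul_one := by
    change A ◁ η[A] ≫ (β_ A A).hom ≫ μ[A] = (ρ_ A).hom
    simp
  mul_assoc := opp_mul_assoc A

/-- An element of `A` as an element of the opposite algebra. -/
def toOpp (a : A) : Opp A := a

theorem opp_mul (a b : A) : mulElt (Opp A) (toOpp A a) (toOpp A b) = toOpp A (mulElt A b a) :=
  congrArg μ[A].hom (braiding_hom_el a b)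

/-- The enveloping algebra `A ⊗̂ A^op`. -/
abbrev Env (A : LCS.{u}) [MonObj A] : LCS.{u} := A ⊗ Opp A

/-- The elementary tensor `a ⊗ b` in the enveloping algebra. -/
def envElt (a b : A) : Env A := el a (toOpp A b)

theorem env_mul (a b a' b' : A) :
    mulElt (Env A) (envElt A a b) (envElt A a' b') =
      envElt A (mulElt A a a') (mulElt A b' b) := by
  rw [envElt, envElt, envElt, ← opp_mul]
  simp only [mulElt, MonObj.tensorObj.mul_def, comp_apply, tensorμ_el, tensorHom_el]

theorem env_one : oneElt (Env A) = envElt A (oneElt A) (oneElt A) := by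
  rw [oneElt, MonObj.tensorObj.one_def, comp_apply, leftUnitor_inv_apply]
  exact tensorHom_el _ _ _ _

theorem isMonHom_of_elt {A B : LCS.{u}} [MonObj A] [MonObj B] (f : A ⟶ B)
    (h₁ : f.hom (oneElt A) = oneElt B)
    (h₂ : ∀ a b, f.hom (mulElt A a b) = mulElt B (f.hom a) (f.hom b)) : IsMonHom f where
  one_hom := hom_ext fun c => by
    rw [comp_apply, one_hom_apply, one_hom_apply, map_smul, h₁]
  mul_hom := el_ext fun a b => by
    simpa only [mulElt, comp_apply, tensorHom_el] using h₂ a b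

end algebra

section Hopf

variable (H : LCS.{u}) [HopfObj H]

/-- The antipode as a morphism to the opposite algebra. -/
def antipodeOpp : H ⟶ Opp H := 𝒮[H]

instance : IsMonHom (antipodeOpp H) where
  one_hom := HopfObj.one_antipode H
  mul_hom := by
    refine (HopfObj.mul_antipode H).trans ?_
    rfl

instance : IsMonHom Δ[H] where
  one_hom := BimonObj.one_comul H
  mul_hom := by
    rw [BimonObj.mul_comul, MonObj.tensorObj.mul_def]

instance : IsMonHom ε[H] where
  one_hom := BimonObj.one_counit H
  mul_hom := by
    rw [BimonObj.mul_counit]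
    simp

/-- The algebra homomorphism `E = (1 ⊗ S) Δ : H → H ⊗̂ H^op`. -/
def E : H ⟶ Env H := Δ[H] ≫ H ◁ antipodeOpp H

instance : IsMonHom (E H) := inferInstanceAs (IsMonHom (Δ[H] ≫ H ◁ antipodeOpp H))

end Hopf

section leftModules

variable {A : LCS.{u}} [MonObj A]

/-- The product `a · x` in a left `⊗̂`-module. -/
def Mod.act (X : Mod LCS.{u} A) (a : A) (x : X.X) : X.X := (γ[A, X.X] : A ⊗ X.X ⟶ X.X).hom (el a x)

theorem smul_mul (X : Mod LCS.{u} A) (a b : A) (x : X.X) :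
    Mod.act X (mulElt A a b) x = Mod.act X a (Mod.act X b x) := by
  have h := congrArg (fun f => Hom.hom f (el (el a b) x)) (ModObj.mul_smul_self A X.X)
  simp only [comp_apply, whiskerLeft_el, whiskerRight_el, associator_hom_el] at h
  exact h

theorem smul_one (X : Mod LCS.{u} A) (x : X.X) : Mod.act X (oneElt A) x = x := by
  have h := congrArg (fun f => Hom.hom f (el (scal 1) x))
    (ModObj.one_smul_self A X.X)
  simp only [comp_apply, whiskerRight_el, leftUnitor_hom_el, val_scal, one_smul] at h
  exact h

theorem hom_act {X Y : Mod LCS.{u} A} (f : X ⟶ Y) (a : A) (x : X.X) :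
    f.hom.hom (Mod.act X a x) = Mod.act Y a (f.hom.hom x) := by
  have h := congrArg (fun g => Hom.hom g (el a x)) (IsModHom.smul_hom (A := A) (f := f.hom))
  exact h.trans (congrArg (γ[A, Y.X] : A ⊗ Y.X ⟶ Y.X).hom (whiskerLeft_el f.hom a x))

end leftModules
end LCS

namespace LCS

section quotient

/-- The quotient of `X` by a subspace, with the quotient topology. -/
def QuotSpace (X : LCS.{u}) (N : Submodule ℂ X) : Type u := X ⧸ N

variable (X : LCS.{u}) (N : Submodule ℂ X)

instance : AddCommGroup (QuotSpace X N) := inferInstanceAs (AddCommGroup (X ⧸ N))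
instance : Module ℂ (QuotSpace X N) := inferInstanceAs (Module ℂ (X ⧸ N))
instance : TopologicalSpace (QuotSpace X N) := inferInstanceAs (TopologicalSpace (X ⧸ N))
instance : IsTopologicalAddGroup (QuotSpace X N) := inferInstanceAs (IsTopologicalAddGroup (X ⧸ N))
instance : PolynormableSpace ℂ (QuotSpace X N) := polynormable_quotient N
instance : UniformSpace (QuotSpace X N) := IsTopologicalAddGroup.rightUniformSpace _
instance : IsUniformAddGroup (QuotSpace X N) := isUniformAddGroup_of_addCommGroup

/-- The class map `X → X / N`. -/
def QuotSpace.mk : X →L[ℂ] QuotSpace X N := N.mkQL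

theorem QuotSpace.isOpenQuotientMap_mk : IsOpenQuotientMap (QuotSpace.mk X N) :=
  N.isOpenQuotientMap_mkQ

theorem QuotSpace.mk_eq_zero {x : X} (hx : x ∈ N) : QuotSpace.mk X N x = 0 :=
  (Submodule.Quotient.mk_eq_zero N).2 hx

/-- The linear map on the quotient given by a linear map that vanishes on `N`. -/
def QuotSpace.lift {E : Type*} [AddCommGroup E] [Module ℂ E] (f : X →ₗ[ℂ] E)
    (h : ∀ x ∈ N, f x = 0) : QuotSpace X N →ₗ[ℂ] E := N.liftQ f h

theorem QuotSpace.lift_mk {E : Type*} [AddCommGroup E] [Module ℂ E] (f : X →ₗ[ℂ] E)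
    (h : ∀ x ∈ N, f x = 0) (x : X) : QuotSpace.lift X N f h (QuotSpace.mk X N x) = f x :=
  N.liftQ_apply f x

theorem QuotSpace.mk_surjective : Function.Surjective (QuotSpace.mk X N) := N.mkQ_surjective

/-- The completion of the quotient `X / N`. -/
def quot : LCS.{u} where
  carrier := UniformSpace.Completion (QuotSpace X N)

/-- The canonical map from `X` to the completion of `X / N`. -/
def proj : X ⟶ quot X N :=
  ofHom ((toCompletion (QuotSpace X N)).comp (QuotSpace.mk X N))

variable {X N}

theorem proj_eq_zero {x : X} (hx : x ∈ N) : (proj X N).hom x = 0 :=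
  (congrArg (toCompletion (QuotSpace X N)) (QuotSpace.mk_eq_zero X N hx)).trans (map_zero _)

theorem quot_ext_apply {Z : LCS.{u}} {f g : quot X N →L[ℂ] Z}
    (h : ∀ x, f ((proj X N).hom x) = g ((proj X N).hom x)) (w : quot X N) : f w = g w := by
  have : f = g := completion_lin_ext (E := QuotSpace X N) fun q => by
    obtain ⟨x, rfl⟩ := QuotSpace.mk_surjective X N q
    exact h x
  rw [this]

theorem quot_ext {Z : LCS.{u}} {f g : quot X N ⟶ Z}
    (h : ∀ x, f.hom ((proj X N).hom x) = g.hom ((proj X N).hom x)) : f = g :=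
  hom_ext (quot_ext_apply h)

/-- The morphism on the completed quotient given by a morphism that vanishes on `N`. -/
def quotDesc {Z : LCS.{u}} (f : X ⟶ Z) (h : ∀ x ∈ N, f.hom x = 0) : quot X N ⟶ Z :=
  ofHom (completionLift
    { toLinearMap := QuotSpace.lift X N f.hom.toLinearMap h
      cont := (QuotSpace.isOpenQuotientMap_mk X N).isQuotientMap.continuous_iff.2
        (f.hom.continuous.congr fun x => (QuotSpace.lift_mk X N _ h x).symm) })

@[simp] theorem quotDesc_proj {Z : LCS.{u}} (f : X ⟶ Z) (h : ∀ x ∈ N, f.hom x = 0) (x : X) :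
    (quotDesc f h).hom ((proj X N).hom x) = f.hom x :=
  (completionLift_coe _ _).trans (QuotSpace.lift_mk X N f.hom.toLinearMap h x)

variable {B Z : LCS.{u}}

/-- The bilinear map `B × X / N → Z` given by a morphism on `B ⊗̂ X` that vanishes on `B ⊗ N`. -/
def quotBilin (t : B ⊗ X ⟶ Z) (h : ∀ b, ∀ x ∈ N, t.hom (el b x) = 0) :
    B →ₗ[ℂ] QuotSpace X N →ₗ[ℂ] Z where
  toFun b := QuotSpace.lift X N (t.hom.comp (tmulL X b)).toLinearMap (h b)
  map_add' b b' := by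
    ext q
    obtain ⟨x, rfl⟩ := QuotSpace.mk_surjective X N q
    have key (b : B) := QuotSpace.lift_mk X N (t.hom.comp (tmulL X b)).toLinearMap (h b) x
    refine (key _).trans (Eq.trans ?_ (congrArg₂ (· + ·) (key b) (key b')).symm)
    exact (congrArg t.hom (add_el b b' x)).trans (map_add _ _ _)
  map_smul' c b := by
    ext q
    obtain ⟨x, rfl⟩ := QuotSpace.mk_surjective X N q
    have key (b : B) := QuotSpace.lift_mk X N (t.hom.comp (tmulL X b)).toLinearMap (h b) x
    refine (key _).trans (Eq.trans ?_ (congrArg (c • ·) (key b)).symm)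
    exact (congrArg t.hom (smul_el c b x)).trans (map_smul _ _ _)

theorem continuous_quotBilin (t : B ⊗ X ⟶ Z) (h : ∀ b, ∀ x ∈ N, t.hom (el b x) = 0) :
    Continuous fun p : B × QuotSpace X N => quotBilin t h p.1 p.2 := by
  refine ((IsOpenQuotientMap.id (X := B)).prodMap
    (QuotSpace.isOpenQuotientMap_mk X N)).isQuotientMap.continuous_iff.2 ?_
  have hc : Continuous fun p : B × X => t.hom (tmulₗ B X p.1 p.2) :=
    t.hom.continuous.comp continuous_tmul
  refine hc.congr fun p => ?_
  exact (QuotSpace.lift_mk X N (t.hom.comp (tmulL X p.1)).toLinearMap (h p.1) p.2).symm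

/-- The morphism on `B ⊗̂ (X / N)^~` given by a morphism on `B ⊗̂ X` that vanishes on `B ⊗ N`. -/
def quotDesc₂ (t : B ⊗ X ⟶ Z) (h : ∀ b, ∀ x ∈ N, t.hom (el b x) = 0) : B ⊗ quot X N ⟶ Z :=
  lift (X := B) (Y := quot X N) (completionLift₂ (quotBilin t h) (continuous_quotBilin t h))
    (continuous_completionLift₂ (quotBilin t h) (continuous_quotBilin t h))

@[simp] theorem quotDesc₂_proj (t : B ⊗ X ⟶ Z) (h : ∀ b, ∀ x ∈ N, t.hom (el b x) = 0) (b : B)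
    (x : X) : (quotDesc₂ t h).hom (el b ((proj X N).hom x)) = t.hom (el b x) :=
  (lift_tmul (X := B) (Y := quot X N) _ _ _ _).trans
    ((completionLift₂_coe (quotBilin t h) (continuous_quotBilin t h) b _).trans
      (QuotSpace.lift_mk X N (t.hom.comp (tmulL X b)).toLinearMap (h b) x))

theorem el_quot_ext {f g : B ⊗ quot X N ⟶ Z}
    (h : ∀ b x, f.hom (el b ((proj X N).hom x)) = g.hom (el b ((proj X N).hom x))) : f = g :=
  el_ext fun b w => quot_ext_apply (f := f.hom.comp (tmulL _ b)) (g := g.hom.comp (tmulL _ b))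
    (h b) w

end quotient

end LCS

namespace LCS

section envModules

variable (A : LCS.{u}) [MonObj A]

variable {A} in
theorem env_ext_apply {Z : LCS.{u}} {f g : Env A →L[ℂ] Z}
    (h : ∀ a b, f (envElt A a b) = g (envElt A a b)) (w : Env A) : f w = g w :=
  tens_ext (X := A) (Y := Opp A) h w

variable {A} in
theorem env_ext₁ {X Z : LCS.{u}} {f g : Env A ⊗ X ⟶ Z}
    (h : ∀ a b x, f.hom (el (envElt A a b) x) = g.hom (el (envElt A a b) x)) : f = g :=
  el_ext fun w x => env_ext_apply (f := f.hom.comp (tmulR _ x)) (g := g.hom.comp (tmulR _ x))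
    (fun a b => h a b x) w

variable {A} in
theorem env_ext₂ {X Z : LCS.{u}} {f g : (Env A ⊗ Env A) ⊗ X ⟶ Z}
    (h : ∀ a b a' b' x, f.hom (el (el (envElt A a b) (envElt A a' b')) x) =
      g.hom (el (el (envElt A a b) (envElt A a' b')) x)) : f = g :=
  el_ext₃ fun w w' x =>
    env_ext_apply (f := (f.hom.comp (tmulR _ x)).comp (tmulR _ w'))
      (g := (g.hom.comp (tmulR _ x)).comp (tmulR _ w')) (fun a b =>
        env_ext_apply (f := (f.hom.comp (tmulR _ x)).comp (tmulL _ (envElt A a b)))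
          (g := (g.hom.comp (tmulR _ x)).comp (tmulL _ (envElt A a b)))
          (fun a' b' => h a b a' b' x) w') w

variable {A} in
theorem env_ext₃ {X Z : LCS.{u}} {f g : X ⊗ (Env A ⊗ Env A) ⟶ Z}
    (h : ∀ x a b a' b', f.hom (el x (el (envElt A a b) (envElt A a' b'))) =
      g.hom (el x (el (envElt A a b) (envElt A a' b')))) : f = g :=
  el_ext₃' fun x w w' =>
    env_ext_apply (f := (f.hom.comp (tmulL _ x)).comp (tmulR _ w'))
      (g := (g.hom.comp (tmulL _ x)).comp (tmulR _ w')) (fun a b =>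
        env_ext_apply (f := (f.hom.comp (tmulL _ x)).comp (tmulL _ (envElt A a b)))
          (g := (g.hom.comp (tmulL _ x)).comp (tmulL _ (envElt A a b)))
          (fun a' b' => h x a b a' b') w') w

/-- The action `(a ⊗ b) · x = a x b` of the enveloping algebra on `A`. -/
def regAct : Env A ⊗ A ⟶ A :=
  (α_ A (Opp A) A).hom ≫ A ◁ ((β_ A A).hom ≫ μ[A]) ≫ μ[A]

theorem regAct_el (a b x : A) :
    (regAct A).hom (el (envElt A a b) x) = mulElt A a (mulElt A x b) := by
  have h₁ : (α_ A (Opp A) A).hom.hom (el (envElt A a b) x) = el a (el (toOpp A b) x) :=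
    associator_hom_el a (toOpp A b) x
  have h₂ : (A ◁ ((β_ A A).hom ≫ μ[A])).hom (el (Y := A ⊗ A) a (el b x)) = el a (mulElt A x b) := by
    rw [whiskerLeft_el, comp_apply, braiding_hom_el, mulElt]
  rw [regAct, comp_apply, comp_apply, h₁]
  exact congrArg μ[A].hom h₂

/-- The algebra `A` as an `A`-`⊗̂`-bimodule, i.e. as a left `A ⊗̂ A^op`-`⊗̂`-module. -/
def regBimod : Mod LCS.{u} (Env A) where
  X := A
  mod :=
    { smul := regAct A
      one_smul := el_ext fun c x => by
        change (regAct A).hom ((η[Env A] ▷ A).hom _) = (λ_ A).hom.hom _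
        rw [whiskerRight_el, one_hom_apply, smul_el, map_smul, env_one, regAct_el, mulElt_one,
          one_mulElt, leftUnitor_hom_el]
      mul_smul := env_ext₂ fun a b a' b' x => by
        change (regAct A).hom ((μ[Env A] ▷ A).hom _) =
          (regAct A).hom ((Env A ◁ regAct A).hom ((α_ (Env A) (Env A) A).hom.hom _))
        rw [whiskerRight_el, associator_hom_el, whiskerLeft_el, regAct_el]
        have h := env_mul A a b a' b'
        rw [mulElt] at h
        rw [h, regAct_el, regAct_el]
        simp only [mulElt_assoc] }

end envModules

section rightModules

/-- A right `⊗̂`-module over a `⊗̂`-algebra. -/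
structure RMod (A : LCS.{u}) [MonObj A] where
  X : LCS.{u}
  act : X ⊗ A ⟶ X
  act_one : X ◁ η[A] ≫ act = (ρ_ X).hom
  act_mul : X ◁ μ[A] ≫ act = (α_ X A A).inv ≫ act ▷ A ≫ act

/-- A morphism of right `⊗̂`-modules. -/
structure RMod.Hom {A : LCS.{u}} [MonObj A] (X Y : RMod A) where
  hom : X.X ⟶ Y.X
  comm : X.act ≫ hom = hom ▷ A ≫ Y.act

/-- The product `x · a` in a right `⊗̂`-module. -/
def RMod.actElt {A : LCS.{u}} [MonObj A] (X : RMod A) (x : X.X) (a : A) : X.X := X.act.hom (el x a)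

theorem RMod.actElt_one {A : LCS.{u}} [MonObj A] (X : RMod A) (x : X.X) :
    X.actElt x (oneElt A) = x := by
  have h := congrArg (fun f => LCS.Hom.hom f (el x (scal 1))) X.act_one
  simp only [comp_apply, whiskerLeft_el, rightUnitor_hom_el, val_scal, one_smul] at h
  exact h

theorem RMod.actElt_mul {A : LCS.{u}} [MonObj A] (X : RMod A) (x : X.X) (a b : A) :
    X.actElt x (mulElt A a b) = X.actElt (X.actElt x a) b := by
  have h := congrArg (fun f => LCS.Hom.hom f (el x (el a b))) X.act_mul
  simp only [comp_apply, whiskerLeft_el, whiskerRight_el, associator_inv_el] at h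
  exact h

theorem RMod.Hom.map_actElt {A : LCS.{u}} [MonObj A] {X Y : RMod A} (f : RMod.Hom X Y) (x : X.X)
    (a : A) : f.hom.hom (X.actElt x a) = Y.actElt (f.hom.hom x) a := by
  have h := congrArg (fun f => LCS.Hom.hom f (el x a)) f.comm
  simp only [comp_apply, whiskerRight_el] at h
  exact h

/-- Restriction of scalars along an algebra homomorphism. -/
def RMod.comap {A B : LCS.{u}} [MonObj A] [MonObj B] (f : A ⟶ B) [IsMonHom f] (X : RMod B) :
    RMod A where
  X := X.X
  act := X.X ◁ f ≫ X.act
  act_one := by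
    rw [← MonoidalCategory.whiskerLeft_comp_assoc, IsMonHom.one_hom, X.act_one]
  act_mul := el_ext₃' fun x a b => by
    have h : f.hom (μ[A].hom (el a b)) = mulElt B (f.hom a) (f.hom b) := by
      have h := congrArg (fun g => LCS.Hom.hom g (el a b)) (IsMonHom.mul_hom (f := f))
      simp only [comp_apply, tensorHom_el] at h
      exact h
    simp only [comp_apply, whiskerLeft_el, whiskerRight_el, associator_inv_el, h]
    exact X.actElt_mul x _ _

/-- Restriction of scalars on morphisms. -/
def RMod.Hom.comap {A B : LCS.{u}} [MonObj A] [MonObj B] (g : A ⟶ B) [IsMonHom g] {X Y : RMod B}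
    (f : RMod.Hom X Y) : RMod.Hom (RMod.comap g X) (RMod.comap g Y) where
  hom := f.hom
  comm := by
    change (X.X ◁ g ≫ X.act) ≫ f.hom = f.hom ▷ A ≫ Y.X ◁ g ≫ Y.act
    refine el_ext fun x a => ?_
    simp only [comp_apply, whiskerLeft_el, whiskerRight_el]
    exact f.map_actElt x (g.hom a)

variable {A : LCS.{u}} [MonObj A]

variable (A) in
/-- The anti-automorphism `a ⊗ b ↦ b ⊗ a` of the enveloping algebra. -/
def flip : Env A ⟶ Env A := (β_ A A).hom

variable (A) in
theorem flip_envElt (a b : A) : (flip A).hom (envElt A a b) = envElt A b a := braiding_hom_el a b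

/-- A bimodule as a right module over the enveloping algebra: `m · (a ⊗ b) = b m a`. -/
def toRight (M : Mod LCS.{u} (Env A)) : RMod (Env A) where
  X := M.X
  act := M.X ◁ flip A ≫ (β_ M.X (Env A)).hom ≫ (γ[Env A, M.X] : Env A ⊗ M.X ⟶ M.X)
  act_one := el_ext fun m c => by
    have h : (flip A).hom (oneElt (Env A)) = oneElt (Env A) := by
      rw [env_one, flip_envElt]
    rw [comp_apply, whiskerLeft_el, comp_apply, comp_apply, whiskerLeft_el, braiding_hom_el,
      one_hom_apply, map_smul, h, smul_el, map_smul, rightUnitor_hom_el]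
    exact congrArg (val c • ·) (smul_one M m)
  act_mul := env_ext₃ fun m a b a' b' => by
    have h : μ[Env A].hom (el (envElt A a b) (envElt A a' b')) = _ := env_mul A a b a' b'
    have h' := env_mul A b' a' b a
    simp only [comp_apply, whiskerLeft_el, whiskerRight_el, associator_inv_el, braiding_hom_el,
      h, flip_envElt]
    rw [← h']
    exact smul_mul M _ _ m

/-- A morphism of bimodules as a morphism of right modules over the enveloping algebra. -/
def toRightHom {M N : Mod LCS.{u} (Env A)} (f : M ⟶ N) : RMod.Hom (toRight M) (toRight N) where
  hom := f.hom
  comm := by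
    change (M.X ◁ flip A ≫ (β_ M.X (Env A)).hom ≫ (γ[Env A, M.X] : Env A ⊗ M.X ⟶ M.X)) ≫ f.hom =
      f.hom ▷ Env A ≫ N.X ◁ flip A ≫ (β_ N.X (Env A)).hom ≫ (γ[Env A, N.X] : Env A ⊗ N.X ⟶ N.X)
    refine el_ext fun m w => ?_
    rw [comp_apply, comp_apply, comp_apply, comp_apply, comp_apply, comp_apply, whiskerLeft_el,
      whiskerRight_el, whiskerLeft_el, braiding_hom_el, braiding_hom_el]
    exact hom_act f _ _

/-- A `B`-`A`-`⊗̂`-bimodule, for two `⊗̂`-algebras `B` and `A`: a right `A`-`⊗̂`-module with a left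
action of `B` that commutes with the action of `A`. -/
structure BiMod (B A : LCS.{u}) [MonObj B] [MonObj A] extends RMod A where
  lact : B ⊗ X ⟶ X
  one_lact : η[B] ▷ X ≫ lact = (λ_ X).hom
  mul_lact : μ[B] ▷ X ≫ lact = (α_ B B X).hom ≫ B ◁ lact ≫ lact
  lact_act : lact ▷ A ≫ act = (α_ B X A).hom ≫ B ◁ act ≫ lact

/-- A `⊗̂`-algebra `B` as a left `B`-module and as a right module over `A` via `f : A → B`. -/
def BiMod.ofHom {A B : LCS.{u}} [MonObj A] [MonObj B] (f : A ⟶ B) [IsMonHom f] : BiMod B A where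
  toRMod := RMod.comap f
    { X := B
      act := μ[B]
      act_one := MonObj.mul_one B
      act_mul := MonObj.mul_assoc_flip B }
  lact := μ[B]
  one_lact := MonObj.one_mul B
  mul_lact := MonObj.mul_assoc B
  lact_act := by
    change μ[B] ▷ A ≫ B ◁ f ≫ μ[B] = (α_ B B A).hom ≫ B ◁ (B ◁ f ≫ μ[B]) ≫ μ[B]
    refine el_ext₃ fun a b x => ?_
    simp only [comp_apply, whiskerLeft_el, whiskerRight_el, associator_hom_el]
    exact mulElt_assoc B _ _ _

end rightModules

section tensor

variable {A : LCS.{u}} [MonObj A]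

/-- The closed linear span of the elements `x · a ⊗ y - x ⊗ a · y` in `X ⊗̂ Y`. -/
def balanced (X : RMod A) (Y : Mod LCS.{u} A) : Submodule ℂ (X.X ⊗ Y.X : LCS.{u}) :=
  (Submodule.span ℂ {w : (X.X ⊗ Y.X : LCS.{u}) | ∃ (x : X.X) (a : A) (y : Y.X),
    w = el (X.actElt x a) y - el x (Mod.act Y a y)}).topologicalClosure

theorem eq_zero_of_balanced {X : RMod A} {Y : Mod LCS.{u} A} {Z : LCS.{u}} (f : X.X ⊗ Y.X ⟶ Z)
    (h : ∀ x a y, f.hom (el (X.actElt x a) y) = f.hom (el x (Mod.act Y a y)))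
    (w : (X.X ⊗ Y.X : LCS.{u})) (hw : w ∈ balanced X Y) : f.hom w = 0 := by
  have hle : balanced X Y ≤ LinearMap.ker f.hom.toLinearMap := by
    refine Submodule.topologicalClosure_minimal _ (Submodule.span_le.2 ?_)
      (f.hom.isClosed_ker)
    rintro _ ⟨x, a, y, rfl⟩
    exact (map_sub f.hom _ _).trans (sub_eq_zero.2 (h x a y))
  exact hle hw

/-- The `A`-module tensor product `X ⊗̂_A Y`: the completion of the quotient of `X ⊗̂ Y` by the
closed linear span of the elements `x · a ⊗ y - x ⊗ a · y`. -/
def tensorOver (X : RMod A) (Y : Mod LCS.{u} A) : LCS.{u} := quot (X.X ⊗ Y.X) (balanced X Y)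

/-- The canonical map `X ⊗̂ Y → X ⊗̂_A Y`. -/
def toTensorOver (X : RMod A) (Y : Mod LCS.{u} A) : X.X ⊗ Y.X ⟶ tensorOver X Y :=
  proj (X.X ⊗ Y.X) (balanced X Y)

/-- The elementary tensor `x ⊗ y` in `X ⊗̂_A Y`. -/
def tel {X : RMod A} {Y : Mod LCS.{u} A} (x : X.X) (y : Y.X) : tensorOver X Y :=
  (toTensorOver X Y).hom (el x y)

theorem tel_actElt {X : RMod A} {Y : Mod LCS.{u} A} (x : X.X) (a : A) (y : Y.X) :
    (tel (X.actElt x a) y : tensorOver X Y) = tel x (Mod.act Y a y) := by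
  refine sub_eq_zero.1 ?_
  refine (map_sub (toTensorOver X Y).hom _ _).symm.trans (proj_eq_zero ?_)
  exact Submodule.le_topologicalClosure _ (Submodule.subset_span ⟨x, a, y, rfl⟩)

theorem tensorOver_ext {X : RMod A} {Y : Mod LCS.{u} A} {Z : LCS.{u}} {f g : tensorOver X Y ⟶ Z}
    (h : ∀ x y, f.hom (tel x y) = g.hom (tel x y)) : f = g := by
  have : toTensorOver X Y ≫ f = toTensorOver X Y ≫ g := el_ext h
  exact quot_ext fun w => congrArg (fun k => LCS.Hom.hom k w) this

theorem el_tensorOver_ext {B : LCS.{u}} {X : RMod A} {Y : Mod LCS.{u} A} {Z : LCS.{u}}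
    {f g : B ⊗ tensorOver X Y ⟶ Z}
    (h : ∀ b x y, f.hom (el b (tel x y)) = g.hom (el b (tel x y))) : f = g := by
  have : B ◁ toTensorOver X Y ≫ f = B ◁ toTensorOver X Y ≫ g := el_ext₃' fun b x y => by
    rw [comp_apply, comp_apply, whiskerLeft_el]
    exact h b x y
  refine el_quot_ext fun b w => ?_
  have h' := congrArg (fun k => LCS.Hom.hom k (el b w)) this
  simp only [comp_apply, whiskerLeft_el] at h'
  exact h'

/-- The map `f ⊗ g : X ⊗̂_A Y → X' ⊗̂_A Y'`. -/
def tensorOverMap {X X' : RMod A} {Y Y' : Mod LCS.{u} A} (f : RMod.Hom X X') (g : Y ⟶ Y') :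
    tensorOver X Y ⟶ tensorOver X' Y' :=
  quotDesc ((f.hom ⊗ₘ g.hom) ≫ toTensorOver X' Y') (eq_zero_of_balanced _ fun x a y => by
    rw [comp_apply, comp_apply, tensorHom_el, tensorHom_el, f.map_actElt, hom_act]
    exact tel_actElt _ _ _)

theorem tensorOverMap_tel {X X' : RMod A} {Y Y' : Mod LCS.{u} A} (f : RMod.Hom X X') (g : Y ⟶ Y')
    (x : X.X) (y : Y.X) :
    (tensorOverMap f g).hom (tel x y) = tel (f.hom.hom x) (g.hom.hom y) := by
  refine (quotDesc_proj _ _ _).trans ?_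
  rw [comp_apply, tensorHom_el]
  rfl

/-- The identity morphism of a right module. -/
def RMod.Hom.id (X : RMod A) : RMod.Hom X X where
  hom := 𝟙 X.X
  comm := by simp

variable {B : LCS.{u}} [MonObj B]

/-- The product `b · x` in a bimodule. -/
def BiMod.lactElt (X : BiMod B A) (b : B) (x : X.X) : X.X := X.lact.hom (el b x)

theorem BiMod.lactElt_actElt (X : BiMod B A) (b : B) (x : X.X) (a : A) :
    X.actElt (X.lactElt b x) a = X.lactElt b (X.actElt x a) := by
  have h := congrArg (fun f => LCS.Hom.hom f (el (el b x) a)) X.lact_act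
  simp only [comp_apply, whiskerLeft_el, whiskerRight_el, associator_hom_el] at h
  exact h

theorem BiMod.lactElt_one (X : BiMod B A) (x : X.X) : X.lactElt (oneElt B) x = x := by
  have h := congrArg (fun f => LCS.Hom.hom f (el (scal 1) x)) X.one_lact
  simp only [comp_apply, whiskerRight_el, leftUnitor_hom_el, val_scal, one_smul] at h
  exact h

theorem BiMod.lactElt_mul (X : BiMod B A) (a b : B) (x : X.X) :
    X.lactElt (mulElt B a b) x = X.lactElt a (X.lactElt b x) := by
  have h := congrArg (fun f => LCS.Hom.hom f (el (el a b) x)) X.mul_lact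
  simp only [comp_apply, whiskerLeft_el, whiskerRight_el, associator_hom_el] at h
  exact h

/-- The map `b ⊗ (x ⊗ y) ↦ b x ⊗ y` from `B ⊗̂ (X ⊗̂ Y)` to `X ⊗̂_A Y`. -/
def tensAct₀ (X : BiMod B A) (Y : Mod LCS.{u} A) :
    B ⊗ (X.X ⊗ Y.X) ⟶ tensorOver X.toRMod Y :=
  (α_ B X.X Y.X).inv ≫ X.lact ▷ Y.X ≫ toTensorOver X.toRMod Y

theorem tensAct₀_el (X : BiMod B A) (Y : Mod LCS.{u} A) (b : B) (x : X.X) (y : Y.X) :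
    (tensAct₀ X Y).hom (el b (el x y)) = tel (X.lactElt b x) y := by
  rw [tensAct₀, comp_apply, comp_apply, associator_inv_el, whiskerRight_el]
  rfl

/-- `x ↦ b ⊗ x`. -/
def elL {B : LCS.{u}} (X : LCS.{u}) (b : B) : X ⟶ B ⊗ X := LCS.ofHom (tmulL X b)

theorem elL_apply {B X : LCS.{u}} (b : B) (x : X) : (elL X b).hom x = el b x := rfl

theorem tensAct₀_zero (X : BiMod B A) (Y : Mod LCS.{u} A) (b : B) (w : (X.X ⊗ Y.X : LCS.{u}))
    (hw : w ∈ balanced X.toRMod Y) : (tensAct₀ X Y).hom (el b w) = 0 := by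
  refine eq_zero_of_balanced (X := X.toRMod) (Y := Y) (elL (X.X ⊗ Y.X) b ≫ tensAct₀ X Y)
    (fun x a y => ?_) w hw
  rw [comp_apply, comp_apply, elL_apply, elL_apply, tensAct₀_el, tensAct₀_el, ← tel_actElt,
    X.lactElt_actElt]

/-- The left action `b · (x ⊗ y) = b x ⊗ y` on `X ⊗̂_A Y`. -/
def tensAct (X : BiMod B A) (Y : Mod LCS.{u} A) :
    B ⊗ tensorOver X.toRMod Y ⟶ tensorOver X.toRMod Y :=
  quotDesc₂ (tensAct₀ X Y) (tensAct₀_zero X Y)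

theorem tensAct_tel (X : BiMod B A) (Y : Mod LCS.{u} A) (b : B) (x : X.X) (y : Y.X) :
    (tensAct X Y).hom (el b (tel x y)) = tel (X.lactElt b x) y :=
  (quotDesc₂_proj _ _ _ _).trans (tensAct₀_el X Y b x y)

theorem tensAct_one (X : BiMod B A) (Y : Mod LCS.{u} A) :
    η[B] ▷ tensorOver X.toRMod Y ≫ tensAct X Y = (λ_ (tensorOver X.toRMod Y)).hom :=
  el_tensorOver_ext fun c x y => by
    rw [comp_apply, whiskerRight_el, one_hom_apply, smul_el, map_smul, tensAct_tel,
      X.lactElt_one, leftUnitor_hom_el]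

theorem tensAct_mul (X : BiMod B A) (Y : Mod LCS.{u} A) :
    μ[B] ▷ tensorOver X.toRMod Y ≫ tensAct X Y =
      (α_ B B (tensorOver X.toRMod Y)).hom ≫ B ◁ tensAct X Y ≫ tensAct X Y := by
  refine el_ext₃ fun b b' w => ?_
  have h : elL _ (mulElt B b b') ≫ tensAct X Y =
      (elL _ b' ≫ tensAct X Y) ≫ elL _ b ≫ tensAct X Y := tensorOver_ext fun x y => by
    rw [comp_apply, comp_apply, comp_apply, comp_apply, elL_apply, elL_apply, elL_apply,
      tensAct_tel, tensAct_tel, tensAct_tel, X.lactElt_mul]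
  have h' := congrArg (fun f => LCS.Hom.hom f w) h
  rw [comp_apply, comp_apply, comp_apply, whiskerRight_el, associator_hom_el, whiskerLeft_el]
  exact h'

/-- The left `B`-module `X ⊗̂_A Y`, for a `B`-`A`-bimodule `X`. -/
def BiMod.tensor (X : BiMod B A) (Y : Mod LCS.{u} A) : Mod LCS.{u} B where
  X := tensorOver X.toRMod Y
  mod :=
    { smul := tensAct X Y
      one_smul := tensAct_one X Y
      mul_smul := tensAct_mul X Y }

end tensor

end LCS

namespace LCS

section induced

variable {A B : LCS.{u}} [MonObj A] [MonObj B]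

/-- A continuous linear map that commutes with the actions is a morphism of left modules. -/
def homOfAct {X Y : Mod LCS.{u} A} (f : X.X ⟶ Y.X)
    (h : ∀ a x, f.hom (Mod.act X a x) = Mod.act Y a (f.hom x)) : X ⟶ Y :=
  Mod.Hom.mk' f (by
    change (γ[A, X.X] : A ⊗ X.X ⟶ X.X) ≫ f = A ◁ f ≫ (γ[A, Y.X] : A ⊗ Y.X ⟶ Y.X)
    refine el_ext fun a x => ?_
    rw [comp_apply, comp_apply, whiskerLeft_el]
    exact h a x)

/-- The functor `X ⊗̂_A (-)` on morphisms. -/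
def BiMod.tensorMap (X : BiMod B A) {Y Y' : Mod LCS.{u} A} (g : Y ⟶ Y') :
    X.tensor Y ⟶ X.tensor Y' :=
  Mod.Hom.mk' (tensorOverMap (RMod.Hom.id X.toRMod) g) (by
    change tensAct X Y ≫ tensorOverMap (RMod.Hom.id X.toRMod) g =
      B ◁ tensorOverMap (RMod.Hom.id X.toRMod) g ≫ tensAct X Y'
    refine el_tensorOver_ext fun b x y => ?_
    rw [comp_apply, comp_apply, whiskerLeft_el, tensAct_tel, tensorOverMap_tel, tensorOverMap_tel]
    exact (tensAct_tel X Y' b x _).symm)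

theorem tel_zero {X : RMod A} {Y : Mod LCS.{u} A} (x : X.X) : (tel x 0 : tensorOver X Y) = 0 :=
  map_zero ((toTensorOver X Y).hom.comp (tmulL Y.X x))

theorem tensorOverMap_comp_zero {X : RMod A} {Y Y' Y'' : Mod LCS.{u} A} (g : Y ⟶ Y')
    (g' : Y' ⟶ Y'') (h : ∀ y, g'.hom.hom (g.hom.hom y) = 0) (w : tensorOver X Y) :
    (tensorOverMap (RMod.Hom.id X) g').hom ((tensorOverMap (RMod.Hom.id X) g).hom w) = 0 := by
  have h₁ : tensorOverMap (RMod.Hom.id X) g ≫ tensorOverMap (RMod.Hom.id X) g' = ofHom 0 :=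
    tensorOver_ext fun x y => by
      rw [comp_apply, tensorOverMap_tel, tensorOverMap_tel, h, tel_zero]
      rfl
  exact congrArg (fun k => LCS.Hom.hom k w) h₁

end induced

section homological

variable {A B : LCS.{u}} [MonObj A] [MonObj B]

/-- An admissible epimorphism: a morphism of modules with a continuous linear right inverse. -/
def AdmissibleEpi {X Y : Mod LCS.{u} A} (σ : X ⟶ Y) : Prop :=
  ∃ τ : Y.X →L[ℂ] X.X, ∀ y, σ.hom.hom (τ y) = y

/-- A projective module: morphisms from it lift along all admissible epimorphisms. -/
def IsProjective (P : Mod LCS.{u} A) : Prop :=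
  ∀ (X Y : Mod LCS.{u} A) (σ : X ⟶ Y), AdmissibleEpi σ → ∀ f : P ⟶ Y, ∃ g : P ⟶ X, g ≫ σ = f

/-- A complex `0 ← X ← P 0 ← P 1 ← ⋯` of left modules. -/
structure AugComplex (X : Mod LCS.{u} A) where
  P : ℕ → Mod LCS.{u} A
  d : ∀ n, P (n + 1) ⟶ P n
  aug : P 0 ⟶ X
  d_d : ∀ n x, (d n).hom.hom ((d (n + 1)).hom.hom x) = 0
  aug_d : ∀ x, aug.hom.hom ((d 0).hom.hom x) = 0

namespace AugComplex

variable {X : Mod LCS.{u} A}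

/-- The augmented complex splits as a complex of topological vector spaces: it has a contracting
homotopy of continuous linear maps. -/
def IsAdmissible (C : AugComplex X) : Prop :=
  ∃ (s₀ : X.X →L[ℂ] (C.P 0).X) (s : ∀ n, (C.P n).X →L[ℂ] (C.P (n + 1)).X),
    (∀ x, C.aug.hom.hom (s₀ x) = x) ∧
    (∀ x, s₀ (C.aug.hom.hom x) + (C.d 0).hom.hom (s 0 x) = x) ∧
    ∀ n x, s n ((C.d n).hom.hom x) + (C.d (n + 1)).hom.hom (s (n + 1) x) = x

/-- A projective resolution of `X`. -/
def IsProjectiveResolution (C : AugComplex X) : Prop :=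
  C.IsAdmissible ∧ ∀ n, IsProjective (C.P n)

/-- The complex `0 ← R ⊗̂_A X ← R ⊗̂_A P 0 ← R ⊗̂_A P 1 ← ⋯`. -/
def induce (R : BiMod B A) (C : AugComplex X) : AugComplex (R.tensor X) where
  P n := R.tensor (C.P n)
  d n := R.tensorMap (C.d n)
  aug := R.tensorMap C.aug
  d_d n := tensorOverMap_comp_zero _ _ (C.d_d n)
  aug_d := tensorOverMap_comp_zero _ _ C.aug_d

/-- The complex with the augmentation followed by a morphism `X ⟶ X'`. -/
def compAug {X' : Mod LCS.{u} A} (C : AugComplex X) (φ : X ⟶ X') : AugComplex X' where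
  P := C.P
  d := C.d
  aug := C.aug ≫ φ
  d_d := C.d_d
  aug_d x := by
    have h : (C.aug ≫ φ).hom.hom ((C.d 0).hom.hom x) =
        φ.hom.hom (C.aug.hom.hom ((C.d 0).hom.hom x)) := rfl
    rw [h, C.aug_d, map_zero]

end AugComplex

/-- The space `_A h(X, Y)` of morphisms of left modules. -/
def homs (X Y : Mod LCS.{u} A) : Submodule ℂ (X.X →L[ℂ] Y.X) where
  carrier := {f | ∀ a x, f (Mod.act X a x) = Mod.act Y a (f x)}
  zero_mem' a x := (map_zero ((γ[A, Y.X] : A ⊗ Y.X ⟶ Y.X).hom.comp (tmulL Y.X a))).symm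
  add_mem' {f g} hf hg a x := by
    have h := map_add ((γ[A, Y.X] : A ⊗ Y.X ⟶ Y.X).hom.comp (tmulL Y.X a)) (f x) (g x)
    exact (congrArg₂ (· + ·) (hf a x) (hg a x)).trans h.symm
  smul_mem' c f hf a x := by
    have h := map_smul ((γ[A, Y.X] : A ⊗ Y.X ⟶ Y.X).hom.comp (tmulL Y.X a)) c (f x)
    exact (congrArg (c • ·) (hf a x)).trans h.symm

theorem mem_homs_iff {X Y : Mod LCS.{u} A} (f : X.X →L[ℂ] Y.X) :
    f ∈ homs X Y ↔ ∃ g : X ⟶ Y, g.hom.hom = f :=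
  ⟨fun h => ⟨homOfAct (ofHom f) h, rfl⟩, by rintro ⟨g, rfl⟩ a x; exact hom_act g a x⟩

instance (X Y : Mod LCS.{u} A) : AddCommGroup (homs X Y) := Submodule.addCommGroup _

/-- `f ↦ f ∘ g` on spaces of morphisms. -/
def homs.precomp {X X' : Mod LCS.{u} A} (g : X ⟶ X') (Y : Mod LCS.{u} A) :
    homs X' Y →ₗ[ℂ] homs X Y where
  toFun f := ⟨f.1.comp g.hom.hom, fun a x => by
    have h := f.2 a (g.hom.hom x)
    rw [← hom_act g a x] at h
    exact h⟩
  map_add' _ _ := rfl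
  map_smul' _ _ := rfl

/-- `f ↦ g ∘ f` on spaces of morphisms. -/
def homs.postcomp (X : Mod LCS.{u} A) {Y Y' : Mod LCS.{u} A} (g : Y ⟶ Y') :
    homs X Y →ₗ[ℂ] homs X Y' where
  toFun f := ⟨g.hom.hom.comp f.1, fun a x =>
    (congrArg g.hom.hom (f.2 a x)).trans (hom_act g a (f.1 x))⟩
  map_add' _ _ := Subtype.ext (ContinuousLinearMap.ext fun _ => map_add g.hom.hom _ _)
  map_smul' _ _ := Subtype.ext (ContinuousLinearMap.ext fun _ => map_smul g.hom.hom _ _)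

section Ext

variable {X : Mod LCS.{u} A} (C : AugComplex X)

/-- The cocycles of the complex `_A h(P, Y)`. -/
def cocycles (Y : Mod LCS.{u} A) (n : ℕ) : Submodule ℂ (homs (C.P n) Y) :=
  LinearMap.ker (homs.precomp (C.d n) Y)

/-- The coboundaries of the complex `_A h(P, Y)`. -/
def coboundaries (Y : Mod LCS.{u} A) : (n : ℕ) → Submodule ℂ (homs (C.P n) Y)
  | 0 => ⊥
  | n + 1 => LinearMap.range (homs.precomp (C.d n) Y)

/-- The cohomology `H^n(_A h(P, Y))`; it is `Ext^n_A(X, Y)` if `P` is a projective resolution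
of `X`. -/
abbrev Ext (Y : Mod LCS.{u} A) (n : ℕ) : Type u :=
  cocycles C Y n ⧸ (coboundaries C Y n).submoduleOf (cocycles C Y n)

theorem postcomp_mem_cocycles {Y Y' : Mod LCS.{u} A} (g : Y ⟶ Y') (n : ℕ)
    (f : homs (C.P n) Y) (hf : f ∈ cocycles C Y n) :
    homs.postcomp (C.P n) g f ∈ cocycles C Y' n := by
  have h : homs.precomp (C.d n) Y f = 0 := hf
  have h' : homs.precomp (C.d n) Y' (homs.postcomp (C.P n) g f) =
      homs.postcomp (C.P (n + 1)) g (homs.precomp (C.d n) Y f) := rfl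
  rw [cocycles, LinearMap.mem_ker, h', h, map_zero]

theorem postcomp_mem_coboundaries {Y Y' : Mod LCS.{u} A} (g : Y ⟶ Y') (n : ℕ)
    (f : homs (C.P n) Y) (hf : f ∈ coboundaries C Y n) :
    homs.postcomp (C.P n) g f ∈ coboundaries C Y' n := by
  cases n with
  | zero =>
    have h : f = 0 := hf
    rw [h, map_zero]
    exact Submodule.zero_mem _
  | succ n =>
    obtain ⟨k, rfl⟩ := hf
    exact ⟨homs.postcomp (C.P n) g k, rfl⟩

/-- The map on `Ext` given by a morphism in the second variable. -/
def ExtMap {Y Y' : Mod LCS.{u} A} (g : Y ⟶ Y') (n : ℕ) : Ext C Y n →ₗ[ℂ] Ext C Y' n :=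
  Submodule.mapQ _ _
    ((homs.postcomp (C.P n) g).restrict (postcomp_mem_cocycles C g n))
    fun f hf => postcomp_mem_coboundaries C g n f.1 hf

end Ext

section Tor

variable {X : Mod LCS.{u} A} (R : RMod A) (C : AugComplex X)

/-- The differential of the complex `R ⊗̂_A P`. -/
def tensorD (n : ℕ) : tensorOver R (C.P (n + 1)) →L[ℂ] tensorOver R (C.P n) :=
  (tensorOverMap (RMod.Hom.id R) (C.d n)).hom

/-- The cycles of the complex `R ⊗̂_A P`. -/
def cycles : (n : ℕ) → Submodule ℂ (tensorOver R (C.P n))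
  | 0 => ⊤
  | n + 1 => LinearMap.ker (tensorD R C n).toLinearMap

/-- The boundaries of the complex `R ⊗̂_A P`. -/
def boundaries (n : ℕ) : Submodule ℂ (tensorOver R (C.P n)) :=
  LinearMap.range (tensorD R C n).toLinearMap

/-- The homology `H_n(R ⊗̂_A P)`, with the quotient topology; it is `Tor_n^A(R, X)` if `P` is a
projective resolution of `X`. -/
abbrev Tor (n : ℕ) : Type u :=
  cycles R C n ⧸ (boundaries R C n).submoduleOf (cycles R C n)

variable {R} {R' : RMod A} (f : RMod.Hom R R')

/-- The map `R ⊗̂_A P n → R' ⊗̂_A P n`. -/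
def tensorF (n : ℕ) : tensorOver R (C.P n) →L[ℂ] tensorOver R' (C.P n) :=
  (tensorOverMap f (𝟙 (C.P n))).hom

theorem tensorF_tensorD (n : ℕ) (w : tensorOver R (C.P (n + 1))) :
    tensorF C f n (tensorD R C n w) = tensorD R' C n (tensorF C f (n + 1) w) := by
  have h : tensorOverMap (RMod.Hom.id R) (C.d n) ≫ tensorOverMap f (𝟙 (C.P n)) =
      tensorOverMap f (𝟙 (C.P (n + 1))) ≫ tensorOverMap (RMod.Hom.id R') (C.d n) :=
    tensorOver_ext fun x y => by
      rw [comp_apply, comp_apply, tensorOverMap_tel, tensorOverMap_tel, tensorOverMap_tel,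
        tensorOverMap_tel]
      rfl
  exact congrArg (fun k => LCS.Hom.hom k w) h

theorem tensorF_mem_cycles (n : ℕ) (w : tensorOver R (C.P n)) (hw : w ∈ cycles R C n) :
    (tensorF C f n).toLinearMap w ∈ cycles R' C n := by
  cases n with
  | zero => exact Submodule.mem_top
  | succ n =>
    have h : tensorD R C n w = 0 := hw
    have h' := tensorF_tensorD C f n w
    rw [h, map_zero] at h'
    exact h'.symm

theorem tensorF_mem_boundaries (n : ℕ) (w : tensorOver R (C.P n)) (hw : w ∈ boundaries R C n) :
    (tensorF C f n).toLinearMap w ∈ boundaries R' C n := by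
  obtain ⟨v, rfl⟩ := hw
  exact ⟨tensorF C f (n + 1) v, (tensorF_tensorD C f n v).symm⟩

/-- The map on `Tor` given by a morphism in the first variable. -/
def TorMap (n : ℕ) : Tor R C n →ₗ[ℂ] Tor R' C n :=
  Submodule.mapQ _ _ ((tensorF C f n).toLinearMap.restrict (tensorF_mem_cycles C f n))
    fun w hw => tensorF_mem_boundaries C f n w.1 hw

end Tor

end homological

section Hopf

variable (H : LCS.{u}) [HopfObj H]

/-- The trivial left `H`-module `ℂ`, with the action `h · c = ε(h) c`. -/
def triv : Mod LCS.{u} H where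
  X := 𝟙_ LCS.{u}
  mod :=
    { smul := ε[H] ▷ 𝟙_ LCS.{u} ≫ (λ_ (𝟙_ LCS.{u})).hom
      one_smul := (Mod.scalarRestriction ε[H] (𝟙_ LCS.{u})).one_smul
      mul_smul := (Mod.scalarRestriction ε[H] (𝟙_ LCS.{u})).mul_smul }

/-- `H ⊗̂ H^op` as a left module over itself and as a right `H`-module via `E`. -/
def HE : BiMod (Env H) H := BiMod.ofHom (E H)

/-- The left `H`-module `_E M`. -/
def leftE (M : Mod LCS.{u} (Env H)) : Mod LCS.{u} H := (Mod.comap (E H)).obj M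

/-- `_E f : _E M → _E N`. -/
def leftEHom {M N : Mod LCS.{u} (Env H)} (f : M ⟶ N) : leftE H M ⟶ leftE H N :=
  (Mod.comap (E H)).map f

/-- The right `H`-module `M_E`. -/
def rightE (M : Mod LCS.{u} (Env H)) : RMod H := RMod.comap (E H) (toRight M)

/-- `f_E : M_E → N_E`. -/
def rightEHom {M N : Mod LCS.{u} (Env H)} (f : M ⟶ N) : RMod.Hom (rightE H M) (rightE H N) :=
  (toRightHom f).comap (E H)

theorem triv_act (h : H) (c : (𝟙_ LCS.{u})) :
    Mod.act (triv H) h c = val (ε[H].hom h) • c := by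
  have h₁ := comp_apply (ε[H] ▷ 𝟙_ LCS.{u}) (λ_ (𝟙_ LCS.{u})).hom (el h c)
  rw [whiskerRight_el, leftUnitor_hom_el] at h₁
  exact h₁

theorem leftE_act (M : Mod LCS.{u} (Env H)) (h : H) (m : M.X) :
    Mod.act (leftE H M) h m = Mod.act M ((E H).hom h) m := by
  have h₁ := comp_apply (E H ▷ M.X) (γ[Env H, M.X] : Env H ⊗ M.X ⟶ M.X) (el h m)
  rw [whiskerRight_el] at h₁
  exact h₁

theorem rightE_act (M : Mod LCS.{u} (Env H)) (h : H) (m : M.X) :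
    (rightE H M).actElt m h = Mod.act M ((flip H).hom ((E H).hom h)) m := by
  have h₁ := comp_apply (M.X ◁ E H) (toRight M).act (el m h)
  rw [whiskerLeft_el] at h₁
  refine h₁.trans ?_
  change (M.X ◁ flip H ≫ (β_ M.X (Env H)).hom ≫ (γ[Env H, M.X] : Env H ⊗ M.X ⟶ M.X)).hom _ = _
  rw [comp_apply, comp_apply, whiskerLeft_el, braiding_hom_el]
  rfl

end Hopf

end LCS

end

open LCS (HE triv regBimod tel envElt val mulElt AugComplex Env leftE leftEHom rightE rightEHom
  toRight toRightHom ExtMap TorMap)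

/-!
The proof rests on two properties of the right `H`-module `H^e_E`.

*The induced module of `ℂ` is `H`.* The map `(a ⊗ b) ⊗ c ↦ c a b` is well defined on `H^e_E ⊗̂_H ℂ`
because `h₁ S(h₂) = ε(h)`. Its inverse is `a ↦ (a ⊗ 1) ⊗ 1`: the identity
`a b ⊗ 1 = (a ⊗ b₂) E(b₁)` (`mulE_comul`) shows that `(a b ⊗ 1) ⊗ 1 = (a ⊗ b) ⊗ 1` (`cls_mul_one`).

*`H^e_E` is a direct summand of the free right module `H ⊗̂ H`.* The map `a ⊗ b ↦ a₂ b ⊗ a₁` is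
right `H`-linear (`envSection_mul_E`), and `v ⊗ h ↦ (1 ⊗ v) E(h)` is a left inverse of it
(`freeRightDesc_envSection`). Hence `H^e_E ⊗̂_H Y` is, naturally in `Y`, a direct summand of the
topological vector space `H ⊗̂ Y`, and contracting homotopies carry over from a resolution of `ℂ` to
the induced complex (`AugComplex.IsAdmissible.induce`). Extension of scalars preserves projectivity,
being left adjoint to restriction of scalars (`IsProjective.extend`). So the induced complex is a
projective bimodule resolution of `H`.

For the isomorphisms of derived functors, any projective bimodule resolution of `H` is homotopy
equivalent to the induced one by the comparison theorem
(`AugComplex.IsProjectiveResolution.exists_homotopyEquiv`). Kernels of differentials are avoided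
there: a projective module is a retract of a free module `A ⊗̂ V`, and morphisms from `A ⊗̂ V` are
the same as continuous linear maps from `V`, so that a morphism lifts as soon as it lifts as a
continuous linear map (`IsProjective.exists_lift`). On the induced resolution, the adjunction gives `Ext`
(`extInduceEquiv`), and the cancellation `N ⊗̂_B (B ⊗̂_A Y) ≅ N ⊗̂_A Y` gives `Tor`
(`torInduceEquiv`).

The Hopf algebra identities are proved without choosing representatives of `Δ(h)`: both sides are
written as values at `Δ(h)`, or at `(Δ ⊗ 1) Δ(h)`, of continuous linear maps on completed tensor
products, and these are compared on elementary tensors (`el_extL`).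
-/

namespace LCS

noncomputable section

/-! ### Subquotients -/

section Subquotient

variable {U V : Type*} [AddCommGroup U] [Module ℂ U] [AddCommGroup V] [Module ℂ V]
  {Z B : Submodule ℂ U} {Z' B' : Submodule ℂ V}

/-- Linear maps between the ambient spaces that preserve `Z` and `B`, and that are inverse to each
other on `Z` modulo `B`, give an isomorphism of the subquotients `Z / B`. -/
def subquotientEquiv (F : U →ₗ[ℂ] V) (G : V →ₗ[ℂ] U)
    (hZ : ∀ x ∈ Z, F x ∈ Z') (hB : ∀ x ∈ B, F x ∈ B')
    (hZ' : ∀ y ∈ Z', G y ∈ Z) (hB' : ∀ y ∈ B', G y ∈ B)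
    (h : ∀ x ∈ Z, G (F x) - x ∈ B) (h' : ∀ y ∈ Z', F (G y) - y ∈ B') :
    (Z ⧸ B.submoduleOf Z) ≃ₗ[ℂ] (Z' ⧸ B'.submoduleOf Z') :=
  LinearEquiv.ofLinearMap
    (Submodule.mapQ _ _ (F.restrict hZ) fun x hx => hB x.1 hx)
    (Submodule.mapQ _ _ (G.restrict hZ') fun y hy => hB' y.1 hy)
    (by
      ext y
      exact (Submodule.Quotient.eq _).2 (h' y.1 y.2))
    (by
      ext x
      exact (Submodule.Quotient.eq _).2 (h x.1 x.2))

variable [TopologicalSpace U] [TopologicalSpace V]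

/-- A continuous map of the ambient spaces is continuous on subquotients, for the quotient topology
of the subspace topology. -/
theorem continuous_subquotient_map (F : U →L[ℂ] V)
    (hZ : ∀ x ∈ Z, F x ∈ Z') (hB : ∀ x ∈ B, F x ∈ B') :
    Continuous (Submodule.mapQ (B.submoduleOf Z) (B'.submoduleOf Z')
      (F.toLinearMap.restrict hZ) fun x hx => hB x.1 hx) := by
  refine (Submodule.isQuotientMap_mkQL _).continuous_iff.2 ?_
  have hc : Continuous fun x : Z => (⟨F x.1, hZ x.1 x.2⟩ : Z') :=
    (F.continuous.comp continuous_subtype_val).subtype_mk _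
  exact (Submodule.isQuotientMap_mkQL _).continuous.comp hc

/-- The topological form of `subquotientEquiv`. -/
def subquotientEquivL (F : U →L[ℂ] V) (G : V →L[ℂ] U)
    (hZ : ∀ x ∈ Z, F x ∈ Z') (hB : ∀ x ∈ B, F x ∈ B')
    (hZ' : ∀ y ∈ Z', G y ∈ Z) (hB' : ∀ y ∈ B', G y ∈ B)
    (h : ∀ x ∈ Z, G (F x) - x ∈ B) (h' : ∀ y ∈ Z', F (G y) - y ∈ B') :
    (Z ⧸ B.submoduleOf Z) ≃L[ℂ] (Z' ⧸ B'.submoduleOf Z') where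
  toLinearEquiv := subquotientEquiv F.toLinearMap G.toLinearMap hZ hB hZ' hB' h h'
  continuous_toFun := continuous_subquotient_map F hZ hB
  continuous_invFun := continuous_subquotient_map G hZ' hB'

end Subquotient

/-! ### Free modules and lifting -/

section Free

variable {A : LCS.{u}} [MonObj A]

variable (A) in
/-- The free left `A`-module `A ⊗̂ V`. -/
def free (V : LCS.{u}) : Mod LCS.{u} A where
  X := A ⊗ V
  mod :=
    { smul := (α_ A A V).inv ≫ μ[A] ▷ V
      one_smul := el_ext fun c w => by
        change (μ[A] ▷ V).hom ((α_ A A V).inv.hom ((η[A] ▷ (A ⊗ V)).hom _)) =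
          (λ_ (A ⊗ V)).hom.hom _
        rw [whiskerRight_el, one_hom_apply, smul_el, map_smul, map_smul, leftUnitor_hom_el]
        refine congrArg (val c • ·) ?_
        have h : elL (A ⊗ V) (oneElt A) ≫ (α_ A A V).inv ≫ μ[A] ▷ V = 𝟙 (A ⊗ V) :=
          el_ext fun a v => by
            rw [comp_apply, comp_apply, elL_apply, associator_inv_el, whiskerRight_el]
            exact congrArg (el · v) (one_mulElt A a)
        exact congrArg (fun k => LCS.Hom.hom k w) h
      mul_smul := el_ext₃ fun a b w => by
        have h : elL (A ⊗ V) (mulElt A a b) ≫ (α_ A A V).inv ≫ μ[A] ▷ V =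
            (elL (A ⊗ V) b ≫ (α_ A A V).inv ≫ μ[A] ▷ V) ≫
              elL (A ⊗ V) a ≫ (α_ A A V).inv ≫ μ[A] ▷ V :=
          el_ext fun c v => by
            simp only [comp_apply, elL_apply, associator_inv_el, whiskerRight_el]
            exact congrArg (el · v) (mulElt_assoc A a b c)
        have h' := congrArg (fun k => LCS.Hom.hom k w) h
        change (μ[A] ▷ V).hom ((α_ A A V).inv.hom ((μ[A] ▷ (A ⊗ V)).hom _)) =
          (μ[A] ▷ V).hom ((α_ A A V).inv.hom ((A ◁ ((α_ A A V).inv ≫ μ[A] ▷ V)).hom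
            ((α_ A A (A ⊗ V)).hom.hom _)))
        rw [whiskerRight_el, associator_hom_el, whiskerLeft_el]
        exact h' }

theorem free_act (V : LCS.{u}) (a b : A) (v : V) :
    Mod.act (free A V) a (el b v) = el (mulElt A a b) v := by
  change (μ[A] ▷ V).hom ((α_ A A V).inv.hom (el a (el b v))) = _
  rw [associator_inv_el, whiskerRight_el]
  rfl

/-- `a ↦ a · x`. -/
def actL (X : Mod LCS.{u} A) (a : A) : X.X →L[ℂ] X.X :=
  (γ[A, X.X] : A ⊗ X.X ⟶ X.X).hom.comp (tmulL X.X a)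

theorem actL_apply (X : Mod LCS.{u} A) (a : A) (x : X.X) : actL X a x = Mod.act X a x := rfl

/-- The morphism `A ⊗̂ V → X` of modules given by a continuous linear map `V → X`. -/
def freeDesc {V : LCS.{u}} {X : Mod LCS.{u} A} (t : V ⟶ X.X) : free A V ⟶ X :=
  homOfAct (X := free A V) (A ◁ t ≫ (γ[A, X.X] : A ⊗ X.X ⟶ X.X)) fun a w => by
    refine tens_ext (X := A) (Y := V)
      (f := (A ◁ t ≫ (γ[A, X.X] : A ⊗ X.X ⟶ X.X)).hom.comp (actL (free A V) a))
      (g := (actL X a).comp (A ◁ t ≫ (γ[A, X.X] : A ⊗ X.X ⟶ X.X)).hom) (fun b v => ?_) w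
    change (A ◁ t ≫ (γ[A, X.X] : A ⊗ X.X ⟶ X.X)).hom (Mod.act (free A V) a (el b v)) =
      Mod.act X a ((A ◁ t ≫ (γ[A, X.X] : A ⊗ X.X ⟶ X.X)).hom (el b v))
    rw [free_act, comp_apply, comp_apply, whiskerLeft_el, whiskerLeft_el]
    exact smul_mul X a b (t.hom v)

theorem freeDesc_el {V : LCS.{u}} {X : Mod LCS.{u} A} (t : V ⟶ X.X) (a : A) (v : V) :
    (freeDesc t).hom.hom (el a v) = Mod.act X a (t.hom v) := by
  change (A ◁ t ≫ (γ[A, X.X] : A ⊗ X.X ⟶ X.X)).hom (el a v) = _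
  rw [comp_apply, whiskerLeft_el]
  rfl

/-- Morphisms from a projective module lift along `d` as soon as they lift along `d` as continuous
linear maps. No kernel of `d` is needed, since a projective module is a retract of a free
module. -/
theorem IsProjective.exists_lift {P : Mod LCS.{u} A} (hP : IsProjective P) {X Y : Mod LCS.{u} A}
    (d : X ⟶ Y) (f : P ⟶ Y) (t : P.X →L[ℂ] X.X) (ht : ∀ p, d.hom.hom (t p) = f.hom.hom p) :
    ∃ g : P ⟶ X, ∀ p, d.hom.hom (g.hom.hom p) = f.hom.hom p := by
  obtain ⟨i, hi⟩ := hP (free A P.X) P (freeDesc (𝟙 P.X))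
    ⟨tmulL P.X (oneElt A), fun p => (freeDesc_el (𝟙 P.X) _ p).trans (smul_one P p)⟩ (𝟙 P)
  have h (w : (free A P.X).X) : d.hom.hom ((freeDesc (X := X) (ofHom t)).hom.hom w) =
      f.hom.hom ((freeDesc (𝟙 P.X)).hom.hom w) := by
    refine tens_ext (X := A) (Y := P.X) (f := d.hom.hom.comp (freeDesc (X := X) (ofHom t)).hom.hom)
      (g := f.hom.hom.comp (freeDesc (𝟙 P.X)).hom.hom) (fun a p => ?_) w
    refine (congrArg d.hom.hom (freeDesc_el (X := X) (ofHom t) a p)).trans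
      (Eq.trans ?_ (congrArg f.hom.hom (freeDesc_el (𝟙 P.X) a p)).symm)
    rw [hom_act, hom_act]
    exact congrArg _ (ht p)
  refine ⟨i ≫ freeDesc (ofHom t), fun p => ?_⟩
  exact (h (i.hom.hom p)).trans (congrArg (fun k : P ⟶ P => f.hom.hom (k.hom.hom p)) hi)

end Free

/-! ### The comparison theorem -/

/-- Dependent choice along the natural numbers. -/
theorem exists_seq {T : ℕ → Type*} (good : ∀ n, T n → Prop) (R : ∀ n, T n → T (n + 1) → Prop)
    (t₀ : T 0) (h₀ : good 0 t₀) (h : ∀ n t, good n t → ∃ t', good (n + 1) t' ∧ R n t t') :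
    ∃ t : ∀ n, T n, t 0 = t₀ ∧ ∀ n, R n (t n) (t (n + 1)) := by
  choose F hF using h
  let S : ∀ n, {t : T n // good n t} := fun n =>
    Nat.rec ⟨t₀, h₀⟩ (fun n t => ⟨F n t.1 t.2, (hF n t.1 t.2).1⟩) n
  exact ⟨fun n => (S n).1, rfl, fun n => (hF n (S n).1 (S n).2).2⟩

namespace AugComplex

variable {A : LCS.{u}} [MonObj A] {X : Mod LCS.{u} A}

/-- The kernel of the differential (in degree `0`, of the augmentation) of an augmented complex. -/
def ker (C : AugComplex X) : (n : ℕ) → Submodule ℂ (C.P n).X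
  | 0 => LinearMap.ker C.aug.hom.hom.toLinearMap
  | n + 1 => LinearMap.ker (C.d n).hom.hom.toLinearMap

/-- In a split complex, a morphism from a projective module to the cycles lifts along the
differential: on cycles, the contracting homotopy is a right inverse of the differential. -/
theorem exists_lift {C : AugComplex X} (hC : C.IsAdmissible) {P : Mod LCS.{u} A}
    (hP : IsProjective P) (n : ℕ) (f : P ⟶ C.P n) (hf : ∀ p, f.hom.hom p ∈ C.ker n) :
    ∃ g : P ⟶ C.P (n + 1), ∀ p, (C.d n).hom.hom (g.hom.hom p) = f.hom.hom p := by
  obtain ⟨s₀, s, -, h₀, h⟩ := hC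
  refine hP.exists_lift (C.d n) f ((s n).comp f.hom.hom) fun p => ?_
  cases n with
  | zero =>
    have e := h₀ (f.hom.hom p)
    have e' : C.aug.hom.hom (f.hom.hom p) = 0 := hf p
    rw [e', map_zero, zero_add] at e
    exact e
  | succ n =>
    have e := h n (f.hom.hom p)
    have e' : (C.d n).hom.hom (f.hom.hom p) = 0 := hf p
    rw [e', map_zero, zero_add] at e
    exact e

/-- A morphism of augmented complexes over the identity of `X`. -/
structure ChainMap (C D : AugComplex X) where
  f : ∀ n, C.P n ⟶ D.P n
  comm : ∀ n x, (D.d n).hom.hom ((f (n + 1)).hom.hom x) = (f n).hom.hom ((C.d n).hom.hom x)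
  aug : ∀ x, D.aug.hom.hom ((f 0).hom.hom x) = C.aug.hom.hom x

/-- The identity morphism. -/
def ChainMap.id (C : AugComplex X) : ChainMap C C where
  f n := 𝟙 (C.P n)
  comm _ _ := rfl
  aug _ := rfl

/-- The composition of morphisms of augmented complexes. -/
def ChainMap.comp {C D E : AugComplex X} (f : ChainMap C D) (g : ChainMap D E) : ChainMap C E where
  f n := f.f n ≫ g.f n
  comm n x := (g.comm n _).trans (congrArg (g.f n).hom.hom (f.comm n x))
  aug x := (g.aug _).trans (f.aug x)

/-- Homotopy of morphisms of augmented complexes, by morphisms of modules. -/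
def Homotopic {C D : AugComplex X} (f g : ChainMap C D) : Prop :=
  ∃ h : ∀ n, C.P n ⟶ D.P (n + 1),
    (∀ x, (D.d 0).hom.hom ((h 0).hom.hom x) = (f.f 0).hom.hom x - (g.f 0).hom.hom x) ∧
    ∀ n x, (D.d (n + 1)).hom.hom ((h (n + 1)).hom.hom x) =
      (f.f (n + 1)).hom.hom x - (g.f (n + 1)).hom.hom x - (h n).hom.hom ((C.d n).hom.hom x)

/-- The identity of `X` extends to a morphism from a complex of projectives to a split complex. -/
theorem exists_chainMap {C D : AugComplex X} (hC : ∀ n, IsProjective (C.P n))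
    (hD : D.IsAdmissible) : Nonempty (ChainMap C D) := by
  obtain ⟨f₀, hf₀⟩ : ∃ f₀ : C.P 0 ⟶ D.P 0,
      ∀ x, D.aug.hom.hom (f₀.hom.hom x) = C.aug.hom.hom x := by
    obtain ⟨s₀, s, h, -, -⟩ := hD
    exact (hC 0).exists_lift D.aug C.aug (s₀.comp C.aug.hom.hom) fun p => h _
  -- The component in degree `n` can be continued if it maps boundaries to cycles.
  obtain ⟨f, h0, h⟩ := exists_seq (T := fun n => C.P n ⟶ D.P n)
    (fun n f => ∀ x, f.hom.hom ((C.d n).hom.hom x) ∈ D.ker n)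
    (fun n f f' => ∀ x, (D.d n).hom.hom (f'.hom.hom x) = f.hom.hom ((C.d n).hom.hom x)) f₀
    (fun x => (hf₀ _).trans (C.aug_d x))
    (fun n f hf => by
      obtain ⟨g, hg⟩ := exists_lift hD (hC (n + 1)) n (C.d n ≫ f) hf
      refine ⟨g, fun x => ?_, hg⟩
      have e := hg ((C.d (n + 1)).hom.hom x)
      refine e.trans ?_
      change f.hom.hom ((C.d n).hom.hom ((C.d (n + 1)).hom.hom x)) = 0
      rw [C.d_d, map_zero])
  exact ⟨⟨f, h, fun x => by rw [h0]; exact hf₀ x⟩⟩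

/-- Two such extensions are homotopic. -/
theorem homotopic_of_projective {C D : AugComplex X} (hC : ∀ n, IsProjective (C.P n))
    (hD : D.IsAdmissible) (f g : ChainMap C D) : Homotopic f g := by
  have hsub {P Q : Mod LCS.{u} A} (k l : P ⟶ Q) :
      ∃ m : P ⟶ Q, ∀ x, m.hom.hom x = k.hom.hom x - l.hom.hom x := by
    obtain ⟨m, hm⟩ := (mem_homs_iff _).1 ((homs P Q).sub_mem
      ((mem_homs_iff _).2 ⟨k, rfl⟩) ((mem_homs_iff _).2 ⟨l, rfl⟩))
    exact ⟨m, fun x => by rw [hm]; rfl⟩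
  choose e he using fun n => hsub (f.f n) (g.f n)
  have hed (n : ℕ) (x) : (D.d n).hom.hom ((e (n + 1)).hom.hom x) =
      (e n).hom.hom ((C.d n).hom.hom x) := by
    rw [he, he, map_sub, f.comm, g.comm]
  obtain ⟨h₀, hh₀⟩ := exists_lift hD (hC 0) 0 (e 0) fun x => by
    change D.aug.hom.hom _ = 0
    rw [he, map_sub, f.aug, g.aug, sub_self]
  -- With `e = f - g`, the homotopy in degree `n` can be continued if `d h d = e d`, which makes
  -- `e - h d` in degree `n + 1` a cycle.
  obtain ⟨h, h0, hs⟩ := exists_seq (T := fun n => C.P n ⟶ D.P (n + 1))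
    (fun n h => ∀ x, (D.d n).hom.hom (h.hom.hom ((C.d n).hom.hom x)) =
      (e n).hom.hom ((C.d n).hom.hom x))
    (fun n h h' => ∀ x, (D.d (n + 1)).hom.hom (h'.hom.hom x) =
      (e (n + 1)).hom.hom x - h.hom.hom ((C.d n).hom.hom x)) h₀
    (fun x => hh₀ _)
    (fun n h hh => by
      obtain ⟨m, hm⟩ := hsub (e (n + 1)) (C.d n ≫ h)
      have hm' (x) : m.hom.hom x = (e (n + 1)).hom.hom x - h.hom.hom ((C.d n).hom.hom x) := hm x
      obtain ⟨k, hk⟩ := exists_lift hD (hC (n + 1)) (n + 1) m fun x => by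
        change (D.d n).hom.hom _ = 0
        rw [hm', map_sub, hh, hed, sub_self]
      refine ⟨k, fun x => ?_, fun x => (hk x).trans (hm' x)⟩
      rw [hk, hm', C.d_d, map_zero, sub_zero])
  exact ⟨h, fun x => by rw [h0, hh₀, he], fun n x => by rw [hs, he]⟩

/-- Mutually inverse homotopy equivalences between two projective resolutions. -/
theorem IsProjectiveResolution.exists_homotopyEquiv {C D : AugComplex X}
    (hC : C.IsProjectiveResolution) (hD : D.IsProjectiveResolution) :
    ∃ (f : ChainMap C D) (g : ChainMap D C),
      Homotopic (f.comp g) (ChainMap.id C) ∧ Homotopic (g.comp f) (ChainMap.id D) := by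
  obtain ⟨f⟩ := exists_chainMap hC.2 hD.1
  obtain ⟨g⟩ := exists_chainMap hD.2 hC.1
  exact ⟨f, g, homotopic_of_projective hC.2 hC.1 _ _, homotopic_of_projective hD.2 hD.1 _ _⟩

end AugComplex

/-! ### Independence of `Ext` and `Tor` of the resolution -/

section Invariance

variable {A : LCS.{u}} [MonObj A] {X : Mod LCS.{u} A}

namespace AugComplex

variable {C D : AugComplex X}

theorem precomp_mem_cocycles (f : ChainMap C D) (Y : Mod LCS.{u} A) (n : ℕ)
    (k : homs (D.P n) Y) (hk : k ∈ cocycles D Y n) :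
    homs.precomp (f.f n) Y k ∈ cocycles C Y n := by
  refine LinearMap.mem_ker.2 (Subtype.ext (ContinuousLinearMap.ext fun x => ?_))
  have h : homs.precomp (D.d n) Y k = 0 := hk
  have h' : k.1 ((D.d n).hom.hom ((f.f (n + 1)).hom.hom x)) = 0 :=
    congrArg (fun l : homs (D.P (n + 1)) Y => l.1 ((f.f (n + 1)).hom.hom x)) h
  rw [f.comm] at h'
  exact h'

theorem precomp_mem_coboundaries (f : ChainMap C D) (Y : Mod LCS.{u} A) (n : ℕ)
    (k : homs (D.P n) Y) (hk : k ∈ coboundaries D Y n) :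
    homs.precomp (f.f n) Y k ∈ coboundaries C Y n := by
  cases n with
  | zero =>
    have h : k = 0 := hk
    rw [h, map_zero]
    exact Submodule.zero_mem _
  | succ n =>
    obtain ⟨l, rfl⟩ := hk
    refine ⟨homs.precomp (f.f n) Y l, Subtype.ext (ContinuousLinearMap.ext fun x => ?_)⟩
    exact congrArg l.1 (f.comm n x).symm

/-- Homotopic morphisms agree on cocycles modulo coboundaries. -/
theorem Homotopic.precomp_sub_mem {f g : ChainMap C D} (h : Homotopic f g) (Y : Mod LCS.{u} A)
    (n : ℕ) (k : homs (D.P n) Y) (hk : k ∈ cocycles D Y n) :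
    homs.precomp (f.f n) Y k - homs.precomp (g.f n) Y k ∈ coboundaries C Y n := by
  obtain ⟨s, h₀, h⟩ := h
  have hk' : homs.precomp (D.d n) Y k = 0 := hk
  have hkd (y) : k.1 ((D.d n).hom.hom y) = 0 :=
    congrArg (fun l : homs (D.P (n + 1)) Y => l.1 y) hk'
  cases n with
  | zero =>
    refine (Submodule.mem_bot ℂ).2 (Subtype.ext (ContinuousLinearMap.ext fun x => ?_))
    have e := hkd ((s 0).hom.hom x)
    rw [h₀, map_sub] at e
    exact e
  | succ n =>
    refine ⟨homs.precomp (s n) Y k, Subtype.ext (ContinuousLinearMap.ext fun x => ?_)⟩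
    have e := hkd ((s (n + 1)).hom.hom x)
    rw [h, map_sub, map_sub] at e
    exact (sub_eq_zero.1 e).symm

/-- Homotopy equivalent complexes have the same `Ext`. -/
def extEquiv (f : ChainMap C D) (g : ChainMap D C) (hfg : Homotopic (f.comp g) (ChainMap.id C))
    (hgf : Homotopic (g.comp f) (ChainMap.id D)) (Y : Mod LCS.{u} A) (n : ℕ) :
    Ext C Y n ≃ₗ[ℂ] Ext D Y n :=
  subquotientEquiv (homs.precomp (g.f n) Y) (homs.precomp (f.f n) Y)
    (precomp_mem_cocycles g Y n) (precomp_mem_coboundaries g Y n)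
    (precomp_mem_cocycles f Y n) (precomp_mem_coboundaries f Y n)
    (hfg.precomp_sub_mem Y n) (hgf.precomp_sub_mem Y n)

theorem extEquiv_natural (f : ChainMap C D) (g : ChainMap D C)
    (hfg : Homotopic (f.comp g) (ChainMap.id C)) (hgf : Homotopic (g.comp f) (ChainMap.id D))
    {Y Y' : Mod LCS.{u} A} (k : Y ⟶ Y') (n : ℕ) (x : Ext C Y n) :
    extEquiv f g hfg hgf Y' n (ExtMap C k n x) = ExtMap D k n (extEquiv f g hfg hgf Y n x) := by
  obtain ⟨x, rfl⟩ := Submodule.Quotient.mk_surjective _ x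
  rfl

end AugComplex

theorem tel_sub {R : RMod A} {Y : Mod LCS.{u} A} (x : R.X) (y y' : Y.X) :
    (tel x (y - y') : tensorOver R Y) = tel x y - tel x y' :=
  map_sub ((toTensorOver R Y).hom.comp (tmulL Y.X x)) y y'

theorem tensorOver_extL {R : RMod A} {Y : Mod LCS.{u} A} {Z : LCS.{u}}
    {f g : tensorOver R Y →L[ℂ] Z} (h : ∀ x y, f (tel x y) = g (tel x y)) (w : tensorOver R Y) :
    f w = g w :=
  congrArg (fun k => LCS.Hom.hom k w) (tensorOver_ext (f := ofHom f) (g := ofHom g) h)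

namespace AugComplex

variable {C D : AugComplex X} (R : RMod A)

/-- The map `R ⊗̂_A C n → R ⊗̂_A D n` given by a morphism of complexes. -/
def tensorChain (f : ChainMap C D) (n : ℕ) : tensorOver R (C.P n) →L[ℂ] tensorOver R (D.P n) :=
  (tensorOverMap (RMod.Hom.id R) (f.f n)).hom

theorem tensorChain_tel (f : ChainMap C D) (n : ℕ) (r : R.X) (x : (C.P n).X) :
    tensorChain R f n (tel r x) = tel r ((f.f n).hom.hom x) :=
  tensorOverMap_tel _ _ _ _

theorem tensorD_tel (C : AugComplex X) (n : ℕ) (r : R.X) (x : (C.P (n + 1)).X) :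
    tensorD R C n (tel r x) = tel r ((C.d n).hom.hom x) :=
  tensorOverMap_tel _ _ _ _

theorem tensorChain_tensorD (f : ChainMap C D) (n : ℕ) (w : tensorOver R (C.P (n + 1))) :
    tensorChain R f n (tensorD R C n w) = tensorD R D n (tensorChain R f (n + 1) w) := by
  refine tensorOver_extL (f := (tensorChain R f n).comp (tensorD R C n))
    (g := (tensorD R D n).comp (tensorChain R f (n + 1))) (fun r x => ?_) w
  rw [ContinuousLinearMap.comp_apply, ContinuousLinearMap.comp_apply, tensorD_tel, tensorChain_tel,
    tensorChain_tel, tensorD_tel, f.comm]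

theorem tensorChain_mem_cycles (f : ChainMap C D) (n : ℕ) (w : tensorOver R (C.P n))
    (hw : w ∈ cycles R C n) : tensorChain R f n w ∈ cycles R D n := by
  cases n with
  | zero => exact Submodule.mem_top
  | succ n =>
    have h : tensorD R C n w = 0 := hw
    have h' := tensorChain_tensorD R f n w
    rw [h, map_zero] at h'
    exact h'.symm

theorem tensorChain_mem_boundaries (f : ChainMap C D) (n : ℕ) (w : tensorOver R (C.P n))
    (hw : w ∈ boundaries R C n) : tensorChain R f n w ∈ boundaries R D n := by
  obtain ⟨v, rfl⟩ := hw
  exact ⟨tensorChain R f (n + 1) v, (tensorChain_tensorD R f n v).symm⟩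

/-- Homotopic morphisms agree on cycles modulo boundaries. -/
theorem Homotopic.tensorChain_sub_mem {f g : ChainMap C D} (h : Homotopic f g) (n : ℕ)
    (w : tensorOver R (C.P n)) (hw : w ∈ cycles R C n) :
    tensorChain R f n w - tensorChain R g n w ∈ boundaries R D n := by
  obtain ⟨s, h₀, h⟩ := h
  let S (n : ℕ) : tensorOver R (C.P n) →L[ℂ] tensorOver R (D.P (n + 1)) :=
    (tensorOverMap (RMod.Hom.id R) (s n)).hom
  have hS (n : ℕ) (r : R.X) (x : (C.P n).X) : S n (tel r x) = tel r ((s n).hom.hom x) :=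
    tensorOverMap_tel _ _ _ _
  refine ⟨S n w, ?_⟩
  cases n with
  | zero =>
    refine tensorOver_extL (f := (tensorD R D 0).comp (S 0))
      (g := tensorChain R f 0 - tensorChain R g 0) (fun r x => ?_) w
    rw [ContinuousLinearMap.comp_apply, sub_apply, hS, tensorD_tel,
      tensorChain_tel, tensorChain_tel, h₀, tel_sub]
  | succ n =>
    have e := tensorOver_extL (f := (tensorD R D (n + 1)).comp (S (n + 1)))
      (g := tensorChain R f (n + 1) - tensorChain R g (n + 1) - (S n).comp (tensorD R C n))
      (fun r x => by
        rw [ContinuousLinearMap.comp_apply, sub_apply,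
          sub_apply, ContinuousLinearMap.comp_apply, hS, tensorD_tel,
          tensorChain_tel, tensorChain_tel, tensorD_tel, hS, h, tel_sub, tel_sub]) w
    have hw' : tensorD R C n w = 0 := hw
    rw [ContinuousLinearMap.comp_apply, sub_apply,
      sub_apply, ContinuousLinearMap.comp_apply, hw', map_zero, sub_zero] at e
    exact e

/-- Homotopy equivalent complexes have the same `Tor`. -/
def torEquiv (f : ChainMap C D) (g : ChainMap D C) (hfg : Homotopic (f.comp g) (ChainMap.id C))
    (hgf : Homotopic (g.comp f) (ChainMap.id D)) (n : ℕ) : Tor R C n ≃L[ℂ] Tor R D n :=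
  have hcomp {C D E : AugComplex X} (f : ChainMap C D) (g : ChainMap D E) (w) :
      tensorChain R g n (tensorChain R f n w) = tensorChain R (f.comp g) n w :=
    tensorOver_extL (f := (tensorChain R g n).comp (tensorChain R f n))
      (g := tensorChain R (f.comp g) n) (fun r x => by
        rw [ContinuousLinearMap.comp_apply, tensorChain_tel, tensorChain_tel, tensorChain_tel]
        rfl) w
  have hid (C : AugComplex X) (w) : tensorChain R (ChainMap.id C) n w = w :=
    tensorOver_extL (f := tensorChain R (ChainMap.id C) n) (g := ContinuousLinearMap.id ℂ _)
      (fun r x => tensorChain_tel _ _ _ _ _) w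
  subquotientEquivL (tensorChain R f n) (tensorChain R g n)
    (tensorChain_mem_cycles R f n) (tensorChain_mem_boundaries R f n)
    (tensorChain_mem_cycles R g n) (tensorChain_mem_boundaries R g n)
    (fun w hw => by
      have e := hfg.tensorChain_sub_mem R n w hw
      rw [← hcomp, hid] at e
      exact e)
    (fun w hw => by
      have e := hgf.tensorChain_sub_mem R n w hw
      rw [← hcomp, hid] at e
      exact e)

theorem torEquiv_natural (f : ChainMap C D) (g : ChainMap D C)
    (hfg : Homotopic (f.comp g) (ChainMap.id C)) (hgf : Homotopic (g.comp f) (ChainMap.id D))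
    {R R' : RMod A} (k : RMod.Hom R R') (n : ℕ) (x : Tor R C n) :
    torEquiv R' f g hfg hgf n (TorMap C k n x) = TorMap D k n (torEquiv R f g hfg hgf n x) := by
  obtain ⟨x, rfl⟩ := Submodule.Quotient.mk_surjective _ x
  refine congrArg Submodule.Quotient.mk (Subtype.ext ?_)
  refine tensorOver_extL (f := (tensorChain R' f n).comp (tensorF C k n))
    (g := (tensorF D k n).comp (tensorChain R f n)) (fun r y => ?_) x.1
  rw [ContinuousLinearMap.comp_apply, ContinuousLinearMap.comp_apply, tensorChain_tel]
  refine (congrArg _ (tensorOverMap_tel k (𝟙 (C.P n)) r y)).trans ?_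
  exact (tensorChain_tel _ _ _ _ _).trans (tensorOverMap_tel k (𝟙 (D.P n)) r _).symm

end AugComplex

end Invariance

/-! ### Extension of scalars -/

section Extension

variable {A B : LCS.{u}} [MonObj A] [MonObj B] (f : A ⟶ B) [IsMonHom f]

/-- The left `B`-module `B ⊗̂_A Y`, for an algebra homomorphism `f : A → B`. -/
abbrev Extend (Y : Mod LCS.{u} A) : Mod LCS.{u} B := (BiMod.ofHom f).tensor Y

/-- The elementary tensor `b ⊗ y` in `B ⊗̂_A Y`, with `b` typed as an element of `B` rather than of
the underlying right module of the bimodule `B`. -/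
def etel {Y : Mod LCS.{u} A} (b : B) (y : Y.X) : (Extend f Y).X :=
  (tel (X := (BiMod.ofHom f).toRMod) (Y := Y) b y : tensorOver (BiMod.ofHom f).toRMod Y)

variable {Y : Mod LCS.{u} A}

theorem ofHom_actElt (b : B) (a : A) :
    (BiMod.ofHom f).actElt b a = mulElt B b (f.hom a) := by
  change (B ◁ f ≫ μ[B]).hom (el b a) = _
  rw [comp_apply, whiskerLeft_el]
  rfl

/-- The relation `b f(a) ⊗ y = b ⊗ a y`. -/
theorem etel_mul (b : B) (a : A) (y : Y.X) :
    etel f (mulElt B b (f.hom a)) y = etel f b (Mod.act Y a y) :=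
  (congrArg (etel f · y) (ofHom_actElt f b a)).symm.trans
    (tel_actElt (X := (BiMod.ofHom f).toRMod) (Y := Y) b a y)

theorem act_etel (b b' : B) (y : Y.X) :
    Mod.act (Extend f Y) b (etel f b' y) = etel f (mulElt B b b') y :=
  tensAct_tel (BiMod.ofHom f) Y b b' y

theorem etel_ext {f : A ⟶ B} [IsMonHom f] {Z : LCS.{u}} {g h : (Extend f Y).X →L[ℂ] Z}
    (e : ∀ b y, g (etel f b y) = h (etel f b y)) (w : (Extend f Y).X) : g w = h w :=
  tensorOver_extL (R := (BiMod.ofHom f).toRMod) (Y := Y) e w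

/-- The map on `B ⊗̂_A Y` given by a balanced map on `B ⊗̂ Y`. -/
def etelDesc {Z : LCS.{u}} (t : B ⊗ Y.X ⟶ Z)
    (ht : ∀ b a y, t.hom (el (mulElt B b (f.hom a)) y) = t.hom (el b (Mod.act Y a y))) :
    (Extend f Y).X ⟶ Z :=
  quotDesc t (eq_zero_of_balanced (X := (BiMod.ofHom f).toRMod) (Y := Y) t fun b a y =>
    (congrArg (fun b' : B => t.hom (el b' y)) (ofHom_actElt f b a)).trans (ht b a y))

theorem etelDesc_etel {Z : LCS.{u}} (t : B ⊗ Y.X ⟶ Z)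
    (ht : ∀ b a y, t.hom (el (mulElt B b (f.hom a)) y) = t.hom (el b (Mod.act Y a y)))
    (b : B) (y : Y.X) : (etelDesc f t ht).hom (etel f b y) = t.hom (el b y) :=
  quotDesc_proj _ _ _

theorem tensorMap_etel {Y' : Mod LCS.{u} A} (g : Y ⟶ Y') (b : B) (y : Y.X) :
    ((BiMod.ofHom f).tensorMap g).hom.hom (etel f b y) = etel f b (g.hom.hom y) :=
  tensorOverMap_tel (RMod.Hom.id (BiMod.ofHom f).toRMod) g b y

/-- `b ⊗ y` as a continuous linear function of `y`. -/
def etelL (Y : Mod LCS.{u} A) (b : B) : Y.X →L[ℂ] (Extend f Y).X :=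
  (toTensorOver (BiMod.ofHom f).toRMod Y).hom.comp (tmulL Y.X b)

theorem etelL_apply (b : B) (y : Y.X) : etelL f Y b y = etel f b y := rfl

/-- The identity map `_f M → M`, from the restriction of scalars of `M` to `M`. -/
def fromRes (M : Mod LCS.{u} B) : ((Mod.comap f).obj M).X →L[ℂ] M.X :=
  ContinuousLinearMap.id ℂ M.X

/-- The identity map `M → _f M`. -/
def toRes (M : Mod LCS.{u} B) : M.X →L[ℂ] ((Mod.comap f).obj M).X :=
  ContinuousLinearMap.id ℂ M.X

theorem fromRes_act (M : Mod LCS.{u} B) (a : A) (m : ((Mod.comap f).obj M).X) :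
    fromRes f M (Mod.act ((Mod.comap f).obj M) a m) = Mod.act M (f.hom a) (fromRes f M m) := by
  have h₁ := comp_apply (f ▷ M.X) (γ[B, M.X] : B ⊗ M.X ⟶ M.X) (el a (fromRes f M m))
  rw [whiskerRight_el] at h₁
  exact h₁

theorem toRes_act (M : Mod LCS.{u} B) (a : A) (m : M.X) :
    toRes f M (Mod.act M (f.hom a) m) = Mod.act ((Mod.comap f).obj M) a (toRes f M m) :=
  (fromRes_act f M a (toRes f M m)).symm

/-- The map `b ⊗ y ↦ b · k(y)` on `B ⊗̂ Y`. -/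
def extend₀ {M : Mod LCS.{u} B} (k : homs Y ((Mod.comap f).obj M)) : B ⊗ Y.X ⟶ M.X :=
  B ◁ ofHom ((fromRes f M).comp k.1) ≫ (γ[B, M.X] : B ⊗ M.X ⟶ M.X)

theorem extend₀_el {M : Mod LCS.{u} B} (k : homs Y ((Mod.comap f).obj M)) (b : B) (y : Y.X) :
    (extend₀ f k).hom (el b y) = Mod.act M b (fromRes f M (k.1 y)) := by
  rw [extend₀, comp_apply, whiskerLeft_el]
  rfl

theorem extend₀_balanced {M : Mod LCS.{u} B} (k : homs Y ((Mod.comap f).obj M)) (b : B) (a : A)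
    (y : Y.X) : (extend₀ f k).hom (el (mulElt B b (f.hom a)) y) =
      (extend₀ f k).hom (el b (Mod.act Y a y)) := by
  rw [extend₀_el, extend₀_el, k.2, fromRes_act, smul_mul]

/-- The morphism `b ⊗ y ↦ b · k(y)` of `B`-modules on `B ⊗̂_A Y`. -/
def extend {M : Mod LCS.{u} B} (k : homs Y ((Mod.comap f).obj M)) : Extend f Y ⟶ M :=
  homOfAct (etelDesc f (extend₀ f k) (extend₀_balanced f k)) fun b w =>
    etel_ext
      (g := (etelDesc f (extend₀ f k) (extend₀_balanced f k)).hom.comp (actL (Extend f Y) b))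
      (h := (actL M b).comp (etelDesc f (extend₀ f k) (extend₀_balanced f k)).hom) (fun b' y => by
        rw [ContinuousLinearMap.comp_apply, ContinuousLinearMap.comp_apply, actL_apply, actL_apply,
          act_etel, etelDesc_etel, etelDesc_etel, extend₀_el, extend₀_el, smul_mul]) w

theorem extend_etel {M : Mod LCS.{u} B} (k : homs Y ((Mod.comap f).obj M)) (b : B) (y : Y.X) :
    (extend f k).hom.hom (etel f b y) = Mod.act M b (fromRes f M (k.1 y)) :=
  (etelDesc_etel f _ (extend₀_balanced f k) b y).trans (extend₀_el f k b y)

/-- The adjunction `_B h(B ⊗̂_A Y, M) ≅ _A h(Y, M)`. -/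
def adjunction (Y : Mod LCS.{u} A) (M : Mod LCS.{u} B) :
    homs (Extend f Y) M ≃ₗ[ℂ] homs Y ((Mod.comap f).obj M) where
  toFun k := ⟨(toRes f M).comp (k.1.comp (etelL f Y (oneElt B))), fun a y => by
    change toRes f M (k.1 (etel f _ _)) = Mod.act _ a (toRes f M (k.1 (etel f _ _)))
    rw [← etel_mul, one_mulElt, ← toRes_act, ← k.2, act_etel, mulElt_one]⟩
  map_add' _ _ := rfl
  map_smul' _ _ := rfl
  invFun k := ⟨(extend f k).hom.hom, hom_act (extend f k)⟩
  left_inv k := Subtype.ext (ContinuousLinearMap.ext fun w =>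
    etel_ext (g := (extend f _).hom.hom) (h := k.1) (fun b y => by
      rw [extend_etel]
      change Mod.act M b (k.1 (etel f _ _)) = _
      rw [← k.2, act_etel, mulElt_one]) w)
  right_inv k := Subtype.ext (ContinuousLinearMap.ext fun y =>
    (extend_etel f k (oneElt B) y).trans (smul_one M _))

/-- Extension of scalars preserves projectivity, since restriction of scalars preserves admissible
epimorphisms. -/
theorem IsProjective.extend (hY : IsProjective Y) : IsProjective (Extend f Y) := by
  intro M N σ ⟨τ, hτ⟩ g
  obtain ⟨k, hk⟩ := (mem_homs_iff _).1 (adjunction f Y N ⟨g.hom.hom, hom_act g⟩).2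
  obtain ⟨l, hl⟩ := hY _ _ ((Mod.comap f).map σ) ⟨τ, hτ⟩ k
  refine ⟨LCS.extend f ⟨l.hom.hom, hom_act l⟩, Mod.Hom.ext (hom_ext fun w => ?_)⟩
  refine etel_ext (g := σ.hom.hom.comp (LCS.extend f ⟨l.hom.hom, hom_act l⟩).hom.hom)
    (h := g.hom.hom) (fun b y => ?_) w
  have e : σ.hom.hom (fromRes f M (l.hom.hom y)) = g.hom.hom (etel f (oneElt B) y) :=
    (congrArg (fun m : Y ⟶ (Mod.comap f).obj N => m.hom.hom y) hl).trans
      (congrArg (fun m : Y.X →L[ℂ] ((Mod.comap f).obj N).X => m y) hk)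
  rw [ContinuousLinearMap.comp_apply, extend_etel, hom_act, e, ← hom_act, act_etel, mulElt_one]

variable {X : Mod LCS.{u} A} (P : AugComplex X)

/-- The adjunction in degree `n` of the induced complex. -/
def adjunctionAt (M : Mod LCS.{u} B) (n : ℕ) :
    homs ((P.induce (BiMod.ofHom f)).P n) M ≃ₗ[ℂ] homs (P.P n) ((Mod.comap f).obj M) :=
  adjunction f (P.P n) M

/-- The adjunction is an isomorphism of cochain complexes. -/
theorem adjunctionAt_precomp (M : Mod LCS.{u} B) (n : ℕ)
    (k : homs ((P.induce (BiMod.ofHom f)).P n) M) :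
    adjunctionAt f P M (n + 1) (homs.precomp ((P.induce (BiMod.ofHom f)).d n) M k) =
      homs.precomp (P.d n) ((Mod.comap f).obj M) (adjunctionAt f P M n k) :=
  Subtype.ext (ContinuousLinearMap.ext fun y =>
    congrArg k.1 (tensorMap_etel f (P.d n) (oneElt B) y))

/-- `Ext` of the induced complex is `Ext` of the restricted module. -/
def extInduceEquiv (M : Mod LCS.{u} B) (n : ℕ) :
    Ext (P.induce (BiMod.ofHom f)) M n ≃ₗ[ℂ] Ext P ((Mod.comap f).obj M) n :=
  subquotientEquiv (adjunctionAt f P M n).toLinearMap (adjunctionAt f P M n).symm.toLinearMap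
    (fun k hk => by
      have h : homs.precomp ((P.induce (BiMod.ofHom f)).d n) M k = 0 := hk
      have e := adjunctionAt_precomp f P M n k
      rw [h, map_zero] at e
      exact e.symm)
    (fun k hk => by
      cases n with
      | zero =>
        have h : k = 0 := hk
        rw [h, map_zero]
        exact Submodule.zero_mem _
      | succ n =>
        obtain ⟨l, rfl⟩ := hk
        exact ⟨_, (adjunctionAt_precomp f P M n l).symm⟩)
    (fun k hk => by
      have h : homs.precomp (P.d n) ((Mod.comap f).obj M) k = 0 := hk
      have e := adjunctionAt_precomp f P M n ((adjunctionAt f P M n).symm k)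
      rw [LinearEquiv.apply_symm_apply, h] at e
      exact (LinearEquiv.map_eq_zero_iff _).1 e)
    (fun k hk => by
      cases n with
      | zero =>
        have h : k = 0 := hk
        rw [h, map_zero]
        exact Submodule.zero_mem _
      | succ n =>
        obtain ⟨l, rfl⟩ := hk
        refine ⟨(adjunctionAt f P M n).symm l, (adjunctionAt f P M (n + 1)).injective ?_⟩
        refine (adjunctionAt_precomp f P M n _).trans ?_
        rw [LinearEquiv.apply_symm_apply]
        exact (LinearEquiv.apply_symm_apply _ _).symm)
    (fun k _ => by
      have e : (adjunctionAt f P M n).symm (adjunctionAt f P M n k) - k = 0 := by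
        rw [LinearEquiv.symm_apply_apply, sub_self]
      exact e ▸ Submodule.zero_mem _)
    (fun k _ => by
      have e : (adjunctionAt f P M n) ((adjunctionAt f P M n).symm k) - k = 0 := by
        rw [LinearEquiv.apply_symm_apply, sub_self]
      exact e ▸ Submodule.zero_mem _)

theorem extInduceEquiv_natural {M N : Mod LCS.{u} B} (g : M ⟶ N) (n : ℕ)
    (x : Ext (P.induce (BiMod.ofHom f)) M n) :
    extInduceEquiv f P N n (ExtMap (P.induce (BiMod.ofHom f)) g n x) =
      ExtMap P ((Mod.comap f).map g) n (extInduceEquiv f P M n x) := by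
  obtain ⟨x, rfl⟩ := Submodule.Quotient.mk_surjective _ x
  rfl

/-! ### Cancellation of tensor products -/

section Cancel

variable (N : RMod B) (Y : Mod LCS.{u} A)

/-- The elementary tensor `x ⊗ y` in `N_f ⊗̂_A Y`, where `N_f` is the restriction of scalars of the
right `B`-module `N`. -/
def rtel {N : RMod B} {Y : Mod LCS.{u} A} (x : N.X) (y : Y.X) : tensorOver (RMod.comap f N) Y :=
  tel (X := RMod.comap f N) x y

theorem comap_actElt (x : N.X) (a : A) : (RMod.comap f N).actElt x a = N.actElt x (f.hom a) := by
  change (N.X ◁ f ≫ N.act).hom (el x a) = _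
  rw [comp_apply, whiskerLeft_el]
  rfl

theorem rtel_actElt {N : RMod B} {Y : Mod LCS.{u} A} (x : N.X) (a : A) (y : Y.X) :
    rtel f (N.actElt x (f.hom a)) y = rtel f x (Mod.act Y a y) :=
  (congrArg (fun x' : N.X => rtel f x' y) (comap_actElt f N x a)).symm.trans
    (tel_actElt (X := RMod.comap f N) (Y := Y) x a y)

theorem rtel_ext {f : A ⟶ B} [IsMonHom f] {N : RMod B} {Y : Mod LCS.{u} A} {Z : LCS.{u}}
    {g h : tensorOver (RMod.comap f N) Y →L[ℂ] Z} (e : ∀ x y, g (rtel f x y) = h (rtel f x y))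
    (w : tensorOver (RMod.comap f N) Y) : g w = h w :=
  tensorOver_extL e w

/-- The map on `N_f ⊗̂_A Y` given by a balanced map on `N ⊗̂ Y`. -/
def rtelDesc {N : RMod B} {Y : Mod LCS.{u} A} {Z : LCS.{u}} (t : N.X ⊗ Y.X ⟶ Z)
    (ht : ∀ x a y, t.hom (el (N.actElt x (f.hom a)) y) = t.hom (el x (Mod.act Y a y))) :
    tensorOver (RMod.comap f N) Y →L[ℂ] Z :=
  (quotDesc t (eq_zero_of_balanced (X := RMod.comap f N) (Y := Y) t fun x a y =>
    (congrArg (fun x' : N.X => t.hom (el x' y)) (comap_actElt f N x a)).trans (ht x a y))).hom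

theorem rtelDesc_rtel {N : RMod B} {Y : Mod LCS.{u} A} {Z : LCS.{u}} (t : N.X ⊗ Y.X ⟶ Z)
    (ht : ∀ x a y, t.hom (el (N.actElt x (f.hom a)) y) = t.hom (el x (Mod.act Y a y)))
    (x : N.X) (y : Y.X) : rtelDesc f t ht (rtel f x y) = t.hom (el x y) :=
  quotDesc_proj _ _ _

/-- `x ⊗ y ↦ x ⊗ y` from `N ⊗̂ Y` to `N_f ⊗̂_A Y`. -/
def toRtel : N.X ⊗ Y.X ⟶ tensorOver (RMod.comap f N) Y := toTensorOver (RMod.comap f N) Y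

theorem tensorOver_extend_ext {f : A ⟶ B} [IsMonHom f] {N : RMod B} {Y : Mod LCS.{u} A}
    {Z : LCS.{u}} {g h : tensorOver N (Extend f Y) →L[ℂ] Z}
    (e : ∀ x b y, g (tel x (etel f b y)) = h (tel x (etel f b y)))
    (w : tensorOver N (Extend f Y)) : g w = h w :=
  tensorOver_extL (fun x v =>
    etel_ext (g := g.comp ((toTensorOver N (Extend f Y)).hom.comp (tmulL _ x)))
      (h := h.comp ((toTensorOver N (Extend f Y)).hom.comp (tmulL _ x))) (e x) v) w

/-- The map `x ⊗ (b ⊗ y) ↦ x b ⊗ y` on `N ⊗̂ (B ⊗̂ Y)`. -/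
def cancel₀ : N.X ⊗ (B ⊗ Y.X) ⟶ tensorOver (RMod.comap f N) Y :=
  (α_ N.X B Y.X).inv ≫ N.act ▷ Y.X ≫ toRtel f N Y

theorem cancel₀_el (x : N.X) (b : B) (y : Y.X) :
    (cancel₀ f N Y).hom (el x (el b y)) = rtel f (N.actElt x b) y := by
  rw [cancel₀, comp_apply, comp_apply, associator_inv_el, whiskerRight_el]
  rfl

theorem cancel₀_zero (x : N.X) (w : (B ⊗ Y.X : LCS.{u}))
    (hw : w ∈ balanced (BiMod.ofHom f).toRMod Y) : (cancel₀ f N Y).hom (el x w) = 0 := by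
  refine eq_zero_of_balanced (X := (BiMod.ofHom f).toRMod) (Y := Y)
    (elL (B ⊗ Y.X) x ≫ cancel₀ f N Y) (fun b a y => ?_) w hw
  refine (congrArg (fun b' : B => (cancel₀ f N Y).hom (el x (el b' y)))
    (ofHom_actElt f b a)).trans ((cancel₀_el f N Y x _ y).trans
      (Eq.trans ?_ (cancel₀_el f N Y x b _).symm))
  exact (congrArg (rtel f · y) (N.actElt_mul x b (f.hom a))).trans (rtel_actElt f _ a y)

/-- The map `x ⊗ (b ⊗ y) ↦ x b ⊗ y` on `N ⊗̂ (B ⊗̂_A Y)`. -/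
def cancel₁ : N.X ⊗ (Extend f Y).X ⟶ tensorOver (RMod.comap f N) Y :=
  quotDesc₂ (cancel₀ f N Y) (cancel₀_zero f N Y)

theorem cancel₁_el (x : N.X) (b : B) (y : Y.X) :
    (cancel₁ f N Y).hom (el x (etel f b y)) = rtel f (N.actElt x b) y :=
  (quotDesc₂_proj _ _ _ _).trans (cancel₀_el f N Y x b y)

/-- The map `x ⊗ (b ⊗ y) ↦ x b ⊗ y` from `N ⊗̂_B (B ⊗̂_A Y)` to `N_f ⊗̂_A Y`. -/
def cancel : tensorOver N (Extend f Y) →L[ℂ] tensorOver (RMod.comap f N) Y :=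
  (quotDesc (cancel₁ f N Y)
    (eq_zero_of_balanced (X := N) (Y := Extend f Y) _ fun x b w =>
      etel_ext (g := (elL _ (N.actElt x b) ≫ cancel₁ f N Y).hom)
        (h := (elL _ x ≫ cancel₁ f N Y).hom.comp (actL (Extend f Y) b))
        (fun b' y => by
          rw [ContinuousLinearMap.comp_apply, actL_apply, act_etel, comp_apply, comp_apply,
            elL_apply, elL_apply, cancel₁_el, cancel₁_el, N.actElt_mul]) w)).hom

theorem cancel_tel {N : RMod B} {Y : Mod LCS.{u} A} (x : N.X) (b : B) (y : Y.X) :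
    cancel f N Y (tel x (etel f b y)) = rtel f (N.actElt x b) y :=
  (quotDesc_proj _ _ _).trans (cancel₁_el f N Y x b y)

/-- The map `x ⊗ y ↦ x ⊗ (1 ⊗ y)`, inverse to `cancel`. -/
def uncancel : tensorOver (RMod.comap f N) Y →L[ℂ] tensorOver N (Extend f Y) :=
  rtelDesc f (N.X ◁ ofHom (etelL f Y (oneElt B)) ≫ toTensorOver N (Extend f Y)) fun x a y => by
    rw [comp_apply, comp_apply, whiskerLeft_el, whiskerLeft_el, ofHom_hom, etelL_apply,
      etelL_apply, ← etel_mul, one_mulElt]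
    refine (tel_actElt x (f.hom a) _).trans ?_
    rw [act_etel, mulElt_one]
    rfl

theorem uncancel_rtel {N : RMod B} {Y : Mod LCS.{u} A} (x : N.X) (y : Y.X) :
    uncancel f N Y (rtel f x y) = tel x (etel f (oneElt B) y) := by
  refine (rtelDesc_rtel f _ _ x y).trans ?_
  rw [comp_apply, whiskerLeft_el]
  rfl

theorem uncancel_cancel (w : tensorOver N (Extend f Y)) :
    uncancel f N Y (cancel f N Y w) = w :=
  tensorOver_extend_ext (g := (uncancel f N Y).comp (cancel f N Y))
    (h := ContinuousLinearMap.id ℂ _) (fun x b y => by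
      rw [ContinuousLinearMap.comp_apply, cancel_tel, uncancel_rtel, tel_actElt, act_etel,
        mulElt_one, ContinuousLinearMap.id_apply]) w

theorem cancel_uncancel (w : tensorOver (RMod.comap f N) Y) :
    cancel f N Y (uncancel f N Y w) = w :=
  rtel_ext (g := (cancel f N Y).comp (uncancel f N Y))
    (h := ContinuousLinearMap.id ℂ _) (fun x y => by
      rw [ContinuousLinearMap.comp_apply, uncancel_rtel, cancel_tel, N.actElt_one,
        ContinuousLinearMap.id_apply]) w

end Cancel

/-- The map `cancel` in degree `n` of the induced complex. -/
def cancelAt (N : RMod B) (n : ℕ) :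
    tensorOver N ((P.induce (BiMod.ofHom f)).P n) ≃L[ℂ] tensorOver (RMod.comap f N) (P.P n) :=
  ContinuousLinearEquiv.equivOfInverse (cancel f N (P.P n)) (uncancel f N (P.P n))
    (uncancel_cancel f N (P.P n)) (cancel_uncancel f N (P.P n))

/-- The cancellation is an isomorphism of chain complexes. -/
theorem cancelAt_tensorD (N : RMod B) (n : ℕ)
    (w : tensorOver N ((P.induce (BiMod.ofHom f)).P (n + 1))) :
    cancelAt f P N n (tensorD N (P.induce (BiMod.ofHom f)) n w) =
      tensorD (RMod.comap f N) P n (cancelAt f P N (n + 1) w) := by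
  refine tensorOver_extend_ext
    (g := (cancelAt f P N n).toContinuousLinearMap.comp (tensorD N (P.induce (BiMod.ofHom f)) n))
    (h := (tensorD (RMod.comap f N) P n).comp (cancelAt f P N (n + 1)).toContinuousLinearMap)
    (fun x b y => ?_) w
  have h₁ : tensorD N (P.induce (BiMod.ofHom f)) n (tel x (etel f b y)) =
      tel (Y := Extend f (P.P n)) x (etel f b ((P.d n).hom.hom y)) :=
    (AugComplex.tensorD_tel N (P.induce (BiMod.ofHom f)) n x _).trans
      (congrArg (fun v : (Extend f (P.P n)).X => tel (Y := Extend f (P.P n)) x v)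
        (tensorMap_etel f (P.d n) b y))
  refine (congrArg (cancelAt f P N n) h₁).trans ((cancel_tel f x b _).trans ?_)
  refine Eq.trans ?_ (congrArg (tensorD (RMod.comap f N) P n) (cancel_tel f x b y)).symm
  exact (AugComplex.tensorD_tel (RMod.comap f N) P n (N.actElt x b) y).symm

/-- `Tor` of the induced complex is `Tor` of the restricted right module. -/
def torInduceEquiv (N : RMod B) (n : ℕ) :
    Tor N (P.induce (BiMod.ofHom f)) n ≃L[ℂ] Tor (RMod.comap f N) P n :=
  have hD (n : ℕ) (v : tensorOver (RMod.comap f N) (P.P (n + 1))) :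
      tensorD N (P.induce (BiMod.ofHom f)) n ((cancelAt f P N (n + 1)).symm v) =
        (cancelAt f P N n).symm (tensorD (RMod.comap f N) P n v) := by
    rw [ContinuousLinearEquiv.eq_symm_apply, cancelAt_tensorD,
      ContinuousLinearEquiv.apply_symm_apply]
  subquotientEquivL (cancelAt f P N n).toContinuousLinearMap
    (cancelAt f P N n).symm.toContinuousLinearMap
    (fun w hw => by
      cases n with
      | zero => exact Submodule.mem_top
      | succ n =>
        have h : tensorD N (P.induce (BiMod.ofHom f)) n w = 0 := hw
        have e := cancelAt_tensorD f P N n w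
        rw [h, map_zero] at e
        exact e.symm)
    (fun w hw => by
      obtain ⟨v, rfl⟩ := hw
      exact ⟨_, (cancelAt_tensorD f P N n v).symm⟩)
    (fun w hw => by
      cases n with
      | zero => exact Submodule.mem_top
      | succ n =>
        have h : tensorD (RMod.comap f N) P n w = 0 := hw
        have e := hD n w
        rw [h, map_zero] at e
        exact e)
    (fun w hw => by
      obtain ⟨v, rfl⟩ := hw
      exact ⟨_, hD n v⟩)
    (fun w _ => by
      have e : (cancelAt f P N n).symm (cancelAt f P N n w) - w = 0 := by
        rw [ContinuousLinearEquiv.symm_apply_apply, sub_self]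
      exact e ▸ Submodule.zero_mem _)
    (fun w _ => by
      have e : cancelAt f P N n ((cancelAt f P N n).symm w) - w = 0 := by
        rw [ContinuousLinearEquiv.apply_symm_apply, sub_self]
      exact e ▸ Submodule.zero_mem _)

theorem torInduceEquiv_natural {N N' : RMod B} (g : RMod.Hom N N') (n : ℕ)
    (x : Tor N (P.induce (BiMod.ofHom f)) n) :
    torInduceEquiv f P N' n (TorMap (P.induce (BiMod.ofHom f)) g n x) =
      TorMap P (g.comap f) n (torInduceEquiv f P N n x) := by
  obtain ⟨x, rfl⟩ := Submodule.Quotient.mk_surjective _ x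
  refine congrArg Submodule.Quotient.mk (Subtype.ext ?_)
  refine tensorOver_extend_ext
    (g := (cancelAt f P N' n).toContinuousLinearMap.comp
      (tensorF (P.induce (BiMod.ofHom f)) g n))
    (h := (tensorF P (g.comap f) n).comp (cancelAt f P N n).toContinuousLinearMap)
    (fun r b y => ?_) x.1
  refine (congrArg (cancelAt f P N' n)
    (tensorOverMap_tel g (𝟙 ((P.induce (BiMod.ofHom f)).P n)) r _)).trans ?_
  refine (cancel_tel f (g.hom.hom r) b y).trans ?_
  refine Eq.trans ?_ (congrArg (tensorF P (g.comap f) n) (cancel_tel f r b y)).symm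
  refine Eq.trans ?_ (tensorOverMap_tel (g.comap f) (𝟙 (P.P n)) (N.actElt r b) y).symm
  exact congrArg (fun z : N'.X => rtel f z y) (g.map_actElt r b).symm

end Extension

/-! ### Admissibility of induced complexes -/

section Admissible

/-- The morphism `v ⊗ a ↦ r(v) f(a)` of right `A`-modules `V ⊗̂ A → B`. -/
def freeRightDesc {A B V : LCS.{u}} [MonObj B] (f : A ⟶ B) (r : V ⟶ B) : V ⊗ A ⟶ B :=
  (r ⊗ₘ f) ≫ μ[B]

theorem freeRightDesc_el {A B V : LCS.{u}} [MonObj B] (f : A ⟶ B) (r : V ⟶ B) (v : V) (a : A) :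
    (freeRightDesc f r).hom (el v a) = mulElt B (r.hom v) (f.hom a) := by
  rw [freeRightDesc, comp_apply, tensorHom_el]
  rfl

variable {A B V : LCS.{u}} [MonObj A] [MonObj B] (f : A ⟶ B) [IsMonHom f]

/-- `(v ⊗ a) ⊗ a' ↦ v ⊗ a a'`, the right action on the free right module `V ⊗̂ A`. -/
def freeRightAct (A V : LCS.{u}) [MonObj A] : (V ⊗ A) ⊗ A ⟶ V ⊗ A := (α_ V A A).hom ≫ V ◁ μ[A]

theorem freeRightAct_el (v : V) (a a' : A) :
    (freeRightAct A V).hom (el (el v a) a') = el v (mulElt A a a') := by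
  rw [freeRightAct, comp_apply, associator_hom_el, whiskerLeft_el]
  rfl

/-- The map `(v ⊗ a) ⊗ y ↦ v ⊗ a y`. -/
def contract (V : LCS.{u}) (Y : Mod LCS.{u} A) : (V ⊗ A) ⊗ Y.X ⟶ V ⊗ Y.X :=
  (α_ V A Y.X).hom ≫ V ◁ (γ[A, Y.X] : A ⊗ Y.X ⟶ Y.X)

theorem contract_el (Y : Mod LCS.{u} A) (v : V) (a : A) (y : Y.X) :
    (contract V Y).hom (el (el v a) y) = el v (Mod.act Y a y) := by
  rw [contract, comp_apply, associator_hom_el, whiskerLeft_el]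
  rfl

/-- `x ↦ x ⊗ y`. -/
def elR (X : LCS.{u}) {Y : LCS.{u}} (y : Y) : X ⟶ X ⊗ Y := ofHom (tmulR X y)

theorem elR_apply {X Y : LCS.{u}} (x : X) (y : Y) : (elR X y).hom x = el x y := rfl

theorem el_extL {X Y Z : LCS.{u}} (f g : X ⊗ Y ⟶ Z) (h : ∀ x y, f.hom (el x y) = g.hom (el x y))
    (w : (X ⊗ Y : LCS.{u})) : f.hom w = g.hom w :=
  congrArg (fun k => LCS.Hom.hom k w) (el_ext h)

theorem contract_freeRightAct (Y : Mod LCS.{u} A) (w : (V ⊗ A : LCS.{u})) (a : A) (y : Y.X) :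
    (contract V Y).hom (el ((freeRightAct A V).hom (el w a)) y) =
      (contract V Y).hom (el w (Mod.act Y a y)) :=
  el_extL (elR _ a ≫ freeRightAct A V ≫ elR _ y ≫ contract V Y)
    (elR _ (Mod.act Y a y) ≫ contract V Y) (fun v a' => by
      simp only [comp_apply, elR_apply, freeRightAct_el, contract_el, smul_mul]) w

variable (s : B ⟶ V ⊗ A) (r : V ⟶ B)
  (hs : ∀ b a, s.hom (mulElt B b (f.hom a)) = (freeRightAct A V).hom (el (s.hom b) a))

/-- The map `b ⊗ y ↦ s(b) y` from `B ⊗̂_A Y` to `V ⊗̂ Y`, for a morphism `s : B → V ⊗̂ A` of right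
`A`-modules. -/
def toFree (Y : Mod LCS.{u} A) : (Extend f Y).X ⟶ V ⊗ Y.X :=
  etelDesc f (s ▷ Y.X ≫ contract V Y) fun b a y => by
    rw [comp_apply, comp_apply, whiskerRight_el, whiskerRight_el, hs, contract_freeRightAct]

theorem toFree_etel (Y : Mod LCS.{u} A) (b : B) (y : Y.X) :
    (toFree f s hs Y).hom (etel f b y) = (contract V Y).hom (el (s.hom b) y) := by
  rw [toFree, etelDesc_etel, comp_apply, whiskerRight_el]

/-- The canonical map `B ⊗̂ Y → B ⊗̂_A Y`. -/
def toExtend (Y : Mod LCS.{u} A) : B ⊗ Y.X ⟶ (Extend f Y).X :=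
  toTensorOver (BiMod.ofHom f).toRMod Y

theorem toExtend_el (Y : Mod LCS.{u} A) (b : B) (y : Y.X) :
    (toExtend f Y).hom (el b y) = etel f b y := rfl

/-- The map `v ⊗ y ↦ r(v) ⊗ y` from `V ⊗̂ Y` to `B ⊗̂_A Y`. -/
def ofFree (Y : Mod LCS.{u} A) : V ⊗ Y.X ⟶ (Extend f Y).X := r ▷ Y.X ≫ toExtend f Y

theorem ofFree_el (Y : Mod LCS.{u} A) (v : V) (y : Y.X) :
    (ofFree f r Y).hom (el v y) = etel f (r.hom v) y := by
  rw [ofFree, comp_apply, whiskerRight_el, toExtend_el]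

theorem ofFree_contract (Y : Mod LCS.{u} A) (w : (V ⊗ A : LCS.{u})) (y : Y.X) :
    (ofFree f r Y).hom ((contract V Y).hom (el w y)) = etel f ((freeRightDesc f r).hom w) y :=
  el_extL (elR _ y ≫ contract V Y ≫ ofFree f r Y) (freeRightDesc f r ≫ elR _ y ≫ toExtend f Y)
    (fun v a => by
      simp only [comp_apply, elR_apply, contract_el, ofFree_el, freeRightDesc_el, toExtend_el,
        etel_mul]) w

/-- `B ⊗̂_A Y` is a direct summand of `V ⊗̂ Y`. -/
theorem ofFree_toFree (hrs : ∀ b, (freeRightDesc f r).hom (s.hom b) = b) (Y : Mod LCS.{u} A)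
    (w : (Extend f Y).X) :
    (ofFree f r Y).hom ((toFree f s hs Y).hom w) = w :=
  etel_ext (g := (toFree f s hs Y ≫ ofFree f r Y).hom) (h := ContinuousLinearMap.id ℂ _)
    (fun b y => by
      rw [comp_apply, toFree_etel, ofFree_contract, hrs, ContinuousLinearMap.id_apply]) w

theorem toFree_natural {Y Y' : Mod LCS.{u} A} (g : Y ⟶ Y') (w : (Extend f Y).X) :
    (toFree f s hs Y').hom (((BiMod.ofHom f).tensorMap g).hom.hom w) =
      (V ◁ g.hom).hom ((toFree f s hs Y).hom w) := by
  have key (w : (V ⊗ A : LCS.{u})) (y : Y.X) : (contract V Y').hom (el w (g.hom.hom y)) =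
      (V ◁ g.hom).hom ((contract V Y).hom (el w y)) :=
    el_extL (elR _ (g.hom.hom y) ≫ contract V Y') (elR _ y ≫ contract V Y ≫ V ◁ g.hom)
      (fun v a => by
        simp only [comp_apply, elR_apply, contract_el, whiskerLeft_el, hom_act]) w
  exact etel_ext (g := (((BiMod.ofHom f).tensorMap g).hom ≫ toFree f s hs Y').hom)
    (h := (toFree f s hs Y ≫ V ◁ g.hom).hom) (fun b y => by
      rw [comp_apply, comp_apply, tensorMap_etel, toFree_etel, toFree_etel, key]) w

theorem ofFree_natural {Y Y' : Mod LCS.{u} A} (g : Y ⟶ Y') (w : (V ⊗ Y.X : LCS.{u})) :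
    ((BiMod.ofHom f).tensorMap g).hom.hom ((ofFree f r Y).hom w) =
      (ofFree f r Y').hom ((V ◁ g.hom).hom w) :=
  el_extL (ofFree f r Y ≫ ((BiMod.ofHom f).tensorMap g).hom) (V ◁ g.hom ≫ ofFree f r Y')
    (fun v y => by
      rw [comp_apply, comp_apply, ofFree_el, tensorMap_etel, whiskerLeft_el, ofFree_el]) w

/-- If `B` is a direct summand of a free right `A`-module `V ⊗̂ A`, then `B ⊗̂_A (-)` is a natural
direct summand of `V ⊗̂ (-)`, and so it preserves contracting homotopies. -/
theorem AugComplex.IsAdmissible.induce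
    (hs : ∀ b a, s.hom (mulElt B b (f.hom a)) = (freeRightAct A V).hom (el (s.hom b) a))
    (hrs : ∀ b, (freeRightDesc f r).hom (s.hom b) = b) {X : Mod LCS.{u} A} {C : AugComplex X}
    (hC : C.IsAdmissible) : (C.induce (BiMod.ofHom f)).IsAdmissible := by
  obtain ⟨s₀, t, h, h₀, ht⟩ := hC
  let S₀ : (Extend f X).X ⟶ (Extend f (C.P 0)).X :=
    toFree f s hs X ≫ V ◁ ofHom s₀ ≫ ofFree f r (C.P 0)
  let T (n : ℕ) : (Extend f (C.P n)).X ⟶ (Extend f (C.P (n + 1))).X :=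
    toFree f s hs (C.P n) ≫ V ◁ ofHom (t n) ≫ ofFree f r (C.P (n + 1))
  -- The homotopy relation for `k`, `k'` passes to `V ⊗̂ (-)`, and from there to its summand
  -- `B ⊗̂_A (-)` by naturality of the inclusion and of the projection.
  have key (Y Y' Y'' : Mod LCS.{u} A) (d : Y ⟶ Y') (d' : Y'' ⟶ Y) (k : Y'.X ⟶ Y.X)
      (k' : Y.X ⟶ Y''.X) (h : ∀ y, k.hom (d.hom.hom y) + d'.hom.hom (k'.hom y) = y)
      (w : (Extend f Y).X) :
      (toFree f s hs Y' ≫ V ◁ k ≫ ofFree f r Y).hom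
          (((BiMod.ofHom f).tensorMap d).hom.hom w) +
        ((BiMod.ofHom f).tensorMap d').hom.hom
          ((toFree f s hs Y ≫ V ◁ k' ≫ ofFree f r Y'').hom w) = w := by
    have e (v : (V ⊗ Y.X : LCS.{u})) :
        (V ◁ k).hom ((V ◁ d.hom).hom v) + (V ◁ d'.hom).hom ((V ◁ k').hom v) = v :=
      el_extL (ofHom ((V ◁ k).hom.comp (V ◁ d.hom).hom + (V ◁ d'.hom).hom.comp (V ◁ k').hom))
        (𝟙 _) (fun x y => by
          have e₁ : (V ◁ k).hom ((V ◁ d.hom).hom (el x y)) +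
              (V ◁ d'.hom).hom ((V ◁ k').hom (el x y)) = el x y := by
            rw [whiskerLeft_el, whiskerLeft_el, whiskerLeft_el, whiskerLeft_el, ← el_add, h]
          exact e₁) v
    rw [comp_apply, comp_apply, comp_apply, comp_apply, toFree_natural, ofFree_natural, ← map_add,
      e, ofFree_toFree f s r hs hrs]
  refine ⟨S₀.hom, fun n => (T n).hom, fun w => ?_,
    key _ _ _ C.aug (C.d 0) (ofHom s₀) (ofHom (t 0)) h₀, fun n =>
      key _ _ _ (C.d n) (C.d (n + 1)) (ofHom (t n)) (ofHom (t (n + 1))) (ht n)⟩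
  have e : ((BiMod.ofHom f).tensorMap C.aug).hom.hom (S₀.hom w) = w := by
    have e' (v : (V ⊗ X.X : LCS.{u})) : (V ◁ C.aug.hom).hom ((V ◁ ofHom s₀).hom v) = v :=
      el_extL (V ◁ ofHom s₀ ≫ V ◁ C.aug.hom) (𝟙 _) (fun x y => by
        rw [comp_apply, whiskerLeft_el, whiskerLeft_el, ofHom_hom, h, id_apply]) v
    rw [comp_apply, comp_apply, ofFree_natural, e', ofFree_toFree f s r hs hrs]
  exact e

theorem AugComplex.IsAdmissible.compAug {X X' : Mod LCS.{u} A} {C : AugComplex X}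
    (hC : C.IsAdmissible) (φ : X ≅ X') : (C.compAug φ.hom).IsAdmissible := by
  obtain ⟨s₀, s, h, h₀, hs⟩ := hC
  have h₁ (x) : φ.hom.hom.hom (φ.inv.hom.hom x) = x :=
    congrArg (fun k : X' ⟶ X' => k.hom.hom x) φ.inv_hom_id
  have h₂ (x) : φ.inv.hom.hom (φ.hom.hom.hom x) = x :=
    congrArg (fun k : X ⟶ X => k.hom.hom x) φ.hom_inv_id
  refine ⟨s₀.comp φ.inv.hom.hom, s, fun x => ?_, fun x => ?_, hs⟩
  · exact (congrArg φ.hom.hom.hom (h _)).trans (h₁ x)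
  · exact (congrArg (fun y => s₀ y + (C.d 0).hom.hom (s 0 x)) (h₂ _)).trans (h₀ x)

/-- A bijective morphism of modules with continuous inverse is an isomorphism. -/
def modIso {X Y : Mod LCS.{u} A} (φ : X ⟶ Y) (ψ : Y.X ⟶ X.X)
    (h₁ : ∀ x, ψ.hom (φ.hom.hom x) = x) (h₂ : ∀ y, φ.hom.hom (ψ.hom y) = y) : X ≅ Y where
  hom := φ
  inv := homOfAct ψ fun a y => by
    conv_lhs => rw [← h₂ y, ← hom_act, h₁]
  hom_inv_id := Mod.Hom.ext (hom_ext h₁)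
  inv_hom_id := Mod.Hom.ext (hom_ext h₂)

end Admissible

/-! ### The Hopf algebra identities -/

section HopfIdentities

variable (H : LCS.{u}) [HopfObj H]

/-- The map `x ⊗ y ⊗ z ↦ x ⊗ S(y) z`. -/
def antipodeMul : (H ⊗ H) ⊗ H ⟶ H ⊗ H := (α_ H H H).hom ≫ H ◁ (𝒮[H] ▷ H ≫ μ[H])

/-- The map `x ⊗ y ⊗ z ↦ x ⊗ y S(z)`. -/
def mulAntipode : (H ⊗ H) ⊗ H ⟶ H ⊗ H := (α_ H H H).hom ≫ H ◁ (H ◁ 𝒮[H] ≫ μ[H])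

theorem antipodeMul_el (x y z : H) :
    (antipodeMul H).hom (el (el x y) z) = el x (mulElt H (𝒮[H].hom y) z) := by
  rw [antipodeMul, comp_apply, associator_hom_el, whiskerLeft_el, comp_apply, whiskerRight_el]
  rfl

theorem mulAntipode_el (x y z : H) :
    (mulAntipode H).hom (el (el x y) z) = el x (mulElt H y (𝒮[H].hom z)) := by
  rw [mulAntipode, comp_apply, associator_hom_el, whiskerLeft_el, comp_apply, whiskerLeft_el]
  rfl

/-- The identity `h₁ ⊗ S(h₂) h₃ = h ⊗ 1`. -/
theorem antipodeMul_comul (h : H) :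
    (antipodeMul H).hom ((Δ[H] ▷ H).hom (Δ[H].hom h)) = el h (oneElt H) := by
  have e : Δ[H] ≫ Δ[H] ▷ H ≫ antipodeMul H = (ρ_ H).inv ≫ H ◁ η[H] := by
    rw [antipodeMul, ← ComonObj.comul_assoc_assoc, ← MonoidalCategory.whiskerLeft_comp,
      HopfObj.antipode_left, MonoidalCategory.whiskerLeft_comp, ComonObj.comul_counit_assoc]
  have e' := congrArg (fun k => LCS.Hom.hom k h) e
  exact e'.trans (whiskerLeft_el η[H] h (scal 1))

/-- The identity `h₁ ⊗ h₂ S(h₃) = h ⊗ 1`. -/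
theorem mulAntipode_comul (h : H) :
    (mulAntipode H).hom ((Δ[H] ▷ H).hom (Δ[H].hom h)) = el h (oneElt H) := by
  have e : Δ[H] ≫ Δ[H] ▷ H ≫ mulAntipode H = (ρ_ H).inv ≫ H ◁ η[H] := by
    rw [mulAntipode, ← ComonObj.comul_assoc_assoc, ← MonoidalCategory.whiskerLeft_comp,
      HopfObj.antipode_right, MonoidalCategory.whiskerLeft_comp, ComonObj.comul_counit_assoc]
  have e' := congrArg (fun k => LCS.Hom.hom k h) e
  exact e'.trans (whiskerLeft_el η[H] h (scal 1))

variable {H}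

/-- `x ↦ a x`. -/
def mulLeft (a : H) : H ⟶ H := elL H a ≫ μ[H]

/-- `x ↦ x b`. -/
def mulRight (b : H) : H ⟶ H := elR H b ≫ μ[H]

theorem mulLeft_apply (a x : H) : (mulLeft a).hom x = mulElt H a x := rfl

theorem mulRight_apply (b x : H) : (mulRight b).hom x = mulElt H x b := rfl

variable (H) in
/-- The identity map from `H ⊗̂ H` to the enveloping algebra. -/
def toEnv : H ⊗ H ⟶ Env H := 𝟙 (H ⊗ H)

theorem toEnv_el (a b : H) : (toEnv H).hom (el a b) = envElt H a b := rfl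

variable (H) in
/-- The map `1 ⊗ S` from `H ⊗̂ H` to the enveloping algebra. -/
def oneAntipode : H ⊗ H ⟶ Env H := H ◁ 𝒮[H] ≫ toEnv H

theorem oneAntipode_el (x y : H) : (oneAntipode H).hom (el x y) = envElt H x (𝒮[H].hom y) := by
  rw [oneAntipode, comp_apply, whiskerLeft_el, toEnv_el]

theorem E_apply (h : H) : (E H).hom h = (oneAntipode H).hom (Δ[H].hom h) := rfl

theorem elL_mul_apply {B : LCS.{u}} [MonObj B] (b b' : B) :
    (elL B b ≫ μ[B]).hom b' = mulElt B b b' := rfl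

/-- The formula `(c ⊗ y b) E(x) = c x₁ ⊗ S(x₂) y b`. -/
theorem envElt_mul_E (c x y b : H) :
    mulElt (Env H) (envElt H c (mulElt H y b)) ((E H).hom x) =
      (toEnv H).hom ((mulLeft c ⊗ₘ mulRight b).hom
        ((antipodeMul H).hom (el (Δ[H].hom x) y))) := by
  rw [E_apply]
  refine el_extL (oneAntipode H ≫ elL (Env H) (envElt H c (mulElt H y b)) ≫ μ[Env H])
    (elR _ y ≫ antipodeMul H ≫ (mulLeft c ⊗ₘ mulRight b) ≫ toEnv H) (fun p q => ?_) _
  rw [comp_apply, oneAntipode_el, elL_mul_apply, env_mul, comp_apply, comp_apply, comp_apply,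
    elR_apply, antipodeMul_el, tensorHom_el, toEnv_el, mulLeft_apply, mulRight_apply, mulElt_assoc]

/-- The map `x ⊗ y ↦ (c ⊗ y b) E(x)`. -/
def mulE (c b : H) : H ⊗ H ⟶ Env H :=
  (β_ H H).hom ≫ ((mulRight b ≫ elL H c ≫ toEnv H) ⊗ₘ E H) ≫ μ[Env H]

theorem mulE_el (c b x y : H) :
    (mulE c b).hom (el x y) = mulElt (Env H) (envElt H c (mulElt H y b)) ((E H).hom x) := by
  rw [mulE, comp_apply, comp_apply, braiding_hom_el, tensorHom_el]
  rfl

/-- The identity `(c ⊗ h₂ b) E(h₁) = c h ⊗ b`. -/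
theorem mulE_comul (c b h : H) : (mulE c b).hom (Δ[H].hom h) = envElt H (mulElt H c h) b := by
  have e (w : (H ⊗ H : LCS.{u})) := el_extL (mulE c b)
    (Δ[H] ▷ H ≫ antipodeMul H ≫ (mulLeft c ⊗ₘ mulRight b) ≫ toEnv H) (fun x y => by
      rw [mulE_el, envElt_mul_E, comp_apply, comp_apply, comp_apply, whiskerRight_el]) w
  rw [e, comp_apply, comp_apply, comp_apply, antipodeMul_comul, tensorHom_el, toEnv_el,
    mulLeft_apply, mulRight_apply, one_mulElt]

/-! ### The enveloping algebra as a right module -/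

variable (H) in
/-- The map `x ⊗ y ⊗ b ↦ y b ⊗ x`. -/
def rotate : (H ⊗ H) ⊗ H ⟶ H ⊗ H := (α_ H H H).hom ≫ H ◁ μ[H] ≫ (β_ H H).hom

theorem rotate_el (x y b : H) : (rotate H).hom (el (el x y) b) = el (mulElt H y b) x := by
  rw [rotate, comp_apply, comp_apply, associator_hom_el, whiskerLeft_el, braiding_hom_el]
  rfl

variable (H) in
/-- The map `a ⊗ b ↦ a₂ b ⊗ a₁` from the enveloping algebra to `H ⊗̂ H`. -/
def envSection : Env H ⟶ H ⊗ H := Δ[H] ▷ H ≫ rotate H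

theorem envSection_envElt (a b : H) :
    (envSection H).hom (envElt H a b) = (rotate H).hom (el (Δ[H].hom a) b) := by
  have e := comp_apply (Δ[H] ▷ H) (rotate H) (el a b)
  rw [whiskerRight_el] at e
  exact e

variable (H) in
/-- The map `v ↦ 1 ⊗ v`. -/
def envGen : H ⟶ Env H := elL H (oneElt H) ≫ toEnv H

theorem envGen_apply (v : H) : (envGen H).hom v = envElt H (oneElt H) v := rfl

/-- The identity `(1 ⊗ a₂ b) E(a₁) = a ⊗ b`: `envSection` is split by `v ⊗ h ↦ (1 ⊗ v) E(h)`. -/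
theorem freeRightDesc_envSection (w : Env H) :
    (freeRightDesc (E H) (envGen H)).hom ((envSection H).hom w) = w := by
  refine env_ext_apply (f := (envSection H ≫ freeRightDesc (E H) (envGen H)).hom)
    (g := ContinuousLinearMap.id ℂ _) (fun a b => ?_) w
  have e (d : (H ⊗ H : LCS.{u})) := el_extL (elR _ b ≫ rotate H ≫ freeRightDesc (E H) (envGen H))
    (mulE (oneElt H) b) (fun x y => by
      rw [comp_apply, comp_apply, elR_apply, rotate_el, freeRightDesc_el, envGen_apply, mulE_el]) d
  have e' := e (Δ[H].hom a)
  rw [mulE_comul, one_mulElt, comp_apply, comp_apply, elR_apply] at e'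
  rw [comp_apply, envSection_envElt, e', ContinuousLinearMap.id_apply]

theorem tensor_mulElt (p q x y : H) :
    mulElt (H ⊗ H) (el p q) (el x y) = el (mulElt H p x) (mulElt H q y) := by
  simp only [mulElt, MonObj.tensorObj.mul_def, comp_apply, tensorμ_el, tensorHom_el]

theorem comul_mulElt (a x : H) :
    Δ[H].hom (mulElt H a x) = mulElt (H ⊗ H) (Δ[H].hom a) (Δ[H].hom x) := by
  have e := congrArg (fun k => LCS.Hom.hom k (el a x)) (IsMonHom.mul_hom (f := Δ[H]))
  rw [comp_apply, comp_apply, tensorHom_el] at e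
  exact e

/-- The map `d ⊗ (x ⊗ y) ↦ d₂ x₂ S(y) b ⊗ d₁ x₁`. -/
def rotateMul (b : H) : (H ⊗ H) ⊗ (H ⊗ H) ⟶ H ⊗ H :=
  (α_ (H ⊗ H) H H).inv ≫ (((H ⊗ H) ◁ Δ[H] ≫ μ[H ⊗ H]) ⊗ₘ (𝒮[H] ≫ mulRight b)) ≫ rotate H

theorem rotateMul_el (b : H) (d : (H ⊗ H : LCS.{u})) (x y : H) :
    (rotateMul b).hom (el d (el x y)) =
      (rotate H).hom (el (mulElt (H ⊗ H) d (Δ[H].hom x)) (mulElt H (𝒮[H].hom y) b)) := by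
  rw [rotateMul, comp_apply, comp_apply, associator_inv_el, tensorHom_el, comp_apply,
    whiskerLeft_el, comp_apply, mulRight_apply]
  rfl

/-- The identity `d₂ h₂ S(h₃) b ⊗ d₁ h₁ = d₂ b ⊗ d₁ h`. -/
theorem rotateMul_comul (b : H) (d : (H ⊗ H : LCS.{u})) (h : H) :
    (rotateMul b).hom (el d (Δ[H].hom h)) =
      (freeRightAct H H).hom (el ((rotate H).hom (el d b)) h) := by
  refine el_extL (elR _ (Δ[H].hom h) ≫ rotateMul b)
    (elR _ b ≫ rotate H ≫ elR _ h ≫ freeRightAct H H) (fun p q => ?_) d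
  have e₁ (w : (H ⊗ H : LCS.{u})) (y : H) := el_extL
    (elL (H ⊗ H) (el p q) ≫ μ[H ⊗ H] ≫ elR _ (mulElt H (𝒮[H].hom y) b) ≫ rotate H)
    (elR _ y ≫ mulAntipode H ≫ (mulLeft p ⊗ₘ (mulRight b ≫ mulLeft q)) ≫ (β_ H H).hom)
    (fun x₁ x₂ => by
      have e : μ[H ⊗ H].hom (el (el p q) (el x₁ x₂)) = _ := tensor_mulElt p q x₁ x₂
      simp only [comp_apply, elL_apply, elR_apply, e, rotate_el, mulAntipode_el, tensorHom_el,
        braiding_hom_el, mulLeft_apply, mulRight_apply, mulElt_assoc]) w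
  have e₂ (w : (H ⊗ H : LCS.{u})) := el_extL
    (elL (H ⊗ H) (el p q) ≫ rotateMul b)
    (Δ[H] ▷ H ≫ mulAntipode H ≫ (mulLeft p ⊗ₘ (mulRight b ≫ mulLeft q)) ≫ (β_ H H).hom)
    (fun x y => by
      rw [comp_apply, elL_apply, rotateMul_el]
      refine (e₁ (Δ[H].hom x) y).trans ?_
      simp only [comp_apply, elR_apply, whiskerRight_el]) w
  have e₃ := e₂ (Δ[H].hom h)
  rw [comp_apply, elL_apply] at e₃
  rw [comp_apply, elR_apply, e₃]
  simp only [comp_apply, elR_apply, mulAntipode_comul, tensorHom_el, braiding_hom_el, rotate_el,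
    freeRightAct_el, mulLeft_apply, mulRight_apply, one_mulElt]

/-- `a ⊗ b ↦ a₂ b ⊗ a₁` is a morphism of right `H`-modules from `H^e_E` to the free module. -/
theorem envSection_mul_E (w : Env H) (h : H) :
    (envSection H).hom (mulElt (Env H) w ((E H).hom h)) =
      (freeRightAct H H).hom (el ((envSection H).hom w) h) := by
  refine env_ext_apply (f := (elR (Env H) ((E H).hom h) ≫ μ[Env H] ≫ envSection H).hom)
    (g := (envSection H ≫ elR _ h ≫ freeRightAct H H).hom) (fun a b => ?_) w
  have e (v : (H ⊗ H : LCS.{u})) := el_extL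
    (oneAntipode H ≫ (elL (Env H) (envElt H a b) ≫ μ[Env H]) ≫ envSection H)
    (elL (H ⊗ H) (Δ[H].hom a) ≫ rotateMul b) (fun x y => by
      rw [comp_apply, comp_apply, oneAntipode_el, elL_mul_apply, env_mul, envSection_envElt,
        comp_apply, elL_apply, rotateMul_el, comul_mulElt]) v
  have e' := e (Δ[H].hom h)
  rw [comp_apply, comp_apply, ← E_apply, elL_mul_apply, comp_apply, elL_apply,
    rotateMul_comul] at e'
  rw [comp_apply, comp_apply, comp_apply, comp_apply, elR_apply, elR_apply, envSection_envElt]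
  exact e'

end HopfIdentities

/-! ### The bimodule `H` as an induced module -/

section Induced

variable (H : LCS.{u}) [HopfObj H]

/-- The identity `h₁ S(h₂) = ε(h)`, as the action of `E(h)` on the bimodule `H`. -/
theorem regAct_E (h : H) :
    (regAct H).hom (el ((E H).hom h) (oneElt H)) = val (ε[H].hom h) • oneElt H := by
  rw [E_apply]
  have e (w : (H ⊗ H : LCS.{u})) := el_extL (oneAntipode H ≫ elR (Env H) (oneElt H) ≫ regAct H)
    (H ◁ 𝒮[H] ≫ μ[H]) (fun x y => by
      rw [comp_apply, oneAntipode_el, comp_apply, elR_apply, regAct_el, one_mulElt, comp_apply,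
        whiskerLeft_el]
      rfl) w
  have e' := congrArg (fun k => LCS.Hom.hom k h) (HopfObj.antipode_right H)
  refine (e (Δ[H].hom h)).trans (e'.trans ?_)
  rw [comp_apply, one_hom_apply]

/-- `c ↦ c 1` intertwines the trivial action and the action through `E` on the bimodule `H`. -/
theorem one_hom_triv_act (h : H) (c : (𝟙_ LCS.{u})) :
    η[H].hom (val (ε[H].hom h) • c) = (regAct H).hom (el ((E H).hom h) (η[H].hom c)) := by
  rw [map_smul, one_hom_apply, el_smul, map_smul, regAct_E, smul_comm]

/-- The morphism `(a ⊗ b) ⊗ c ↦ c a b` from `H^e_E ⊗̂_H ℂ` to `H`. -/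
def augmentation : Extend (E H) (triv H) ⟶ regBimod H :=
  extend (E H) ⟨(toRes (E H) (regBimod H)).comp η[H].hom, fun h c =>
    (congrArg (toRes (E H) (regBimod H)) ((congrArg η[H].hom (triv_act H h c)).trans
      (one_hom_triv_act H h c))).trans (toRes_act (E H) (regBimod H) h (η[H].hom c))⟩

/-- The augmentation as a morphism to the underlying space of `H`. -/
def augHom : (Extend (E H) (triv H)).X ⟶ H := (augmentation H).hom

/-- `c ↦ c`, to the underlying space of the trivial module. -/
def toTriv : 𝟙_ LCS.{u} ⟶ (triv H).X := 𝟙 (𝟙_ LCS.{u})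

/-- The map `w ↦ w ⊗ 1` from `H^e` to `H^e_E ⊗̂_H ℂ`. -/
def cls : Env H ⟶ (Extend (E H) (triv H)).X :=
  elR (Env H) ((toTriv H).hom (scal 1)) ≫ toExtend (E H) (triv H)

theorem etel_toTriv (w : Env H) (c : (𝟙_ LCS.{u})) :
    etel (E H) w ((toTriv H).hom c) = val c • (cls H).hom w := by
  conv_lhs => rw [← val_smul c]
  exact map_smul ((etelL (E H) (triv H) w).comp (toTriv H).hom) _ _

theorem augHom_etel (a b : H) (c : (𝟙_ LCS.{u})) :
    (augHom H).hom (etel (E H) (envElt H a b) ((toTriv H).hom c)) = val c • mulElt H a b := by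
  refine (extend_etel (E H) _ _ _).trans ?_
  have e : (regAct H).hom (el (envElt H a b) (η[H].hom c)) = val c • mulElt H a b := by
    rw [one_hom_apply, el_smul, map_smul, regAct_el, one_mulElt]
  exact e

theorem augHom_cls (a b : H) : (augHom H).hom ((cls H).hom (envElt H a b)) = mulElt H a b := by
  have e := augHom_etel H a b (scal 1)
  rw [etel_toTriv, val_scal, one_smul, one_smul] at e
  exact e

/-- The relation `w E(h) ⊗ 1 = ε(h) (w ⊗ 1)`. -/
theorem cls_mul_E (w : Env H) (h : H) :
    (cls H).hom (mulElt (Env H) w ((E H).hom h)) = val (ε[H].hom h) • (cls H).hom w := by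
  refine (etel_mul (Y := triv H) (E H) w h ((toTriv H).hom (scal 1))).trans ?_
  exact (congrArg (etel (E H) w) (triv_act H h (scal 1))).trans
    (map_smul ((etelL (E H) (triv H) w).comp (toTriv H).hom) _ _)

/-- `(a b ⊗ 1) ⊗ 1 = (a ⊗ b) ⊗ 1`, since `a b ⊗ 1 = (a ⊗ b₂) E(b₁)`. -/
theorem cls_mul_one (a b : H) :
    (cls H).hom (envElt H (mulElt H a b) (oneElt H)) = (cls H).hom (envElt H a b) := by
  have e (d : (H ⊗ H : LCS.{u})) := el_extL (mulE a (oneElt H) ≫ cls H)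
    (ε[H] ▷ H ≫ (λ_ H).hom ≫ elL H a ≫ toEnv H ≫ cls H) (fun x y => by
      rw [comp_apply, mulE_el, mulElt_one, cls_mul_E, comp_apply, whiskerRight_el, comp_apply,
        leftUnitor_hom_el, map_smul, comp_apply, comp_apply, elL_apply, toEnv_el]) d
  have e' := e (Δ[H].hom b)
  have e₂ : (ε[H] ▷ H).hom (Δ[H].hom b) = (λ_ H).inv.hom b :=
    congrArg (fun k => LCS.Hom.hom k b) (ComonObj.counit_comul H)
  rw [comp_apply, mulE_comul, comp_apply, e₂, leftUnitor_inv_apply, comp_apply, leftUnitor_hom_el,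
    val_scal, one_smul, comp_apply, comp_apply, elL_apply, toEnv_el] at e'
  exact e'

/-- The map `a ↦ (a ⊗ 1) ⊗ 1`, inverse to the augmentation. -/
def augmentationInv : H ⟶ (Extend (E H) (triv H)).X := elR H (oneElt H) ≫ toEnv H ≫ cls H

theorem augmentationInv_apply (a : H) :
    (augmentationInv H).hom a = (cls H).hom (envElt H a (oneElt H)) := rfl

theorem augHom_augmentationInv (a : H) : (augHom H).hom ((augmentationInv H).hom a) = a := by
  rw [augmentationInv_apply, augHom_cls, mulElt_one]

theorem augmentationInv_augHom (w : (Extend (E H) (triv H)).X) :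
    (augmentationInv H).hom ((augHom H).hom w) = w := by
  refine etel_ext (g := (augmentationInv H).hom.comp (augHom H).hom)
    (h := ContinuousLinearMap.id ℂ _) (fun v c => ?_) w
  have e₁ (v : Env H) : (augmentationInv H).hom ((augHom H).hom ((cls H).hom v)) =
      (cls H).hom v :=
    env_ext_apply (f := (cls H ≫ augHom H ≫ augmentationInv H).hom) (g := (cls H).hom)
      (fun a b => by
        rw [comp_apply, comp_apply, augHom_cls, augmentationInv_apply, cls_mul_one]) v
  have e₂ (c : (𝟙_ LCS.{u})) : (augmentationInv H).hom ((augHom H).hom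
      (etel (E H) v ((toTriv H).hom c))) = etel (E H) v ((toTriv H).hom c) := by
    rw [etel_toTriv, map_smul, map_smul, e₁]
  exact e₂ c

/-- The isomorphism `H^e_E ⊗̂_H ℂ ≅ H`. -/
def augmentationIso : Extend (E H) (triv H) ≅ regBimod H :=
  modIso (augmentation H) (augmentationInv H) (augmentationInv_augHom H)
    (augHom_augmentationInv H)

/-- A projective resolution of `ℂ` induces a projective bimodule resolution of `H`. -/
theorem isProjectiveResolution_induce {P : AugComplex (triv H)} (hP : P.IsProjectiveResolution) :
    ((P.induce (BiMod.ofHom (E H))).compAug (augmentationIso H).hom).IsProjectiveResolution :=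
  ⟨(AugComplex.IsAdmissible.induce (E H) (envSection H) (envGen H) envSection_mul_E
    freeRightDesc_envSection hP.1).compAug (augmentationIso H),
    fun n => IsProjective.extend (E H) (hP.2 n)⟩

end Induced

end

end LCS

theorem mainTheorem6 (H : LCS.{u}) [HopfObj H] (hS : IsIso 𝒮[H]) :
    (∃ φ : (HE H).tensor (triv H) ≅ regBimod H,
      (∀ (a b : H) (c : (𝟙_ LCS.{u})),
        φ.hom.hom.hom (tel (X := (HE H).toRMod) (Y := triv H) (envElt H a b) c) =
          val c • mulElt H a b) ∧
      ∀ P : AugComplex (triv H), P.IsProjectiveResolution →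
        ((P.induce (HE H)).compAug φ.hom).IsProjectiveResolution) ∧
    ∀ (P : AugComplex (triv H)) (Q : AugComplex (regBimod H)),
      P.IsProjectiveResolution → Q.IsProjectiveResolution → ∀ n : ℕ,
        (∃ Φ : ∀ M : Mod LCS.{u} (Env H), LCS.Ext Q M n ≃ₗ[ℂ] LCS.Ext P (leftE H M) n,
          ∀ (M N : Mod LCS.{u} (Env H)) (f : M ⟶ N) (x : LCS.Ext Q M n),
            Φ N (ExtMap Q f n x) = ExtMap P (leftEHom H f) n (Φ M x)) ∧
        ∃ Ψ : ∀ M : Mod LCS.{u} (Env H), LCS.Tor (toRight M) Q n ≃L[ℂ] LCS.Tor (rightE H M) P n,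
          ∀ (M N : Mod LCS.{u} (Env H)) (f : M ⟶ N) (x : LCS.Tor (toRight M) Q n),
            Ψ N (TorMap Q (toRightHom f) n x) = TorMap P (rightEHom H f) n (Ψ M x) := by
  refine ⟨⟨LCS.augmentationIso H, LCS.augHom_etel H,
    fun P hP => LCS.isProjectiveResolution_induce H hP⟩, fun P Q hP hQ n => ?_⟩
  obtain ⟨f, g, hfg, hgf⟩ := hQ.exists_homotopyEquiv (LCS.isProjectiveResolution_induce H hP)
  refine ⟨⟨fun M => (AugComplex.extEquiv f g hfg hgf M n).trans
      (LCS.extInduceEquiv (LCS.E H) P M n), fun M N k x => ?_⟩,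
    ⟨fun M => (AugComplex.torEquiv (toRight M) f g hfg hgf n).trans
      (LCS.torInduceEquiv (LCS.E H) P (toRight M) n), fun M N k x => ?_⟩⟩
  · exact (congrArg (LCS.extInduceEquiv (LCS.E H) P N n)
      (AugComplex.extEquiv_natural f g hfg hgf k n x)).trans
        (LCS.extInduceEquiv_natural (LCS.E H) P k n _)
  · exact (congrArg (LCS.torInduceEquiv (LCS.E H) P (toRight N) n)
      (AugComplex.torEquiv_natural f g hfg hgf (toRightHom k) n x)).trans
        (LCS.torInduceEquiv_natural (LCS.E H) P (toRightHom k) n _)
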